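/- In the problem MAXSPACE-R (MAXSPACE with release dates) one is given $K$ slots $B_1,\dots,B_K$ of size $1$ and $n$ ads; ad $A_i$ has a rational size $0<s_i\le 1$, a frequency $w_i\ge 1$ and a release date $r_i\ge 1$ with $w_i\le K-r_i+1$. A feasible schedule of a set $\mathcal A'$ of ads assigns to each slot $B_j$ a subset of $\mathcal A'$ such that every $A_i\in\mathcal A'$ appears in exactly $w_i$ slots (at most one copy per slot), $A_i\in B_j$ only if $j\ge r_i$, and the fullness $f(B_j)=\sum_{A_i\in B_j}s_i$ of every slot is at most $1$. The goal is to choose $\mathcal A'$ and a feasible schedule of it that maximizes $\sum_{j=1}^K f(B_j)$. Consider the following algorithm Alg\_General. It splits the ads into the large ones $G$ ($s_i>1/2$), the medium ones $M$ ($1/4<s_i\le 1/2$) and the small ones $P$ ($s_i\le 1/4$), runs one subroutine on each class, and returns the best of the three schedules. In each subroutine the ads are processed in non-decreasing order of release dates; write $m[i,j]$ for a table indexed by the number $i$ of processed ads and $0\le j\le K$. * Large ads: put $m[0,j]=0$ for all $j$; if $A_i$ is the $i$-th ad, put $m[i,j]=m[i-1,j]$ for $j<r_i+w_i-1$ and $m[i,j]=\max\{m[i-1,j],\,m[i-1,j-w_i]+s_iw_i\}$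 for $j\ge r_i+w_i-1$. A schedule of value $m[|G|,K]$ is obtained by backtracking, an ad that is taken in column $j$ being placed in the slots $j-w_i+1,\dots,j$. * Medium ads: start with empty slots. For each ad $A_i$ start with $X=\emptyset$ and repeat $w_i$ times: (a) if some $j\notin X$ with $j\ge r_i$ has $f(B_j)<1/4$, add the smallest such $j$ to $X$; otherwise (c) if some $j\notin X$ with $j\ge r_i$ has $f(B_j)\le 1-s_i$, add to $X$ an index $j\notin X$, $j\ge r_i$, that minimizes $f(B_j)$; otherwise discard $A_i$ and go to the next ad. If $A_i$ was not discarded, add a copy of it to $B_j$ for each $j\in X$. * Small ads: the same, but between (a) and (c) the following case is tried: (b) if there are $j_1\in X$ and $j_2\notin X$ with $j_1,j_2\ge r_i$, $f(B_{j_1})<1/4$ and $f(B_{j_2})\ge 3/4$, take the smallest such $j_1$ and the smallest such $j_2$, move from $B_{j_2}$ to $B_{j_1}$ a set of ads of $B_{j_2}\setminus B_{j_1}$ of total size between $1/4$ and $1/2$, and add $j_2$ to $X$. Ties are broken by a fixed rule: the smallest index is taken in (c), and in (b) ads of $B_{j_2}\setminus B_{j_1}$ are collected one by one until their total size is at least $1/4$.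 **Theorem.** Alg\_General is a polynomial-time $1/9$-approximation algorithm for MAXSPACE-R, assuming that $K$ is polynomially bounded. That is: 1. on every instance it returns a feasible schedule whose value is at least $1/9$ of the value of every feasible schedule; 2. for every polynomial $q$ there is a polynomial $p$ such that on every instance whose binary encoding has length $N$ and in which $K\le q(N)$, the algorithm makes at most $p(N)$ steps, where every elementary list operation costs at least one step, reading, adding, subtracting and comparing natural numbers costs the sum of their binary lengths, and every arithmetic operation or comparison that involves rationals costs the square of the sum of the binary lengths of its operands. Moreover, the subroutine for large ads is exact on every set of large ads, and the subroutines for medium and for small ads are $1/4$-approximations on every set of medium, respectively small, ads (each returns a feasible schedule of ads of the given set). -/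

import Mathlib

namespace MaxSpace

/-! ## The problem MAXSPACE-R (slots normalised to size 1) -/

/-- An instance of MAXSPACE-R: `K` slots of size `1` and `n` ads. Ad `i` has a rational size
`s i`, a frequency `w i` and a release date `r i`; slots are numbered from `1` to `K`. -/
structure Instance where
  n : ℕ
  K : ℕ
  s : Fin n → ℚ
  w : Fin n → ℕ
  r : Fin n → ℕ
  s_pos : ∀ i, 0 < s i
  s_le_one : ∀ i, s i ≤ 1
  w_pos : ∀ i, 1 ≤ w i
  r_pos : ∀ i, 1 ≤ r i
  /-- The frequency is compatible with the release date: `w i ≤ K - r i + 1`. -/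
  compatible : ∀ i, r i + w i ≤ K + 1

/-- A schedule: the set of ads displayed in each slot. The index `j : Fin K` stands for slot
number `j + 1`. -/
abbrev Schedule (I : Instance) : Type := Fin I.K → Finset (Fin I.n)

/-- The fullness of slot `j`. -/
def Schedule.fullness {I : Instance} (B : Schedule I) (j : Fin I.K) : ℚ := ∑ i ∈ B j, I.s i

/-- The fullness of a schedule, which is the objective function. -/
def Schedule.value {I : Instance} (B : Schedule I) : ℚ := ∑ j, B.fullness j

/-- `B` is a feasible schedule of some subset `A'` of the ads `A`: only ads of `A'` are displayed,
every ad of `A'` is displayed in exactly `w i` slots, no slot is overfull, and no ad is displayed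
before its release date. -/
def Schedule.Feasible {I : Instance} (A : Finset (Fin I.n)) (B : Schedule I) : Prop :=
  ∃ A' ⊆ A,
    (∀ j, B j ⊆ A') ∧
    (∀ i ∈ A', (Finset.univ.filter fun j => i ∈ B j).card = I.w i) ∧
    (∀ j, B.fullness j ≤ 1) ∧
    (∀ j, ∀ i ∈ B j, I.r i ≤ (j : ℕ) + 1)

/-- The list representation of schedules used by the algorithms: the list of the `K` slots in
order, each slot being the list of the ads displayed in it. -/
abbrev Slots (I : Instance) : Type := List (List (Fin I.n))

/-- The list `L` represents the schedule `B`: there are `K` slots, and each slot is listed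
without repetitions. -/
def Represents {I : Instance} (L : Slots I) (B : Schedule I) : Prop :=
  L.length = I.K ∧ (∀ b ∈ L, b.Nodup) ∧ ∀ j : Fin I.K, B j = (L.getD j []).toFinset

/-- `L` is a feasible schedule of ads of `A` whose value is at least `α` times the value of every
feasible schedule of ads of `A` (hence at least `α` times the optimum). -/
def IsApproxSolution (I : Instance) (A : Finset (Fin I.n)) (α : ℚ) (L : Slots I) : Prop :=
  ∃ B : Schedule I, Represents L B ∧ B.Feasible A ∧
    ∀ S : Schedule I, S.Feasible A → α * S.value ≤ B.value

/-! ## Input size and cost model -/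

/-- Length of the binary encoding of a natural number. -/
def natBits (a : ℕ) : ℕ := a.size + 1

/-- Length of the binary encoding of a rational number. -/
def ratBits (q : ℚ) : ℕ := natBits q.num.natAbs + natBits q.den

/-- Length of the binary encoding of an instance. -/
def Instance.size (I : Instance) : ℕ :=
  natBits I.K + ∑ i, (ratBits (I.s i) + natBits (I.w i) + natBits (I.r i))

/-- A computation, recorded as its result together with the number of steps that it takes. -/
structure Timed (α : Type) where
  val : α
  cost : ℕ

instance : Monad Timed where
  pure a := ⟨a, 0⟩
  bind x f := ⟨(f x.val).val, x.cost + (f x.val).cost⟩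

/-- Spend `c` steps. Every call of a function below spends at least one step, and operations on
numbers spend a number of steps that depends on the lengths of the numbers. -/
def tick (c : ℕ) : Timed Unit := ⟨(), c⟩

def addNat (a b : ℕ) : Timed ℕ := ⟨a + b, natBits a + natBits b⟩

def subNat (a b : ℕ) : Timed ℕ := ⟨a - b, natBits a + natBits b⟩

def leNat (a b : ℕ) : Timed Bool := ⟨decide (a ≤ b), natBits a + natBits b⟩

def eqNat (a b : ℕ) : Timed Bool := ⟨decide (a = b), natBits a + natBits b⟩

/-- Rational arithmetic and comparisons are charged quadratically in the lengths of the operands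
(schoolbook arithmetic). -/
def addRat (p q : ℚ) : Timed ℚ := ⟨p + q, (ratBits p + ratBits q) ^ 2⟩

def subRat (p q : ℚ) : Timed ℚ := ⟨p - q, (ratBits p + ratBits q) ^ 2⟩

def mulNatRat (a : ℕ) (q : ℚ) : Timed ℚ := ⟨(a : ℚ) * q, (natBits a + ratBits q) ^ 2⟩

def leRat (p q : ℚ) : Timed Bool := ⟨decide (p ≤ q), (ratBits p + ratBits q) ^ 2⟩

def ltRat (p q : ℚ) : Timed Bool := ⟨decide (p < q), (ratBits p + ratBits q) ^ 2⟩

/-- Reading the entries of the input costs the length of the address and of the content. -/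
def readSize (I : Instance) (i : Fin I.n) : Timed ℚ := ⟨I.s i, natBits i + ratBits (I.s i)⟩

def readFreq (I : Instance) (i : Fin I.n) : Timed ℕ := ⟨I.w i, natBits i + natBits (I.w i)⟩

def readRel (I : Instance) (i : Fin I.n) : Timed ℕ := ⟨I.r i, natBits i + natBits (I.r i)⟩

def readK (I : Instance) : Timed ℕ := ⟨I.K, natBits I.K⟩

/-! ## Elementary procedures -/

def memNat (a : ℕ) : List ℕ → Timed Bool
  | [] => do
    tick 1
    pure false
  | x :: t => do
    tick 1
    let e ← eqNat a x
    if e then pure true else memNat a t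

def memAd {n : ℕ} (i : Fin n) : List (Fin n) → Timed Bool
  | [] => do
    tick 1
    pure false
  | x :: t => do
    tick 1
    let e ← eqNat i x
    if e then pure true else memAd i t

/-- The ads of the first list that are not in the second one. -/
def diffAds {n : ℕ} : List (Fin n) → List (Fin n) → Timed (List (Fin n))
  | [], _ => do
    tick 1
    pure []
  | i :: t, c => do
    tick 1
    let e ← memAd i c
    let rest ← diffAds t c
    if e then pure rest else pure (i :: rest)

def appendAds {n : ℕ} : List (Fin n) → List (Fin n) → Timed (List (Fin n))
  | [], c => do
    tick 1
    pure c
  | i :: t, c => do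
    tick 1
    let rest ← appendAds t c
    pure (i :: rest)

/-- The total size of a list of ads. -/
def totalSize (I : Instance) : List (Fin I.n) → Timed ℚ
  | [] => do
    tick 1
    pure 0
  | i :: t => do
    tick 1
    let f ← totalSize I t
    let si ← readSize I i
    addRat si f

/-- The fullness of a list of slots. -/
def totalValue (I : Instance) : Slots I → Timed ℚ
  | [] => do
    tick 1
    pure 0
  | b :: t => do
    tick 1
    let v ← totalValue I t
    let f ← totalSize I b
    addRat f v

/-- `k` empty slots. -/
def emptySlots (I : Instance) : ℕ → Timed (Slots I)
  | 0 => do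
    tick 1
    pure []
  | k + 1 => do
    tick (natBits (k + 1))
    let rest ← emptySlots I k
    pure ([] :: rest)

/-- The content of slot number `j` when the first slot of the list has number `j₀`. -/
def getSlot (I : Instance) (j : ℕ) : ℕ → Slots I → Timed (List (Fin I.n))
  | _, [] => do
    tick 1
    pure []
  | j₀, b :: t => do
    tick 1
    let e ← eqNat j j₀
    let j₁ ← addNat j₀ 1
    if e then pure b else getSlot I j j₁ t

/-- Replace the content of slot number `j` when the first slot of the list has number `j₀`. -/
def setSlot (I : Instance) (j : ℕ) (c : List (Fin I.n)) : ℕ → Slots I → Timed (Slots I)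
  | _, [] => do
    tick 1
    pure []
  | j₀, b :: t => do
    tick 1
    let e ← eqNat j j₀
    let j₁ ← addNat j₀ 1
    let rest ← setSlot I j c j₁ t
    if e then pure (c :: t) else pure (b :: rest)

/-- Add a copy of ad `i` to every slot whose number is in `X`, when the first slot of the list has
number `j₀`. -/
def addCopies (I : Instance) (i : Fin I.n) (X : List ℕ) : ℕ → Slots I → Timed (Slots I)
  | _, [] => do
    tick 1
    pure []
  | j₀, b :: t => do
    tick 1
    let e ← memNat j₀ X
    let j₁ ← addNat j₀ 1
    let rest ← addCopies I i X j₁ t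
    if e then pure ((i :: b) :: rest) else pure (b :: rest)

/-- The smallest slot number that satisfies the test `p`, when the first slot of the list has
number `j₀`. -/
def findSlot (I : Instance) (p : ℕ → List (Fin I.n) → Timed Bool) :
    ℕ → Slots I → Timed (Option ℕ)
  | _, [] => do
    tick 1
    pure none
  | j₀, b :: t => do
    tick 1
    let e ← p j₀ b
    let j₁ ← addNat j₀ 1
    if e then pure (some j₀) else findSlot I p j₁ t

/-- Insert an ad into a list of ads that is sorted by release date. -/
def insertAd (I : Instance) (i : Fin I.n) : List (Fin I.n) → Timed (List (Fin I.n))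
  | [] => do
    tick 1
    pure [i]
  | x :: t => do
    tick 1
    let ri ← readRel I i
    let rx ← readRel I x
    let e ← leNat ri rx
    if e then pure (i :: x :: t)
    else do
      let rest ← insertAd I i t
      pure (x :: rest)

/-- Sort a list of ads in non-decreasing order of release dates. -/
def sortAds (I : Instance) : List (Fin I.n) → Timed (List (Fin I.n))
  | [] => do
    tick 1
    pure []
  | i :: t => do
    tick 1
    let rest ← sortAds I t
    insertAd I i rest

/-! ## Large ads: dynamic programming -/

def zeros : ℕ → Timed (List ℚ)
  | 0 => do
    tick 1
    pure []
  | k + 1 => do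
    tick (natBits (k + 1))
    let rest ← zeros k
    pure (0 :: rest)

/-- Entry `j` of a row (counted from `0`). -/
def entry : List ℚ → ℕ → Timed ℚ
  | [], _ => do
    tick 1
    pure 0
  | x :: _, 0 => do
    tick 1
    pure x
  | _ :: t, j + 1 => do
    tick (natBits (j + 1))
    entry t j

/-- The list of the numbers `a + 1, …, a + k`. -/
def interval : ℕ → ℕ → Timed (List ℕ)
  | _, 0 => do
    tick 1
    pure []
  | a, k + 1 => do
    tick (natBits (k + 1))
    let a' ← addNat a 1
    let rest ← interval a' k
    pure (a' :: rest)

/-- The entry `m[i, j]`, computed from the row `prev` of the entries `m[i-1, ·]`. -/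
def dpEntry (I : Instance) (i : Fin I.n) (prev : List ℚ) (j : ℕ) : Timed ℚ := do
  tick 1
  let si ← readSize I i
  let wi ← readFreq I i
  let ri ← readRel I i
  let y ← addNat ri wi
  let x ← subNat y 1
  let a ← entry prev j
  let e ← leNat x j
  if e then do
    let j' ← subNat j wi
    let b ← entry prev j'
    let p ← mulNatRat wi si
    let c ← addRat b p
    let d ← leRat a c
    if d then pure c else pure a
  else pure a

/-- The entries `m[i, j], …, m[i, j + k - 1]`, computed from the previous row. -/
def dpRow (I : Instance) (i : Fin I.n) (prev : List ℚ) : ℕ → ℕ → Timed (List ℚ)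
  | _, 0 => do
    tick 1
    pure []
  | j, k + 1 => do
    tick (natBits (k + 1))
    let a ← dpEntry I i prev j
    let j' ← addNat j 1
    let rest ← dpRow I i prev j' k
    pure (a :: rest)

/-- Process the ads of the list in order, starting from the current row. Returns the last row and,
latest ad first, the processed ads, each with the row before it. -/
def dpTable (I : Instance) : List (Fin I.n) → List ℚ → List (Fin I.n × List ℚ) →
    Timed (List ℚ × List (Fin I.n × List ℚ))
  | [], row, st => do
    tick 1
    pure (row, st)
  | i :: t, row, st => do
    tick 1
    let k ← readK I
    let k' ← addNat k 1
    let row' ← dpRow I i row 0 k'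
    dpTable I t row' ((i, row) :: st)

/-- Backtracking in the matrix from column `j`: if `m[i, j] > m[i-1, j]`, then ad `i` is displayed
in the slots `j - w i + 1, …, j`. -/
def dpBacktrack (I : Instance) : List (Fin I.n × List ℚ) → List ℚ → ℕ → Slots I →
    Timed (Slots I)
  | [], _, _, B => do
    tick 1
    pure B
  | (i, prev) :: st, row, j, B => do
    tick 1
    let a ← entry prev j
    let b ← entry row j
    let e ← ltRat a b
    if e then do
      let wi ← readFreq I i
      let j' ← subNat j wi
      let X ← interval j' wi
      let B' ← addCopies I i X 1 B
      dpBacktrack I st prev j' B'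
    else dpBacktrack I st prev j B

/-- The algorithm for a list of large ads. -/
def algLarge (I : Instance) (G : List (Fin I.n)) : Timed (Slots I) := do
  tick 1
  let k ← readK I
  let k' ← addNat k 1
  let row ← zeros k'
  let L ← sortAds I G
  let m ← dpTable I L row []
  let B ← emptySlots I k
  dpBacktrack I m.2 m.1 k B

/-! ## Tests on slots, relative to an ad `i` and a set `X` of slot numbers -/

/-- `j ∉ X`, `j ≥ r i` and `f(B_j) < 1/4`. -/
def isLowFree (I : Instance) (i : Fin I.n) (X : List ℕ) (j : ℕ) (b : List (Fin I.n)) :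
    Timed Bool := do
  tick 1
  let x ← memNat j X
  let ri ← readRel I i
  let c ← leNat ri j
  let f ← totalSize I b
  let d ← ltRat f (1 / 4)
  pure (!x && c && d)

/-- `j ∈ X`, `j ≥ r i` and `f(B_j) < 1/4`. -/
def isLowUsed (I : Instance) (i : Fin I.n) (X : List ℕ) (j : ℕ) (b : List (Fin I.n)) :
    Timed Bool := do
  tick 1
  let x ← memNat j X
  let ri ← readRel I i
  let c ← leNat ri j
  let f ← totalSize I b
  let d ← ltRat f (1 / 4)
  pure (x && c && d)

/-- `j ∉ X`, `j ≥ r i` and `f(B_j) ≥ 3/4`. -/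
def isHighFree (I : Instance) (i : Fin I.n) (X : List ℕ) (j : ℕ) (b : List (Fin I.n)) :
    Timed Bool := do
  tick 1
  let x ← memNat j X
  let ri ← readRel I i
  let c ← leNat ri j
  let f ← totalSize I b
  let d ← leRat (3 / 4) f
  pure (!x && c && d)

/-- `j ∉ X`, `j ≥ r i` and `f(B_j) ≤ 1 - s i`. -/
def isRoomFree (I : Instance) (i : Fin I.n) (X : List ℕ) (j : ℕ) (b : List (Fin I.n)) :
    Timed Bool := do
  tick 1
  let x ← memNat j X
  let ri ← readRel I i
  let c ← leNat ri j
  let f ← totalSize I b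
  let si ← readSize I i
  let u ← subRat 1 si
  let d ← leRat f u
  pure (!x && c && d)

/-- The first slot number `j` that minimises `f(B_j)` over all `j ∉ X` with `j ≥ r i`, together
with `f(B_j)`, when the first slot of the list has number `j₀`. -/
def leastFull (I : Instance) (i : Fin I.n) (X : List ℕ) : ℕ → Slots I → Timed (Option (ℕ × ℚ))
  | _, [] => do
    tick 1
    pure none
  | j₀, b :: t => do
    tick 1
    let j₁ ← addNat j₀ 1
    let rest ← leastFull I i X j₁ t
    let x ← memNat j₀ X
    let ri ← readRel I i
    let c ← leNat ri j₀
    let f ← totalSize I b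
    if !x && c then
      match rest with
      | none => pure (some (j₀, f))
      | some (j, g) => do
        let d ← leRat f g
        if d then pure (some (j₀, f)) else pure (some (j, g))
    else pure rest

/-! ## Medium ads -/

/-- Choose `k` further slots for copies of ad `i`, in addition to the slots in `X`; the result is
`none` if the ad has to be discarded. -/
def mediumLoop (I : Instance) (i : Fin I.n) (B : Slots I) : ℕ → List ℕ → Timed (Option (List ℕ))
  | 0, X => do
    tick 1
    pure (some X)
  | k + 1, X => do
    tick (natBits (k + 1))
    let a ← findSlot I (isLowFree I i X) 1 B
    match a with
    | some j => mediumLoop I i B k (j :: X)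
    | none => do
      let c ← findSlot I (isRoomFree I i X) 1 B
      match c with
      | none => pure none
      | some _ => do
        let d ← leastFull I i X 1 B
        match d with
        | none => pure none
        | some (j, _) => mediumLoop I i B k (j :: X)

def mediumAds (I : Instance) : List (Fin I.n) → Slots I → Timed (Slots I)
  | [], B => do
    tick 1
    pure B
  | i :: t, B => do
    tick 1
    let wi ← readFreq I i
    let o ← mediumLoop I i B wi []
    match o with
    | none => mediumAds I t B
    | some X => do
      let B' ← addCopies I i X 1 B
      mediumAds I t B'

/-- The algorithm for a list of medium ads. -/
def algMedium (I : Instance) (M : List (Fin I.n)) : Timed (Slots I) := do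
  tick 1
  let k ← readK I
  let B ← emptySlots I k
  let L ← sortAds I M
  mediumAds I L B

/-! ## Small ads -/

/-- Take ads from the list until, together with `acc`, their total size is at least `1/4`. -/
def takeQuarter (I : Instance) : List (Fin I.n) → ℚ → Timed (List (Fin I.n))
  | [], _ => do
    tick 1
    pure []
  | i :: t, acc => do
    tick 1
    let e ← leRat (1 / 4) acc
    if e then pure []
    else do
      let si ← readSize I i
      let acc' ← addRat acc si
      let rest ← takeQuarter I t acc'
      pure (i :: rest)

/-- Move from slot `j₂` to slot `j₁` a set of ads that are not in slot `j₁` and have total size at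
least `1/4` and at most `1/2`. -/
def moveAds (I : Instance) (j₁ j₂ : ℕ) (B : Slots I) : Timed (Slots I) := do
  tick 1
  let b₁ ← getSlot I j₁ 1 B
  let b₂ ← getSlot I j₂ 1 B
  let D ← diffAds b₂ b₁
  let T ← takeQuarter I D 0
  let c₁ ← appendAds T b₁
  let c₂ ← diffAds b₂ T
  let B' ← setSlot I j₁ c₁ 1 B
  setSlot I j₂ c₂ 1 B'

/-- Choose `k` further slots for copies of ad `i`, in addition to the slots in `X`, possibly moving
other ads; the second component is `none` if the ad has to be discarded. -/
def smallLoop (I : Instance) (i : Fin I.n) :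
    ℕ → List ℕ → Slots I → Timed (Slots I × Option (List ℕ))
  | 0, X, B => do
    tick 1
    pure (B, some X)
  | k + 1, X, B => do
    tick (natBits (k + 1))
    let a ← findSlot I (isLowFree I i X) 1 B
    match a with
    | some j => smallLoop I i k (j :: X) B
    | none => do
      let u ← findSlot I (isLowUsed I i X) 1 B
      let v ← findSlot I (isHighFree I i X) 1 B
      match u, v with
      | some j₁, some j₂ => do
        let B' ← moveAds I j₁ j₂ B
        smallLoop I i k (j₂ :: X) B'
      | _, _ => do
        let c ← findSlot I (isRoomFree I i X) 1 B
        match c with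
        | none => pure (B, none)
        | some _ => do
          let d ← leastFull I i X 1 B
          match d with
          | none => pure (B, none)
          | some (j, _) => smallLoop I i k (j :: X) B

def smallAds (I : Instance) : List (Fin I.n) → Slots I → Timed (Slots I)
  | [], B => do
    tick 1
    pure B
  | i :: t, B => do
    tick 1
    let wi ← readFreq I i
    let o ← smallLoop I i wi [] B
    match o with
    | (B', none) => smallAds I t B'
    | (B', some X) => do
      let B'' ← addCopies I i X 1 B'
      smallAds I t B''

/-- The algorithm for a list of small ads. -/
def algSmall (I : Instance) (P : List (Fin I.n)) : Timed (Slots I) := do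
  tick 1
  let k ← readK I
  let B ← emptySlots I k
  let L ← sortAds I P
  smallAds I L B

/-! ## The general algorithm -/

/-- Split a list of ads into the large (`s i > 1/2`), the medium (`1/4 < s i ≤ 1/2`) and the small
(`s i ≤ 1/4`) ones. -/
def splitAds (I : Instance) :
    List (Fin I.n) → Timed (List (Fin I.n) × List (Fin I.n) × List (Fin I.n))
  | [] => do
    tick 1
    pure ([], [], [])
  | i :: t => do
    tick 1
    let R ← splitAds I t
    let si ← readSize I i
    let a ← ltRat (1 / 2) si
    let b ← ltRat (1 / 4) si
    if a then pure (i :: R.1, R.2.1, R.2.2)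
    else if b then pure (R.1, i :: R.2.1, R.2.2)
    else pure (R.1, R.2.1, i :: R.2.2)

/-- The better of two schedules. -/
def better (I : Instance) (S T : Slots I) : Timed (Slots I) := do
  tick 1
  let a ← totalValue I S
  let b ← totalValue I T
  let e ← leRat b a
  if e then pure S else pure T

/-- The algorithm for the general case: the best of the schedules computed for the large, the
medium and the small ads. -/
def algGeneral (I : Instance) : Timed (Slots I) := do
  tick 1
  let R ← splitAds I (List.finRange I.n)
  let S₁ ← algLarge I R.1
  let S₂ ← algMedium I R.2.1
  let S₃ ← algSmall I R.2.2
  let S ← better I S₁ S₂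
  better I S S₃

end MaxSpace

/-! A feasible schedule restricted to one size class stays feasible, so OPT is at most the sum of
the optima of the three classes. If the subroutines return values a, b, c for the large, medium and
small ads, exactness on the first class and the factor 4 on the others give OPT ≤ a + 4b + 4c ≤ 9
max(a, b, c).

Large ads. Two of them never share a slot, so in a feasible schedule the ads released at `r i` or
later occupy disjoint sets of slots among `r i, …, K`; hence `r i` plus the sum of their frequencies
is at most `K + 1`. This necessary counting condition already implies the upper bound by the table
(`sum_le_dp`): the ad of latest release is counted in the condition of every other ad, so removing
it and `w` columns preserves the condition. Conversely, backtracking realises the table value by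
consecutive blocks (`dpBacktrack_spec`).

Medium and small ads. Call a slot low if its fullness is below 1/4. Both subroutines satisfy the
criterion of `quarter_value_le`: an ad that is released in time for a low slot and missing there has
all its copies in strictly earlier slots. Let `j₀` be the last low slot of such a schedule T and let
S be any feasible schedule. Behind `j₀`, S has at most 1 and T at least 1/4 per slot. Up to `j₀`,
the ads of S that T shows in `j₀` are charged slot by slot to T, and all other ads are charged, copy
for copy, to their own copies in T, which all lie before `j₀`. So S is at most twice T up to `j₀`
and at most four times T behind it.

The criterion, as `LowFilled`, is an invariant. Low slots are chosen from left to right, which is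
the field `before` of `LoopState`. A discarded ad is harmless when no slot from its release date on
is low. For medium ads this follows from `Saturated`: a discard exhibits a slot of fullness above
1/2, such a slot must have received a copy when it was already nonempty, and nonempty slots are used
only after all available low ones. For small ads a discard exhibits a free slot of fullness above
3/4, so a low chosen slot would have triggered a move instead. The move goes to the first low chosen
slot, so moved copies still precede every low slot from which their ad is missing (`move_spec`).

Running time. All rationals that occur are nonnegative multiples of `1 / denom` and at most `bound ^
2`, so their length is linear in `bound` (`Nice.ratBits_le`), which is the input length plus `K +
2`. Every procedure then costs at most a fixed power of `unit`, a large multiple of `bound`; each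
nested loop adds to the exponent, and the spare factor absorbs the constants. -/

namespace MaxSpace

/-! ## Values and costs of the elementary procedures -/

section Timed
variable {α β : Type}

@[simp] theorem Timed.val_bind (x : Timed α) (f : α → Timed β) :
    (x >>= f).val = (f x.val).val := rfl
@[simp] theorem Timed.cost_bind (x : Timed α) (f : α → Timed β) :
    (x >>= f).cost = x.cost + (f x.val).cost := rfl
@[simp] theorem Timed.val_pure (a : α) : (pure a : Timed α).val = a := rfl
@[simp] theorem Timed.cost_pure (a : α) : (pure a : Timed α).cost = 0 := rfl
@[simp] theorem tick_val (c : ℕ) : (tick c).val = () := rfl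
@[simp] theorem tick_cost (c : ℕ) : (tick c).cost = c := rfl
@[simp] theorem addNat_val (a b : ℕ) : (addNat a b).val = a + b := rfl
@[simp] theorem subNat_val (a b : ℕ) : (subNat a b).val = a - b := rfl
@[simp] theorem leNat_val (a b : ℕ) : (leNat a b).val = decide (a ≤ b) := rfl
@[simp] theorem eqNat_val (a b : ℕ) : (eqNat a b).val = decide (a = b) := rfl
@[simp] theorem addRat_val (a b : ℚ) : (addRat a b).val = a + b := rfl
@[simp] theorem subRat_val (a b : ℚ) : (subRat a b).val = a - b := rfl
@[simp] theorem mulNatRat_val (a : ℕ) (b : ℚ) : (mulNatRat a b).val = a * b := rfl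
@[simp] theorem leRat_val (a b : ℚ) : (leRat a b).val = decide (a ≤ b) := rfl
@[simp] theorem ltRat_val (a b : ℚ) : (ltRat a b).val = decide (a < b) := rfl
@[simp] theorem readSize_val (I : Instance) (i : Fin I.n) : (readSize I i).val = I.s i := rfl
@[simp] theorem readFreq_val (I : Instance) (i : Fin I.n) : (readFreq I i).val = I.w i := rfl
@[simp] theorem readRel_val (I : Instance) (i : Fin I.n) : (readRel I i).val = I.r i := rfl
@[simp] theorem readK_val (I : Instance) : (readK I).val = I.K := rfl
@[simp] theorem addNat_cost (a b : ℕ) : (addNat a b).cost = natBits a + natBits b := rfl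
@[simp] theorem subNat_cost (a b : ℕ) : (subNat a b).cost = natBits a + natBits b := rfl
@[simp] theorem leNat_cost (a b : ℕ) : (leNat a b).cost = natBits a + natBits b := rfl
@[simp] theorem eqNat_cost (a b : ℕ) : (eqNat a b).cost = natBits a + natBits b := rfl

end Timed

/-! ### Results of the list procedures as pure functions -/

@[simp] theorem memNat_val (a : ℕ) (l : List ℕ) : (memNat a l).val = decide (a ∈ l) := by
  induction l with
  | nil => simp [memNat]
  | cons x t ih => by_cases h : a = x <;> simp [memNat, h, ih]

@[simp] theorem memAd_val {n : ℕ} (i : Fin n) (l : List (Fin n)) :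
    (memAd i l).val = decide (i ∈ l) := by
  induction l with
  | nil => simp [memAd]
  | cons x t ih =>
    by_cases h : i = x
    · simp [memAd, h]
    · have h' : (i : ℕ) ≠ x := fun e => h (Fin.ext e)
      simp [memAd, h, h', ih]

@[simp] theorem diffAds_val {n : ℕ} (l c : List (Fin n)) :
    (diffAds l c).val = l.filter (· ∉ c) := by
  induction l with
  | nil => simp [diffAds]
  | cons x t ih => by_cases h : x ∈ c <;> simp [diffAds, h, ih]

@[simp] theorem appendAds_val {n : ℕ} (l c : List (Fin n)) : (appendAds l c).val = l ++ c := by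
  induction l with
  | nil => simp [appendAds]
  | cons x t ih => simp [appendAds, ih]

/-- The total size of a list of ads. -/
def sizeSum (I : Instance) (b : List (Fin I.n)) : ℚ := (b.map I.s).sum

@[simp] theorem sizeSum_nil (I : Instance) : sizeSum I [] = 0 := rfl
@[simp] theorem sizeSum_cons (I : Instance) (i : Fin I.n) (b : List (Fin I.n)) :
    sizeSum I (i :: b) = I.s i + sizeSum I b := by simp [sizeSum]
@[simp] theorem sizeSum_append (I : Instance) (b c : List (Fin I.n)) :
    sizeSum I (b ++ c) = sizeSum I b + sizeSum I c := by simp [sizeSum]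

theorem sizeSum_nonneg (I : Instance) (b : List (Fin I.n)) : 0 ≤ sizeSum I b := by
  induction b with
  | nil => simp
  | cons i t ih => have := I.s_pos i; simp only [sizeSum_cons]; linarith

theorem sizeSum_le_length (I : Instance) (b : List (Fin I.n)) : sizeSum I b ≤ b.length := by
  induction b with
  | nil => simp
  | cons i t ih => have := I.s_le_one i; simp only [sizeSum_cons, List.length_cons]; push_cast; linarith

theorem sizeSum_filter_add (I : Instance) (p : Fin I.n → Bool) (b : List (Fin I.n)) :
    sizeSum I (b.filter p) + sizeSum I (b.filter fun i => !p i) = sizeSum I b := by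
  induction b with
  | nil => simp
  | cons i t ih => by_cases h : p i <;> simp [h] <;> linarith

theorem sizeSum_eq_sum {I : Instance} {b : List (Fin I.n)} (h : b.Nodup) :
    sizeSum I b = ∑ i ∈ b.toFinset, I.s i := (List.sum_toFinset _ h).symm

theorem sizeSum_le_of_subset {I : Instance} {b c : List (Fin I.n)} (hb : b.Nodup) (hc : c.Nodup)
    (h : ∀ i ∈ b, i ∈ c) : sizeSum I b ≤ sizeSum I c := by
  rw [sizeSum_eq_sum hb, sizeSum_eq_sum hc]
  refine Finset.sum_le_sum_of_subset_of_nonneg (fun i hi => ?_) fun i _ _ => (I.s_pos i).le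
  simpa using h i (by simpa using hi)

@[simp] theorem totalSize_val (I : Instance) (b : List (Fin I.n)) :
    (totalSize I b).val = sizeSum I b := by
  induction b with
  | nil => simp [totalSize]
  | cons x t ih => simp [totalSize, ih]

/-- The total size of all ads in a list of slots. -/
def slotsSum (I : Instance) (B : Slots I) : ℚ := (B.map (sizeSum I)).sum

@[simp] theorem slotsSum_nil (I : Instance) : slotsSum I [] = 0 := rfl
@[simp] theorem slotsSum_cons (I : Instance) (b : List (Fin I.n)) (B : Slots I) :
    slotsSum I (b :: B) = sizeSum I b + slotsSum I B := by simp [slotsSum]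

@[simp] theorem totalValue_val (I : Instance) (B : Slots I) :
    (totalValue I B).val = slotsSum I B := by
  induction B with
  | nil => simp [totalValue]
  | cons x t ih => simp [totalValue, ih]

@[simp] theorem emptySlots_val (I : Instance) (k : ℕ) :
    (emptySlots I k).val = List.replicate k [] := by
  induction k with
  | zero => simp [emptySlots]
  | succ k ih => simp [emptySlots, ih, List.replicate_succ]

/-- The ads in slot number `j`, where slots are numbered from `1`; there is no slot outside of the
list. -/
def content {I : Instance} (B : Slots I) (j : ℕ) : List (Fin I.n) := ([] :: B).getD j []

@[simp] theorem content_zero {I : Instance} (B : Slots I) : content B 0 = [] := rfl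
@[simp] theorem content_succ {I : Instance} (B : Slots I) (j : ℕ) :
    content B (j + 1) = B.getD j [] := rfl

theorem content_of_pos {I : Instance} (B : Slots I) {j : ℕ} (h : 1 ≤ j) :
    content B j = B.getD (j - 1) [] := by
  obtain ⟨j, rfl⟩ := Nat.exists_eq_add_of_le' h
  simp

theorem content_of_length_lt {I : Instance} (B : Slots I) {j : ℕ} (h : B.length < j) :
    content B j = [] := by
  obtain ⟨j, rfl⟩ := Nat.exists_eq_add_of_le' (show 1 ≤ j by omega)
  simp only [content_succ]
  exact List.getD_eq_default _ _ (by omega)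

theorem mem_Icc_of_mem_content {I : Instance} {B : Slots I} {j : ℕ} {i : Fin I.n}
    (h : i ∈ content B j) : 1 ≤ j ∧ j ≤ B.length := by
  constructor
  · rcases Nat.eq_zero_or_pos j with rfl | h'
    · simp at h
    · exact h'
  · by_contra h'
    rw [content_of_length_lt B (by omega)] at h
    simp at h

theorem content_mem_or_nil {I : Instance} (B : Slots I) (j : ℕ) :
    content B j ∈ B ∨ content B j = [] := by
  rcases Nat.eq_zero_or_pos j with rfl | h
  · right; simp
  · rw [content_of_pos B h]
    by_cases h' : j - 1 < B.length
    · left; rw [List.getD_eq_getElem _ _ h']; exact List.getElem_mem _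
    · right; exact List.getD_eq_default _ _ (by omega)

theorem exists_content_of_mem {I : Instance} {B : Slots I} {b : List (Fin I.n)} (h : b ∈ B) :
    ∃ j, 1 ≤ j ∧ j ≤ B.length ∧ content B j = b := by
  obtain ⟨k, hk, rfl⟩ := List.getElem_of_mem h
  exact ⟨k + 1, by omega, by omega, by rw [content_succ, List.getD_eq_getElem _ _ hk]⟩

/-- The recursion advances the number of the first slot, so the induction needs arbitrary `j₀`; `j₀
≤ j` keeps the truncated subtraction honest. -/
theorem getSlot_val_aux (I : Instance) (j j₀ : ℕ) (h : j₀ ≤ j) (B : Slots I) :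
    (getSlot I j j₀ B).val = B.getD (j - j₀) [] := by
  induction B generalizing j₀ with
  | nil => simp [getSlot]
  | cons b t ih =>
    by_cases e : j = j₀
    · subst e; simp [getSlot]
    · have : j - j₀ = (j - (j₀ + 1)) + 1 := by omega
      simp [getSlot, e, ih (j₀ + 1) (by omega), this]

theorem getSlot_val (I : Instance) (j : ℕ) (h : 1 ≤ j) (B : Slots I) :
    (getSlot I j 1 B).val = content B j := by
  rw [getSlot_val_aux I j 1 h, content_of_pos B h]

theorem setSlot_val_aux (I : Instance) (j j₀ : ℕ) (c : List (Fin I.n)) (h : j₀ ≤ j)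
    (B : Slots I) : (setSlot I j c j₀ B).val = B.set (j - j₀) c := by
  induction B generalizing j₀ with
  | nil => simp [setSlot]
  | cons b t ih =>
    by_cases e : j = j₀
    · subst e; simp [setSlot]
    · have : j - j₀ = (j - (j₀ + 1)) + 1 := by omega
      simp [setSlot, e, ih (j₀ + 1) (by omega), this]

theorem setSlot_length (I : Instance) (j : ℕ) (c : List (Fin I.n)) (h : 1 ≤ j) (B : Slots I) :
    (setSlot I j c 1 B).val.length = B.length := by
  simp [setSlot_val_aux I j 1 c h]

theorem content_setSlot (I : Instance) (j : ℕ) (c : List (Fin I.n)) (B : Slots I) (h : 1 ≤ j)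
    (h' : j ≤ B.length) (k : ℕ) :
    content (setSlot I j c 1 B).val k = if k = j then c else content B k := by
  rw [setSlot_val_aux I j 1 c h]
  rcases Nat.eq_zero_or_pos k with rfl | hk
  · rw [if_neg (by omega)]; simp
  · rw [content_of_pos _ hk, content_of_pos _ hk]
    simp only [List.getD_eq_getElem?_getD, List.getElem?_set]
    by_cases e : k = j
    · subst e; simp [show k - 1 < B.length by omega]
    · simp [e, show ¬ (j - 1 = k - 1) by omega]

theorem addCopies_length (I : Instance) (i : Fin I.n) (X : List ℕ) (j₀ : ℕ) (B : Slots I) :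
    (addCopies I i X j₀ B).val.length = B.length := by
  induction B generalizing j₀ with
  | nil => simp [addCopies]
  | cons b t ih => by_cases h : j₀ ∈ X <;> simp [addCopies, h, ih]

theorem addCopies_getD (I : Instance) (i : Fin I.n) (X : List ℕ) (j₀ : ℕ) (B : Slots I) (k : ℕ)
    (hk : k < B.length) : (addCopies I i X j₀ B).val.getD k [] =
      if j₀ + k ∈ X then i :: B.getD k [] else B.getD k [] := by
  induction B generalizing j₀ k with
  | nil => simp at hk
  | cons b t ih =>
    cases k with
    | zero => by_cases h : j₀ ∈ X <;> simp [addCopies, h]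
    | succ k =>
      have := ih (j₀ + 1) k (by simpa using hk)
      rw [show j₀ + 1 + k = j₀ + (k + 1) by ring] at this
      by_cases h : j₀ ∈ X <;> simpa [addCopies, h] using this

theorem content_addCopies (I : Instance) (i : Fin I.n) (X : List ℕ) (B : Slots I) {k : ℕ}
    (hk : 1 ≤ k) (hk' : k ≤ B.length) : content (addCopies I i X 1 B).val k =
      if k ∈ X then i :: content B k else content B k := by
  rw [content_of_pos _ hk, content_of_pos _ hk, addCopies_getD I i X 1 B _ (by omega)]
  rw [show 1 + (k - 1) = k by omega]

/-! ### Linear search through the slots -/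

theorem findSlot_some_aux {I : Instance} {p : ℕ → List (Fin I.n) → Timed Bool} {B : Slots I}
    {j₀ j : ℕ} (h : (findSlot I p j₀ B).val = some j) :
    j₀ ≤ j ∧ j < j₀ + B.length ∧ (p j (B.getD (j - j₀) [])).val = true ∧
      ∀ j', j₀ ≤ j' → j' < j → (p j' (B.getD (j' - j₀) [])).val = false := by
  induction B generalizing j₀ with
  | nil => simp [findSlot] at h
  | cons b t ih =>
    by_cases e : (p j₀ b).val = true
    · have : j₀ = j := by simpa [findSlot, e] using h
      subst this
      refine ⟨le_rfl, by simp, by simpa using e, fun j' h1 h2 => by omega⟩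
    · have hh : (findSlot I p (j₀ + 1) t).val = some j := by simpa [findSlot, e] using h
      obtain ⟨h1, h2, h3, h4⟩ := ih hh
      refine ⟨by omega, by simp; omega, ?_, fun j' h5 h6 => ?_⟩
      · rw [show j - j₀ = j - (j₀ + 1) + 1 by omega]; simpa using h3
      · rcases Nat.eq_or_lt_of_le h5 with rfl | h5
        · simpa using e
        · rw [show j' - j₀ = j' - (j₀ + 1) + 1 by omega]; simpa using h4 j' h5 h6

theorem findSlot_none_aux {I : Instance} {p : ℕ → List (Fin I.n) → Timed Bool} {B : Slots I}
    {j₀ : ℕ} (h : (findSlot I p j₀ B).val = none) :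
      ∀ j', j₀ ≤ j' → j' < j₀ + B.length → (p j' (B.getD (j' - j₀) [])).val = false := by
  induction B generalizing j₀ with
  | nil => intro j' h1 h2; simp at h2; omega
  | cons b t ih =>
    by_cases e : (p j₀ b).val = true
    · simp [findSlot, e] at h
    · have hh : (findSlot I p (j₀ + 1) t).val = none := by simpa [findSlot, e] using h
      intro j' h5 h6
      rcases Nat.eq_or_lt_of_le h5 with rfl | h5
      · simpa using e
      · rw [show j' - j₀ = j' - (j₀ + 1) + 1 by omega]
        simpa using ih hh j' h5 (by simp at h6; omega)

theorem findSlot_some {I : Instance} {p : ℕ → List (Fin I.n) → Timed Bool} {B : Slots I}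
    {j : ℕ} (h : (findSlot I p 1 B).val = some j) :
    1 ≤ j ∧ j ≤ B.length ∧ (p j (content B j)).val = true ∧
      ∀ j', 1 ≤ j' → j' < j → (p j' (content B j')).val = false := by
  obtain ⟨h1, h2, h3, h4⟩ := findSlot_some_aux h
  refine ⟨h1, by omega, by rwa [content_of_pos B h1], fun j' h5 h6 => ?_⟩
  rw [content_of_pos B h5]; exact h4 j' h5 h6

theorem findSlot_none {I : Instance} {p : ℕ → List (Fin I.n) → Timed Bool} {B : Slots I}
    (h : (findSlot I p 1 B).val = none) :
      ∀ j', 1 ≤ j' → j' ≤ B.length → (p j' (content B j')).val = false := by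
  intro j' h1 h2
  rw [content_of_pos B h1]; exact findSlot_none_aux h j' h1 (by omega)

theorem insertAd_val (I : Instance) (i : Fin I.n) (l : List (Fin I.n)) :
    (insertAd I i l).val = l.orderedInsert (fun a b => I.r a ≤ I.r b) i := by
  induction l with
  | nil => simp [insertAd]
  | cons x t ih => by_cases h : I.r i ≤ I.r x <;> simp [insertAd, h, ih]

theorem sortAds_val (I : Instance) (l : List (Fin I.n)) :
    (sortAds I l).val = l.insertionSort (fun a b => I.r a ≤ I.r b) := by
  induction l with
  | nil => simp [sortAds]
  | cons x t ih => simp [sortAds, insertAd_val, ih]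

theorem sortAds_perm (I : Instance) (l : List (Fin I.n)) : (sortAds I l).val.Perm l := by
  rw [sortAds_val]; exact List.perm_insertionSort _ _

theorem sortAds_pairwise (I : Instance) (l : List (Fin I.n)) :
    (sortAds I l).val.Pairwise fun a b => I.r a ≤ I.r b := by
  rw [sortAds_val]
  -- Comparison by release date is total and transitive but not antisymmetric, so these two
  -- properties are supplied by hand.
  have : Std.Total fun a b : Fin I.n => I.r a ≤ I.r b := ⟨fun a b => le_total _ _⟩
  have : IsTrans _ fun a b : Fin I.n => I.r a ≤ I.r b := ⟨fun a b c => le_trans⟩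
  exact List.pairwise_insertionSort _ _

@[simp] theorem zeros_val (k : ℕ) : (zeros k).val = List.replicate k 0 := by
  induction k with
  | zero => simp [zeros]
  | succ k ih => simp [zeros, ih, List.replicate_succ]

@[simp] theorem entry_val (l : List ℚ) (j : ℕ) : (entry l j).val = l.getD j 0 := by
  induction l generalizing j with
  | nil => simp [entry]
  | cons x t ih => cases j <;> simp [entry, ih]

theorem mem_interval (a k x : ℕ) : x ∈ (interval a k).val ↔ a < x ∧ x ≤ a + k := by
  induction k generalizing a with
  | zero => simp [interval]
  | succ k ih => simp [interval, ih]; omega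

theorem interval_length (a k : ℕ) : (interval a k).val.length = k := by
  induction k generalizing a with
  | zero => simp [interval]
  | succ k ih => simp [interval, ih]

theorem splitAds_val (I : Instance) (l : List (Fin I.n)) :
    (splitAds I l).val = (l.filter (fun i => 1 / 2 < I.s i),
      l.filter (fun i => 1 / 4 < I.s i ∧ I.s i ≤ 1 / 2), l.filter (fun i => I.s i ≤ 1 / 4)) := by
  induction l with
  | nil => simp [splitAds]
  | cons x t ih =>
    by_cases h : 1 / 2 < I.s x
    · have h1 : ¬ I.s x ≤ 1 / 2 := by linarith
      have h2 : ¬ I.s x ≤ 1 / 4 := by linarith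
      -- `simp` normalises `1 / 2` to `2⁻¹`; the hypotheses must have the same form.
      simp only [one_div] at *
      simp [splitAds, h, ih, h1, h2]
    · by_cases h' : 1 / 4 < I.s x
      · have h1 : I.s x ≤ 1 / 2 := by linarith
        have h2 : ¬ I.s x ≤ 1 / 4 := by linarith
        simp only [one_div] at *
        simp [splitAds, h, ih, h1, h2, h']
      · have h2 : I.s x ≤ 1 / 4 := by linarith
        simp only [one_div] at *
        simp [splitAds, h, ih, h2, h']

theorem better_val (I : Instance) (S T : Slots I) : (better I S T).val =
    if slotsSum I T ≤ slotsSum I S then S else T := by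
  by_cases h : slotsSum I T ≤ slotsSum I S <;> simp [better, h]

/-! ## Tests relative to an ad and a set of slot numbers -/

/-- The fullness of slot number `j`. -/
def fill {I : Instance} (B : Slots I) (j : ℕ) : ℚ := sizeSum I (content B j)

theorem isLowFree_val (I : Instance) (i : Fin I.n) (X : List ℕ) (j : ℕ) (b : List (Fin I.n)) :
    (isLowFree I i X j b).val = true ↔ j ∉ X ∧ I.r i ≤ j ∧ sizeSum I b < 1 / 4 := by
  simp [isLowFree, and_assoc]

theorem isLowUsed_val (I : Instance) (i : Fin I.n) (X : List ℕ) (j : ℕ) (b : List (Fin I.n)) :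
    (isLowUsed I i X j b).val = true ↔ j ∈ X ∧ I.r i ≤ j ∧ sizeSum I b < 1 / 4 := by
  simp [isLowUsed, and_assoc]

theorem isHighFree_val (I : Instance) (i : Fin I.n) (X : List ℕ) (j : ℕ) (b : List (Fin I.n)) :
    (isHighFree I i X j b).val = true ↔ j ∉ X ∧ I.r i ≤ j ∧ 3 / 4 ≤ sizeSum I b := by
  simp [isHighFree, and_assoc]

theorem isRoomFree_val (I : Instance) (i : Fin I.n) (X : List ℕ) (j : ℕ) (b : List (Fin I.n)) :
    (isRoomFree I i X j b).val = true ↔ j ∉ X ∧ I.r i ≤ j ∧ sizeSum I b ≤ 1 - I.s i := by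
  simp [isRoomFree, and_assoc]

theorem findSlot_lowFree_some {I : Instance} {i : Fin I.n} {X : List ℕ} {B : Slots I} {j : ℕ}
    (h : (findSlot I (isLowFree I i X) 1 B).val = some j) :
    j ∉ X ∧ I.r i ≤ j ∧ j ≤ B.length ∧ fill B j < 1 / 4 ∧
      ∀ j', I.r i ≤ j' → j' < j → fill B j' < 1 / 4 → j' ∈ X := by
  obtain ⟨h1, h2, h3, h4⟩ := findSlot_some h
  rw [isLowFree_val] at h3
  refine ⟨h3.1, h3.2.1, h2, h3.2.2, fun j' h5 h6 h7 => ?_⟩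
  -- Release dates are at least 1, so every slot from the release date on lies in the range of the
  -- search.
  have := h4 j' ((I.r_pos i).trans h5) h6
  by_contra hX
  rw [(isLowFree_val I i X j' _).2 ⟨hX, h5, h7⟩] at this
  simp at this

theorem findSlot_lowFree_none {I : Instance} {i : Fin I.n} {X : List ℕ} {B : Slots I}
    (h : (findSlot I (isLowFree I i X) 1 B).val = none) {j : ℕ} (hr : I.r i ≤ j)
    (hj : j ≤ B.length) (hX : j ∉ X) : 1 / 4 ≤ fill B j := by
  have := findSlot_none h j ((I.r_pos i).trans hr) hj
  by_contra hf
  rw [(isLowFree_val I i X j _).2 ⟨hX, hr, not_le.1 hf⟩] at this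
  simp at this

theorem findSlot_lowUsed_some {I : Instance} {i : Fin I.n} {X : List ℕ} {B : Slots I} {j : ℕ}
    (h : (findSlot I (isLowUsed I i X) 1 B).val = some j) :
    j ∈ X ∧ I.r i ≤ j ∧ j ≤ B.length ∧ fill B j < 1 / 4 ∧
      ∀ j' ∈ X, I.r i ≤ j' → fill B j' < 1 / 4 → j ≤ j' := by
  obtain ⟨h1, h2, h3, h4⟩ := findSlot_some h
  rw [isLowUsed_val] at h3
  refine ⟨h3.1, h3.2.1, h2, h3.2.2, fun j' hX h5 h7 => ?_⟩
  by_contra hlt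
  have := h4 j' ((I.r_pos i).trans h5) (not_le.1 hlt)
  rw [(isLowUsed_val I i X j' _).2 ⟨hX, h5, h7⟩] at this
  simp at this

theorem findSlot_lowUsed_none {I : Instance} {i : Fin I.n} {X : List ℕ} {B : Slots I}
    (h : (findSlot I (isLowUsed I i X) 1 B).val = none) {j : ℕ} (hr : I.r i ≤ j)
    (hj : j ≤ B.length) (hX : j ∈ X) : 1 / 4 ≤ fill B j := by
  have := findSlot_none h j ((I.r_pos i).trans hr) hj
  by_contra hf
  rw [(isLowUsed_val I i X j _).2 ⟨hX, hr, not_le.1 hf⟩] at this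
  simp at this

theorem findSlot_highFree_some {I : Instance} {i : Fin I.n} {X : List ℕ} {B : Slots I} {j : ℕ}
    (h : (findSlot I (isHighFree I i X) 1 B).val = some j) :
    j ∉ X ∧ I.r i ≤ j ∧ j ≤ B.length ∧ 3 / 4 ≤ fill B j := by
  obtain ⟨h1, h2, h3, h4⟩ := findSlot_some h
  rw [isHighFree_val] at h3
  exact ⟨h3.1, h3.2.1, h2, h3.2.2⟩

theorem findSlot_highFree_none {I : Instance} {i : Fin I.n} {X : List ℕ} {B : Slots I}
    (h : (findSlot I (isHighFree I i X) 1 B).val = none) {j : ℕ} (hr : I.r i ≤ j)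
    (hj : j ≤ B.length) (hX : j ∉ X) : fill B j < 3 / 4 := by
  have := findSlot_none h j ((I.r_pos i).trans hr) hj
  by_contra hf
  rw [(isHighFree_val I i X j _).2 ⟨hX, hr, not_lt.1 hf⟩] at this
  simp at this

theorem findSlot_roomFree_some {I : Instance} {i : Fin I.n} {X : List ℕ} {B : Slots I} {j : ℕ}
    (h : (findSlot I (isRoomFree I i X) 1 B).val = some j) :
    j ∉ X ∧ I.r i ≤ j ∧ j ≤ B.length ∧ fill B j ≤ 1 - I.s i := by
  obtain ⟨h1, h2, h3, h4⟩ := findSlot_some h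
  rw [isRoomFree_val] at h3
  exact ⟨h3.1, h3.2.1, h2, h3.2.2⟩

theorem findSlot_roomFree_none {I : Instance} {i : Fin I.n} {X : List ℕ} {B : Slots I}
    (h : (findSlot I (isRoomFree I i X) 1 B).val = none) {j : ℕ} (hr : I.r i ≤ j)
    (hj : j ≤ B.length) (hX : j ∉ X) : 1 - I.s i < fill B j := by
  have := findSlot_none h j ((I.r_pos i).trans hr) hj
  by_contra hf
  rw [(isRoomFree_val I i X j _).2 ⟨hX, hr, not_lt.1 hf⟩] at this
  simp at this

/-- Case (c) looks for room first and minimises afterwards. A slot with room is a candidate for the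
minimum, so the failure branch after the minimisation is never reached. -/
theorem leastFull_ne_none_aux {I : Instance} {i : Fin I.n} {X : List ℕ} {B : Slots I} {j₀ j : ℕ}
    (h1 : j₀ ≤ j) (h2 : j < j₀ + B.length) (h3 : j ∉ X) (h4 : I.r i ≤ j) :
    (leastFull I i X j₀ B).val ≠ none := by
  induction B generalizing j₀ with
  | nil => simp at h2; omega
  | cons b t ih =>
    by_cases e : j₀ ∉ X ∧ I.r i ≤ j₀
    · rcases hr : (leastFull I i X (j₀ + 1) t).val with _ | ⟨j₂, g₂⟩
      · simp [leastFull, e, hr]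
      · by_cases hle : sizeSum I b ≤ g₂ <;> simp [leastFull, e, hr, hle]
    · have hne : j₀ ≠ j := by rintro rfl; exact e ⟨h3, h4⟩
      have := ih (j₀ := j₀ + 1) (by omega) (by simp at h2; omega)
      simpa [leastFull, e] using this

theorem leastFull_some_aux {I : Instance} {i : Fin I.n} {X : List ℕ} {B : Slots I} {j₀ j : ℕ}
    {g : ℚ} (h : (leastFull I i X j₀ B).val = some (j, g)) :
    j₀ ≤ j ∧ j < j₀ + B.length ∧ j ∉ X ∧ I.r i ≤ j ∧ g = sizeSum I (B.getD (j - j₀) []) ∧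
      ∀ j', j₀ ≤ j' → j' < j₀ + B.length → j' ∉ X → I.r i ≤ j' →
        g ≤ sizeSum I (B.getD (j' - j₀) []) := by
  induction B generalizing j₀ j g with
  | nil => simp [leastFull] at h
  | cons b t ih =>
    have shift : ∀ {k}, j₀ < k → (b :: t).getD (k - j₀) [] = t.getD (k - (j₀ + 1)) [] := by
      intro k hk
      rw [show k - j₀ = k - (j₀ + 1) + 1 by omega]; simp
    by_cases e : j₀ ∉ X ∧ I.r i ≤ j₀
    · rcases hrest : (leastFull I i X (j₀ + 1) t).val with _ | ⟨j₂, g₂⟩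
      · have hj : j₀ = j ∧ sizeSum I b = g := by simpa [leastFull, e, hrest] using h
        obtain ⟨rfl, rfl⟩ := hj
        refine ⟨le_rfl, by simp, e.1, e.2, by simp, fun j' h1 h2 h3 h4 => ?_⟩
        rcases Nat.eq_or_lt_of_le h1 with rfl | h1
        · simp
        · exact (leastFull_ne_none_aux h1 (by simp at h2; omega) h3 h4 hrest).elim
      · obtain ⟨a1, a2, a3, a4, a5, a6⟩ := ih hrest
        by_cases hle : sizeSum I b ≤ g₂
        · have hj : j₀ = j ∧ sizeSum I b = g := by simpa [leastFull, e, hrest, hle] using h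
          obtain ⟨rfl, rfl⟩ := hj
          refine ⟨le_rfl, by simp, e.1, e.2, by simp, fun j' h1 h2 h3 h4 => ?_⟩
          rcases Nat.eq_or_lt_of_le h1 with rfl | h1
          · simp
          · rw [shift h1]; exact hle.trans (a6 j' h1 (by simp at h2; omega) h3 h4)
        · have hj : j₂ = j ∧ g₂ = g := by simpa [leastFull, e, hrest, hle] using h
          obtain ⟨rfl, rfl⟩ := hj
          refine ⟨by omega, by simp; omega, a3, a4, by rw [shift (by omega)]; exact a5,
            fun j' h1 h2 h3 h4 => ?_⟩
          rcases Nat.eq_or_lt_of_le h1 with rfl | h1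
          · simpa using (not_le.1 hle).le
          · rw [shift h1]; exact a6 j' h1 (by simp at h2; omega) h3 h4
    · have hh : (leastFull I i X (j₀ + 1) t).val = some (j, g) := by
        simpa [leastFull, e] using h
      obtain ⟨a1, a2, a3, a4, a5, a6⟩ := ih hh
      refine ⟨by omega, by simp; omega, a3, a4, by rw [shift (by omega)]; exact a5,
        fun j' h1 h2 h3 h4 => ?_⟩
      rcases Nat.eq_or_lt_of_le h1 with rfl | h1
      · exact (e ⟨h3, h4⟩).elim
      · rw [shift h1]; exact a6 j' h1 (by simp at h2; omega) h3 h4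

theorem leastFull_some {I : Instance} {i : Fin I.n} {X : List ℕ} {B : Slots I} {j : ℕ}
    {g : ℚ} (h : (leastFull I i X 1 B).val = some (j, g)) :
    j ∉ X ∧ I.r i ≤ j ∧ j ≤ B.length ∧
      ∀ j', j' ∉ X → I.r i ≤ j' → j' ≤ B.length → fill B j ≤ fill B j' := by
  obtain ⟨a1, a2, a3, a4, a5, a6⟩ := leastFull_some_aux h
  refine ⟨a3, a4, by omega, fun j' h1 h2 h3 => ?_⟩
  have h0 := (I.r_pos i).trans h2
  simp only [fill, content_of_pos B a1, content_of_pos B h0]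
  rw [← a5]; exact a6 j' h0 (by omega) h1 h2


/-! ## Comparison of schedules slot by slot -/

theorem Schedule.fullness_nonneg {I : Instance} (B : Schedule I) (j : Fin I.K) :
    0 ≤ B.fullness j := Finset.sum_nonneg fun i _ => (I.s_pos i).le

/-- If every ad that is missing in a slot of fullness less than `1/4`, and is released in time for
that slot, has all its copies in earlier slots, then the schedule is a `1/4`-approximation. -/
theorem quarter_value_le {I : Instance} {A : Finset (Fin I.n)} {S T : Schedule I}
    (hS : S.Feasible A)
    (hT : ∀ i ∈ A, ∀ j : Fin I.K, I.r i ≤ j + 1 → T.fullness j < 1 / 4 → i ∉ T j →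
      (Finset.univ.filter fun j => i ∈ T j).card = I.w i ∧ ∀ j', i ∈ T j' → j' < j) :
    1 / 4 * S.value ≤ T.value := by
  obtain ⟨A', hA', hSA, hcount, hfull, hrel⟩ := hS
  by_cases hlow : ∃ j, T.fullness j < 1 / 4
  swap
  -- Without low slots, each slot of T has at least 1/4 and each slot of S at most 1.
  · push Not at hlow
    rw [Schedule.value, Schedule.value, Finset.mul_sum]
    exact Finset.sum_le_sum fun j _ => by linarith [hlow j, hfull j]
  -- The last low slot separates the slots that are full enough from those where ads have to be
  -- charged.
  obtain ⟨j₀, hj₀, hmax⟩ : ∃ j₀, T.fullness j₀ < 1 / 4 ∧ ∀ j, T.fullness j < 1 / 4 → j ≤ j₀ := by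
    obtain ⟨j, hj⟩ := hlow
    let F := Finset.univ.filter fun j => T.fullness j < 1 / 4
    have hF : F.Nonempty := ⟨j, by simpa [F] using hj⟩
    refine ⟨F.max' hF, ?_, fun k hk => F.le_max' k (by simpa [F] using hk)⟩
    simpa [F] using F.max'_mem hF
  let P := Finset.univ.filter fun j : Fin I.K => j ≤ j₀
  have hlate : ∀ j, ¬ j ≤ j₀ → S.fullness j ≤ 4 * T.fullness j := fun j hj => by
    have : ¬ T.fullness j < 1 / 4 := fun h => hj (hmax j h)
    linarith [hfull j]
  -- Ads of S that T shows in `j₀`. If `j` is low, such an ad is also in `T j`, since otherwise all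
  -- its copies would precede `j ≤ j₀`. If `j` is not low, already all of `T j₀` weighs less than
  -- 1/4.
  have hpresent : ∀ j ∈ P, ∑ i ∈ S j with i ∈ T j₀, I.s i ≤ T.fullness j := fun j hj => by
    have hj : j ≤ j₀ := by simpa [P] using hj
    by_cases hjl : T.fullness j < 1 / 4
    · refine Finset.sum_le_sum_of_subset_of_nonneg (fun i hi => ?_) fun i _ _ => (I.s_pos i).le
      rw [Finset.mem_filter] at hi
      by_contra hij
      exact absurd ((hT i (hA' (hSA j hi.1)) j (hrel j i hi.1) hjl hij).2 j₀ hi.2) (not_lt.2 hj)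
    · have : ∑ i ∈ S j with i ∈ T j₀, I.s i ≤ T.fullness j₀ := by
        refine Finset.sum_le_sum_of_subset_of_nonneg (fun i hi => ?_) fun i _ _ => (I.s_pos i).le
        exact (Finset.mem_filter.1 hi).2
      linarith
  -- Ads of S that are missing in `T j₀`, compared ad by ad after exchanging the sums: all `w i`
  -- copies in T lie before `j₀`, and S has no more copies than that.
  have hmissing : ∑ j ∈ P, ∑ i ∈ S j with i ∉ T j₀, I.s i ≤ ∑ j ∈ P, T.fullness j := by
    have hl : ∑ j ∈ P, ∑ i ∈ S j with i ∉ T j₀, I.s i =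
        ∑ i, ∑ j ∈ P, if i ∈ S j ∧ i ∉ T j₀ then I.s i else 0 := by
      rw [Finset.sum_comm]
      refine Finset.sum_congr rfl fun j _ => ?_
      rw [← Finset.sum_filter]
      exact Finset.sum_congr (by ext; simp) fun _ _ => rfl
    have hr : ∑ j ∈ P, T.fullness j = ∑ i, ∑ j ∈ P, if i ∈ T j then I.s i else 0 := by
      rw [Finset.sum_comm]
      refine Finset.sum_congr rfl fun j _ => ?_
      rw [← Finset.sum_filter, Schedule.fullness]
      exact Finset.sum_congr (by ext; simp) fun _ _ => rfl
    rw [hl, hr]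
    refine Finset.sum_le_sum fun i _ => ?_
    by_cases hi : ∃ j ∈ P, i ∈ S j ∧ i ∉ T j₀
    · obtain ⟨j, hjP, hiS, hiT⟩ := hi
      have hj : j ≤ j₀ := by simpa [P] using hjP
      have hr : I.r i ≤ j₀ + 1 := (hrel j i hiS).trans (by have : (j : ℕ) ≤ j₀ := hj; omega)
      obtain ⟨h1, h2⟩ := hT i (hA' (hSA j hiS)) j₀ hr hj₀ hiT
      rw [← Finset.sum_filter, ← Finset.sum_filter, Finset.sum_const, Finset.sum_const]
      refine nsmul_le_nsmul_left (I.s_pos i).le ?_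
      have e : P.filter (fun j => i ∈ T j) = Finset.univ.filter fun j => i ∈ T j := by
        ext k
        simp only [P, Finset.mem_filter, Finset.mem_univ, true_and, and_iff_right_iff_imp]
        exact fun hk => (h2 k hk).le
      rw [e, h1, ← hcount i (hSA j hiS)]
      refine Finset.card_le_card fun k hk => ?_
      simp only [Finset.mem_filter, Finset.mem_univ, true_and] at hk ⊢
      exact hk.2.1
    · push Not at hi
      refine Finset.sum_le_sum fun j hj => ?_
      rw [if_neg (fun h => h.2 (hi j hj h.1))]
      split_ifs
      · exact (I.s_pos i).le
      · exact le_rfl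
  have hsplit : ∀ j, S.fullness j =
      ∑ i ∈ S j with i ∈ T j₀, I.s i + ∑ i ∈ S j with i ∉ T j₀, I.s i := fun j =>
    (Finset.sum_filter_add_sum_filter_not _ _ _).symm
  -- One copy of the value of T on `P` pays for the present ads, a second one for the missing ads.
  have hS1 : ∑ j ∈ P, S.fullness j ≤ 2 * ∑ j ∈ P, T.fullness j := by
    rw [Finset.sum_congr rfl fun j _ => hsplit j, Finset.sum_add_distrib]
    linarith [Finset.sum_le_sum hpresent]
  have hS2 : ∑ j with ¬ j ≤ j₀, S.fullness j ≤ 4 * ∑ j with ¬ j ≤ j₀, T.fullness j := by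
    rw [Finset.mul_sum]
    exact Finset.sum_le_sum fun j hj => hlate j (Finset.mem_filter.1 hj).2
  have hT0 : 0 ≤ ∑ j ∈ P, T.fullness j := Finset.sum_nonneg fun j _ => T.fullness_nonneg j
  rw [Schedule.value, Schedule.value, ← Finset.sum_filter_add_sum_filter_not _ (fun j => j ≤ j₀),
    ← Finset.sum_filter_add_sum_filter_not Finset.univ (fun j => j ≤ j₀) T.fullness]
  change 1 / 4 * (∑ j ∈ P, S.fullness j + _) ≤ ∑ j ∈ P, T.fullness j + _
  linarith

/-! ## Lists of slots as schedules -/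

/-- `B` consists of `K` slots, listed without repetitions, with ads of `A`. -/
structure Valid (I : Instance) (A : Finset (Fin I.n)) (B : Slots I) : Prop where
  length : B.length = I.K
  nodup : ∀ j, (content B j).Nodup
  sub : ∀ j, ∀ i ∈ content B j, i ∈ A

/-- The numbers of the slots in which ad `i` is displayed. -/
def copies {I : Instance} (B : Slots I) (i : Fin I.n) : Finset ℕ :=
  (Finset.Icc 1 B.length).filter fun j => i ∈ content B j

theorem mem_copies {I : Instance} {B : Slots I} {i : Fin I.n} {j : ℕ} :
    j ∈ copies B i ↔ i ∈ content B j := by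
  simp only [copies, Finset.mem_filter, Finset.mem_Icc, and_iff_right_iff_imp]
  exact mem_Icc_of_mem_content

/-- `B` is the list of the slots of a feasible schedule of ads of `A`. -/
structure FeasibleSlots (I : Instance) (A : Finset (Fin I.n)) (B : Slots I) : Prop
    extends Valid I A B where
  released : ∀ j, ∀ i ∈ content B j, I.r i ≤ j
  fill_le : ∀ j, fill B j ≤ 1
  count : ∀ i, (copies B i).card = I.w i ∨ (copies B i).card = 0

/-- The schedule represented by a list of slots. -/
def toSchedule {I : Instance} (B : Slots I) : Schedule I := fun j => (content B (j + 1)).toFinset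

theorem fullness_toSchedule {I : Instance} {A : Finset (Fin I.n)} {B : Slots I} (h : Valid I A B)
    (j : Fin I.K) : (toSchedule B).fullness j = fill B (j + 1) := by
  rw [fill, sizeSum_eq_sum (h.nodup _)]; rfl

theorem slotsSum_eq_sum {I : Instance} (B : Slots I) :
    slotsSum I B = ∑ j ∈ Finset.range B.length, fill B (j + 1) := by
  induction B with
  | nil => simp
  | cons b t ih =>
    rw [slotsSum_cons, ih, List.length_cons, Finset.sum_range_succ', add_comm]
    rfl

theorem value_toSchedule {I : Instance} {A : Finset (Fin I.n)} {B : Slots I} (h : Valid I A B) :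
    (toSchedule B).value = slotsSum I B := by
  rw [Schedule.value, slotsSum_eq_sum, h.length, Finset.sum_range]
  exact Finset.sum_congr rfl fun j _ => fullness_toSchedule h j

theorem card_filter_toSchedule {I : Instance} {A : Finset (Fin I.n)} {B : Slots I}
    (h : Valid I A B) (i : Fin I.n) :
    (Finset.univ.filter fun j => i ∈ toSchedule B j).card = (copies B i).card := by
  refine Finset.card_bij (fun j _ => (j : ℕ) + 1) (fun j hj => ?_) (fun j _ k _ e => ?_)
    fun j hj => ?_
  · simpa [mem_copies, toSchedule] using hj
  · exact Fin.ext (by omega)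
  · rw [mem_copies] at hj
    have := mem_Icc_of_mem_content hj
    have hl := h.length
    refine ⟨⟨j - 1, by omega⟩, ?_, by simp; omega⟩
    rw [Finset.mem_filter]
    refine ⟨Finset.mem_univ _, List.mem_toFinset.2 ?_⟩
    rwa [show j - 1 + 1 = j by omega]

theorem represents_toSchedule {I : Instance} {A : Finset (Fin I.n)} {B : Slots I}
    (h : Valid I A B) : Represents B (toSchedule B) := by
  refine ⟨h.length, fun b hb => ?_, fun j => rfl⟩
  obtain ⟨j, -, -, rfl⟩ := exists_content_of_mem hb
  exact h.nodup j

theorem FeasibleSlots.feasible {I : Instance} {A : Finset (Fin I.n)} {B : Slots I}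
    (h : FeasibleSlots I A B) : (toSchedule B).Feasible A := by
  -- The scheduled set consists of the ads with all copies present; a displayed ad has a copy, so
  -- `count` leaves only this alternative.
  refine ⟨A.filter fun i => (copies B i).card = I.w i, Finset.filter_subset _ _, ?_, ?_, ?_, ?_⟩
  · intro j i hi
    have hi : i ∈ content B (j + 1) := by simpa [toSchedule] using hi
    refine Finset.mem_filter.2 ⟨h.sub _ i hi, (h.count i).resolve_right fun h0 => ?_⟩
    rw [Finset.card_eq_zero] at h0
    have := mem_copies.2 hi
    simp [h0] at this
  · intro i hi
    rw [card_filter_toSchedule h.toValid]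
    exact (Finset.mem_filter.1 hi).2
  · intro j
    rw [fullness_toSchedule h.toValid]
    exact h.fill_le _
  · intro j i hi
    exact h.released _ i (by simpa [toSchedule] using hi)

/-- Every ad of `A` that is missing in a slot of fullness less than `1/4`, and is released in time
for that slot, has all its copies in earlier slots. -/
def LowFilled (I : Instance) (A : Finset (Fin I.n)) (B : Slots I) : Prop :=
  ∀ i ∈ A, ∀ j ≤ I.K, I.r i ≤ j → fill B j < 1 / 4 → i ∉ content B j →
    (copies B i).card = I.w i ∧ ∀ j', i ∈ content B j' → j' < j

theorem FeasibleSlots.quarter {I : Instance} {A : Finset (Fin I.n)} {B : Slots I}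
    (h : FeasibleSlots I A B) (hl : LowFilled I A B) : IsApproxSolution I A (1 / 4) B := by
  refine ⟨toSchedule B, represents_toSchedule h.toValid, h.feasible, fun S hS => ?_⟩
  refine quarter_value_le hS fun i hi j hr hf hij => ?_
  rw [fullness_toSchedule h.toValid] at hf
  have := hl i hi (j + 1) j.2 hr hf (by simpa [toSchedule] using hij)
  rw [card_filter_toSchedule h.toValid]
  refine ⟨this.1, fun j' hj' => ?_⟩
  have := this.2 (j' + 1) (by simpa [toSchedule] using hj')
  exact Fin.lt_def.2 (by omega)

/-! ## Choosing the slots for the copies of an ad -/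

/-- The state of the choice of slots for the copies of ad `i`, when `k` slots are missing. -/
structure LoopState (I : Instance) (i : Fin I.n) (k : ℕ) (X : List ℕ) (B : Slots I) : Prop where
  nodup : X.Nodup
  release_le : ∀ j ∈ X, I.r i ≤ j
  le_K : ∀ j ∈ X, j ≤ I.K
  length : X.length + k = I.w i
  room : ∀ j ∈ X, fill B j + I.s i ≤ 1
  before : ∀ j ≤ I.K, I.r i ≤ j → j ∉ X → fill B j < 1 / 4 → ∀ j' ∈ X, j' < j

theorem LoopState.init (I : Instance) (i : Fin I.n) (B : Slots I) :
    LoopState I i (I.w i) [] B := by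
  constructor <;> simp

/-- The next slot may be chosen if it has room and no slot of smaller index with fullness less
than `1/4` is available. -/
theorem LoopState.cons {I : Instance} {i : Fin I.n} {k : ℕ} {X : List ℕ} {B : Slots I}
    (h : LoopState I i (k + 1) X B) {j : ℕ} (hX : j ∉ X) (hr : I.r i ≤ j) (hK : j ≤ I.K)
    (hs : fill B j + I.s i ≤ 1)
    (hj : ∀ j' ≤ I.K, I.r i ≤ j' → j' < j → fill B j' < 1 / 4 → j' ∈ X) :
    LoopState I i k (j :: X) B where
  nodup := List.nodup_cons.2 ⟨hX, h.nodup⟩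
  release_le := by simpa [hr] using h.release_le
  le_K := by simpa [hK] using h.le_K
  length := by have := h.length; simp; omega
  room := by simpa [hs] using h.room
  before := by
    intro a ha hra haX hfa b hb
    rw [List.mem_cons, not_or] at haX
    rcases List.mem_cons.1 hb with rfl | hb
    -- A low slot `a` before the new slot would already have been chosen.
    · by_contra hlt
      exact haX.2 (hj a ha hra (lt_of_le_of_ne (not_lt.1 hlt) haX.1) hfa)
    · exact h.before a ha hra haX.2 hfa b hb

/-- There are `K - r i + 1 ≥ w i` slots from the release date on, and fewer than `w i` are chosen so
far. This is where the compatibility of frequency and release date enters. -/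
theorem LoopState.exists_not_mem {I : Instance} {i : Fin I.n} {k : ℕ} {X : List ℕ} {B : Slots I}
    (h : LoopState I i (k + 1) X B) : ∃ j, j ∉ X ∧ I.r i ≤ j ∧ j ≤ I.K := by
  by_contra hcon
  push Not at hcon
  have hsub : Finset.Icc (I.r i) I.K ⊆ X.toFinset := fun j hj => by
    rw [Finset.mem_Icc] at hj
    by_contra hjX
    have := hcon j (by simpa using hjX) hj.1
    omega
  have h1 := Finset.card_le_card hsub
  rw [Nat.card_Icc, List.toFinset_card_of_nodup h.nodup] at h1
  have := h.length
  have := I.compatible i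
  omega

/-! ### Effect of adding the copies of one ad -/

theorem content_addCopies_of_subset {I : Instance} (i : Fin I.n) {X : List ℕ} {B : Slots I}
    (h : ∀ j ∈ X, 1 ≤ j ∧ j ≤ B.length) (k : ℕ) : content (addCopies I i X 1 B).val k =
      if k ∈ X then i :: content B k else content B k := by
  by_cases hk : 1 ≤ k ∧ k ≤ B.length
  · exact content_addCopies I i X B hk.1 hk.2
  · rw [if_neg (fun hX => hk (h k hX))]
    rcases Nat.eq_zero_or_pos k with rfl | h0
    · simp
    · rw [content_of_length_lt B (by omega), content_of_length_lt]
      rw [addCopies_length]; omega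

theorem fill_addCopies {I : Instance} (i : Fin I.n) {X : List ℕ} {B : Slots I}
    (h : ∀ j ∈ X, 1 ≤ j ∧ j ≤ B.length) (k : ℕ) : fill (addCopies I i X 1 B).val k =
      if k ∈ X then I.s i + fill B k else fill B k := by
  simp only [fill, content_addCopies_of_subset i h]
  split_ifs <;> simp

theorem copies_addCopies_self {I : Instance} (i : Fin I.n) {X : List ℕ} {B : Slots I}
    (h : ∀ j ∈ X, 1 ≤ j ∧ j ≤ B.length) (hi : ∀ j, i ∉ content B j) :
    copies (addCopies I i X 1 B).val i = X.toFinset := by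
  ext k
  rw [mem_copies, content_addCopies_of_subset i h]
  split_ifs with hk <;> simp [hk, hi]

theorem copies_addCopies_ne {I : Instance} {i i' : Fin I.n} {X : List ℕ} {B : Slots I}
    (h : ∀ j ∈ X, 1 ≤ j ∧ j ≤ B.length) (hi : i' ≠ i) :
    copies (addCopies I i X 1 B).val i' = copies B i' := by
  ext k
  rw [mem_copies, mem_copies, content_addCopies_of_subset i h]
  split_ifs with hk <;> simp [hi]

theorem Valid.addCopies {I : Instance} {A : Finset (Fin I.n)} {B : Slots I} (h : Valid I A B)
    {i : Fin I.n} (hi : i ∉ A) {X : List ℕ} (hX : ∀ j ∈ X, 1 ≤ j ∧ j ≤ I.K) :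
    Valid I (insert i A) (addCopies I i X 1 B).val := by
  have hX' : ∀ j ∈ X, 1 ≤ j ∧ j ≤ B.length := by rw [h.length]; exact hX
  refine ⟨by rw [addCopies_length, h.length], fun j => ?_, fun j i' hi' => ?_⟩
  · rw [content_addCopies_of_subset i hX']
    split_ifs
    · exact List.nodup_cons.2 ⟨fun h' => hi (h.sub j i h'), h.nodup j⟩
    · exact h.nodup j
  · rw [content_addCopies_of_subset i hX'] at hi'
    rw [Finset.mem_insert]
    split_ifs at hi'
    · exact (List.mem_cons.1 hi').imp_right (h.sub j i')
    · exact Or.inr (h.sub j i' hi')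

theorem LoopState.mem_bounds {I : Instance} {i : Fin I.n} {k : ℕ} {X : List ℕ} {B : Slots I}
    (h : LoopState I i k X B) : ∀ j ∈ X, 1 ≤ j ∧ j ≤ I.K := fun j hj =>
  ⟨(I.r_pos i).trans (h.release_le j hj), h.le_K j hj⟩

theorem FeasibleSlots.addCopies {I : Instance} {A : Finset (Fin I.n)} {B : Slots I}
    (h : FeasibleSlots I A B) {i : Fin I.n} (hi : i ∉ A) {X : List ℕ}
    (hX : LoopState I i 0 X B) : FeasibleSlots I (insert i A) (addCopies I i X 1 B).val := by
  have hX' : ∀ j ∈ X, 1 ≤ j ∧ j ≤ B.length := by rw [h.length]; exact hX.mem_bounds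
  refine ⟨h.toValid.addCopies hi hX.mem_bounds, fun j i' hi' => ?_, fun j => ?_, fun i' => ?_⟩
  · rw [content_addCopies_of_subset i hX'] at hi'
    split_ifs at hi' with hj
    · rcases List.mem_cons.1 hi' with rfl | hi'
      · exact hX.release_le j hj
      · exact h.released j i' hi'
    · exact h.released j i' hi'
  · rw [fill_addCopies i hX']
    split_ifs with hj
    · rw [add_comm]; exact hX.room j hj
    · exact h.fill_le j
  · by_cases e : i' = i
    · subst e
      rw [copies_addCopies_self i' hX' fun j hj => hi (h.sub j i' hj),
        List.toFinset_card_of_nodup hX.nodup]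
      exact Or.inl hX.length
    · rw [copies_addCopies_ne hX' e]; exact h.count i'

/-- Fullness only grows, so a slot that is low afterwards was low before. The older ads keep their
copies, and for the new ad the claim is contained in the fields `length` and `before` of the loop
state. -/
theorem LowFilled.addCopies {I : Instance} {A : Finset (Fin I.n)} {B : Slots I}
    (hl : LowFilled I A B) (h : Valid I A B) {i : Fin I.n} (hi : i ∉ A) {X : List ℕ}
    (hX : LoopState I i 0 X B) : LowFilled I (insert i A) (addCopies I i X 1 B).val := by
  have hX' : ∀ j ∈ X, 1 ≤ j ∧ j ≤ B.length := by rw [h.length]; exact hX.mem_bounds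
  have hc := content_addCopies_of_subset i hX'
  intro i' hi' j hj hr hf hij
  have hf' : fill B j < 1 / 4 := by
    rw [fill_addCopies i hX'] at hf
    split_ifs at hf
    · have := I.s_pos i; linarith
    · exact hf
  have hij' : i' ∉ content B j := by
    rw [hc] at hij
    split_ifs at hij
    · exact fun h => hij (List.mem_cons_of_mem _ h)
    · exact hij
  by_cases e : i' = i
  · subst e
    have hcop := copies_addCopies_self i' hX' fun j hj => hi (h.sub j i' hj)
    have hjX : j ∉ X := fun hjX => hij (by rw [hc, if_pos hjX]; exact List.mem_cons_self)
    refine ⟨?_, fun j' hj' => ?_⟩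
    · rw [hcop, List.toFinset_card_of_nodup hX.nodup]; exact hX.length
    · rw [← mem_copies, hcop, List.mem_toFinset] at hj'
      exact hX.before j hj hr hjX hf' j' hj'
  · have := hl i' (Finset.mem_of_mem_insert_of_ne hi' e) j hj hr hf' hij'
    rw [copies_addCopies_ne hX' e]
    refine ⟨this.1, fun j' hj' => this.2 j' ?_⟩
    rwa [← mem_copies, copies_addCopies_ne hX' e, mem_copies] at hj'

theorem FeasibleSlots.insert {I : Instance} {A : Finset (Fin I.n)} {B : Slots I}
    (h : FeasibleSlots I A B) (i : Fin I.n) : FeasibleSlots I (insert i A) B :=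
  { h with sub := fun j i' hi' => Finset.mem_insert_of_mem (h.sub j i' hi') }

/-- An ad may be discarded if all slots after its release date have fullness at least `1/4`. -/
theorem LowFilled.insert {I : Instance} {A : Finset (Fin I.n)} {B : Slots I}
    (hl : LowFilled I A B) {i : Fin I.n}
    (hi : ∀ j ≤ I.K, I.r i ≤ j → 1 / 4 ≤ fill B j) : LowFilled I (insert i A) B := by
  intro i' hi' j hj hr hf hij
  rcases Finset.mem_insert.1 hi' with rfl | hi'
  · exact absurd hf (not_lt.2 (hi j hj hr))
  · exact hl i' hi' j hj hr hf hij

theorem content_replicate {I : Instance} (k j : ℕ) :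
    content (List.replicate k [] : Slots I) j = [] := by
  rcases content_mem_or_nil (List.replicate k [] : Slots I) j with h | h
  · exact List.eq_of_mem_replicate h
  · exact h

theorem copies_replicate {I : Instance} (k : ℕ) (i : Fin I.n) :
    copies (List.replicate k [] : Slots I) i = ∅ := by
  ext j; simp [mem_copies, content_replicate]

theorem feasibleSlots_replicate (I : Instance) : FeasibleSlots I ∅ (List.replicate I.K []) := by
  refine ⟨⟨by simp, ?_, ?_⟩, ?_, ?_, ?_⟩ <;> simp [content_replicate, fill, copies_replicate]

theorem lowFilled_empty (I : Instance) (B : Slots I) : LowFilled I ∅ B := by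
  intro i hi; simp at hi

/-- The choice of an available slot of fullness less than `1/4`. -/
theorem LoopState.cons_low {I : Instance} {i : Fin I.n} {k : ℕ} {X : List ℕ} {B : Slots I}
    (h : LoopState I i (k + 1) X B) (hB : B.length = I.K) (hs : I.s i ≤ 1 / 2) {j : ℕ}
    (hj : (findSlot I (isLowFree I i X) 1 B).val = some j) : LoopState I i k (j :: X) B := by
  obtain ⟨h1, h2, h3, h4, h5⟩ := findSlot_lowFree_some hj
  exact h.cons h1 h2 (hB ▸ h3) (by linarith) fun j' _ hr hlt hf => h5 j' hr hlt hf

/-- Some available slot has room, so the least full one has room too. Since no available slot is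
low, the condition on earlier low slots holds trivially. -/
theorem LoopState.cons_least {I : Instance} {i : Fin I.n} {k : ℕ} {X : List ℕ} {B : Slots I}
    (h : LoopState I i (k + 1) X B) (hB : B.length = I.K)
    (ha : (findSlot I (isLowFree I i X) 1 B).val = none) {j₁ : ℕ}
    (hc : (findSlot I (isRoomFree I i X) 1 B).val = some j₁) {j : ℕ} {g : ℚ}
    (hj : (leastFull I i X 1 B).val = some (j, g)) : LoopState I i k (j :: X) B := by
  obtain ⟨h1, h2, h3, h4⟩ := leastFull_some hj
  obtain ⟨g1, g2, g3, g4⟩ := findSlot_roomFree_some hc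
  have := h4 j₁ g1 g2 g3
  refine h.cons h1 h2 (hB ▸ h3) (by linarith) fun j' hK hr _ hf => ?_
  by_contra hX
  exact absurd hf (not_lt.2 (findSlot_lowFree_none ha hr (hB ▸ hK) hX))

/-! ## Medium ads -/

/-- If some slot has fullness more than `1/2`, then all slots from `ρ` on have fullness at least
`1/4`. -/
def Saturated (I : Instance) (ρ : ℕ) (B : Slots I) : Prop :=
  ∀ j, 1 / 2 < fill B j → ∀ j' ≤ I.K, fill B j' < 1 / 4 → j' < ρ

/-- The extra invariant `hX` records the priority of case (a) over case (c): a slot that is not low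
is chosen only when every low slot from the release date on has been used. -/
theorem mediumLoop_spec {I : Instance} {i : Fin I.n} {B : Slots I} (hB : B.length = I.K)
    (hs : I.s i ≤ 1 / 2) (k : ℕ) (X : List ℕ) (h : LoopState I i k X B)
    (hX : ∀ j ∈ X, 1 / 4 ≤ fill B j → ∀ j' ≤ I.K, I.r i ≤ j' → fill B j' < 1 / 4 → j' ∈ X) :
    match (mediumLoop I i B k X).val with
    | none => ∃ j, 1 / 2 ≤ fill B j ∧ 1 - I.s i < fill B j
    | some Y => LoopState I i 0 Y B ∧
        ∀ j ∈ Y, 1 / 4 ≤ fill B j → ∀ j' ≤ I.K, I.r i ≤ j' → fill B j' < 1 / 4 → j' ∈ Y := by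
  induction k generalizing X with
  | zero => exact ⟨h, hX⟩
  | succ k ih =>
    rcases ha : (findSlot I (isLowFree I i X) 1 B).val with _ | j
    · rcases hc : (findSlot I (isRoomFree I i X) 1 B).val with _ | j₁
      -- A free slot remains; it lacks room, so its fullness exceeds `1 - s i ≥ 1/2`.
      · obtain ⟨j, hjX, hr, hK⟩ := h.exists_not_mem
        have := findSlot_roomFree_none hc hr (hB ▸ hK) hjX
        simp only [mediumLoop, Timed.val_bind, ha, hc, Timed.val_pure]
        exact ⟨j, by linarith, this⟩
      · rcases hd : (leastFull I i X 1 B).val with _ | ⟨j, g⟩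
        · obtain ⟨g1, g2, g3, g4⟩ := findSlot_roomFree_some hc
          exact (leastFull_ne_none_aux ((I.r_pos i).trans g2) (by omega) g1 g2 hd).elim
        · have hrun : (mediumLoop I i B (k + 1) X).val = (mediumLoop I i B k (j :: X)).val := by
            simp only [mediumLoop, Timed.val_bind, ha, hc, hd]
          rw [hrun]
          refine ih (j :: X) (h.cons_least hB ha hc hd) fun a _ _ j' hK hr hf => ?_
          by_contra hX'
          exact absurd hf (not_lt.2 (findSlot_lowFree_none ha hr (hB ▸ hK)
            fun hm => hX' (List.mem_cons_of_mem _ hm)))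
    · have hrun : (mediumLoop I i B (k + 1) X).val = (mediumLoop I i B k (j :: X)).val := by
        simp only [mediumLoop, Timed.val_bind, ha]
      rw [hrun]
      refine ih (j :: X) (h.cons_low hB hs ha) fun a ha' hfa j' hK hr hf => ?_
      rcases List.mem_cons.1 ha' with rfl | ha'
      -- The newly chosen slot is low itself, so the invariant asks nothing of it.
      · exact absurd (findSlot_lowFree_some ha).2.2.2.1 (not_lt.2 hfa)
      · exact List.mem_cons_of_mem _ (hX a ha' hfa j' hK hr hf)

/-- A single medium ad exceeds 1/4, so the fullness of a slot of medium ads jumps from 0 past 1/4.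
-/
theorem quarter_lt_fill {I : Instance} {B : Slots I} {j : ℕ}
    (h : ∀ i ∈ content B j, 1 / 4 < I.s i) (h0 : fill B j ≠ 0) : 1 / 4 < fill B j := by
  rw [fill] at h0 ⊢
  rcases hc : content B j with _ | ⟨i, t⟩
  · simp [hc] at h0
  · have h1 := h i (by simp [hc])
    have h2 := sizeSum_nonneg I t
    rw [sizeSum_cons]; linarith

/-- The parameter `ρ` is the release date of the last ad that was scheduled (initially 0). As the
ads are sorted, the remaining ones are released no earlier than `ρ`, so `Saturated` applies to each
of them. -/
theorem mediumAds_spec {I : Instance} (L : List (Fin I.n)) (A : Finset (Fin I.n)) (B : Slots I)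
    (ρ : ℕ) (h : FeasibleSlots I A B) (hl : LowFilled I A B) (hsat : Saturated I ρ B)
    (hA : ∀ i ∈ A, 1 / 4 < I.s i) (hL : ∀ i ∈ L, 1 / 4 < I.s i ∧ I.s i ≤ 1 / 2)
    (hLA : ∀ i ∈ L, i ∉ A) (hLn : L.Nodup) (hsort : L.Pairwise fun a b => I.r a ≤ I.r b)
    (hρ : ∀ i ∈ L, ρ ≤ I.r i) :
    FeasibleSlots I (A ∪ L.toFinset) (mediumAds I L B).val ∧
      LowFilled I (A ∪ L.toFinset) (mediumAds I L B).val := by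
  induction L generalizing A B ρ with
  | nil => simpa [mediumAds] using ⟨h, hl⟩
  | cons i t ih =>
    have hi := hL i (by simp)
    have hiA := hLA i (by simp)
    have hA' : ∀ i' ∈ insert i A, 1 / 4 < I.s i' := by
      intro i' hi'
      rcases Finset.mem_insert.1 hi' with rfl | hi'
      · exact hi.1
      · exact hA i' hi'
    rw [List.nodup_cons] at hLn
    rw [List.pairwise_cons] at hsort
    have hLA' : ∀ i' ∈ t, i' ∉ insert i A := by
      intro i' hi' hmem
      rcases Finset.mem_insert.1 hmem with rfl | hmem
      · exact hLn.1 hi'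
      · exact hLA i' (by simp [hi']) hmem
    have hun : A ∪ (i :: t).toFinset = insert i A ∪ t.toFinset := by ext; simp
    rw [hun]
    have hspec := mediumLoop_spec h.length hi.2 (I.w i) [] (LoopState.init I i B) (by simp)
    rcases ho : (mediumLoop I i B (I.w i) []).val with _ | X
    · have hrun : (mediumAds I (i :: t) B).val = (mediumAds I t B).val := by
        simp only [mediumAds, Timed.val_bind, readFreq_val, ho]
      rw [ho] at hspec
      obtain ⟨j, hj1, hj2⟩ := hspec
      rw [hrun]
      refine ih (insert i A) B ρ (h.insert i) (hl.insert fun j' hK hr => ?_) hsat hA'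
        (fun i' hi' => hL i' (by simp [hi'])) hLA' hLn.2 hsort.2 fun i' hi' => hρ i' (by simp [hi'])
      -- A discard exhibits a slot above 1/2; by saturation a low slot then precedes `ρ ≤ r i`.
      by_contra hf
      have := hsat j (by linarith) j' hK (not_le.1 hf)
      have := hρ i (by simp)
      omega
    · have hrun : (mediumAds I (i :: t) B).val =
          (mediumAds I t (addCopies I i X 1 B).val).val := by
        simp only [mediumAds, Timed.val_bind, readFreq_val, ho]
      rw [ho] at hspec
      obtain ⟨hX, hXl⟩ := hspec
      have hX' : ∀ j ∈ X, 1 ≤ j ∧ j ≤ B.length := by rw [h.length]; exact hX.mem_bounds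
      rw [hrun]
      refine ih (insert i A) _ (I.r i) (h.addCopies hiA hX) (hl.addCopies h.toValid hiA hX) ?_ hA'
        (fun i' hi' => hL i' (by simp [hi'])) hLA' hLn.2 hsort.2 hsort.1
      intro j hj j' hK hj'
      -- A slot that receives a medium ad is no longer low.
      have hj'X : j' ∉ X := by
        intro hm
        rw [fill_addCopies i hX', if_pos hm] at hj'
        have := sizeSum_nonneg I (content B j')
        rw [fill] at hj'
        linarith [hi.1]
      rw [fill_addCopies i hX', if_neg hj'X] at hj'
      rw [fill_addCopies i hX'] at hj
      by_contra hr
      rw [not_lt] at hr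
      by_cases hold : 1 / 2 < fill B j
      · have := hsat j hold j' hK hj'
        have := hρ i (by simp)
        omega
      · split_ifs at hj with hjX
        -- One copy has size at most 1/2, so `j` was nonempty before and thus above 1/4. Such a slot
        -- is chosen only after all low slots from `r i` on, which would include `j'`.
        · have h0 : fill B j ≠ 0 := by intro h0; rw [h0] at hj; linarith [hi.2]
          have := quarter_lt_fill (fun i' hi' => hA i' (h.sub j i' hi')) h0
          exact hj'X (hXl j hjX this.le j' hK hr hj')
        · exact hold hj

theorem algMedium_spec {I : Instance} {M : List (Fin I.n)} (hM : M.Nodup)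
    (hs : ∀ i ∈ M, 1 / 4 < I.s i ∧ I.s i ≤ 1 / 2) :
    FeasibleSlots I M.toFinset (algMedium I M).val ∧
      LowFilled I M.toFinset (algMedium I M).val := by
  have hp := sortAds_perm I M
  have := mediumAds_spec (sortAds I M).val ∅ (List.replicate I.K []) 0 (feasibleSlots_replicate I)
    -- Empty slots never exceed 1/2, so saturation holds vacuously at the start.
    (lowFilled_empty I _) (fun j hj => by rw [fill, content_replicate] at hj; norm_num at hj)
    (by simp) (fun i hi => hs i (hp.mem_iff.1 hi)) (by simp) (hp.nodup_iff.2 hM)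
    (sortAds_pairwise I M) (by simp)
  rw [Finset.empty_union, List.toFinset_eq_of_perm _ _ hp] at this
  simpa [algMedium] using this


/-! ## Small ads -/

/-! ### Collecting and moving small ads -/

theorem takeQuarter_sublist (I : Instance) (l : List (Fin I.n)) (acc : ℚ) :
    (takeQuarter I l acc).val.Sublist l := by
  induction l generalizing acc with
  | nil => simp [takeQuarter]
  | cons i t ih =>
    by_cases h : 1 / 4 ≤ acc
    · simp only [one_div] at h; simp [takeQuarter, h]
    · simp only [one_div] at h; simp [takeQuarter, h, ih]

/-- An ad is taken only while the total is below 1/4, and it contributes at most 1/4. -/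
theorem takeQuarter_lt {I : Instance} {l : List (Fin I.n)} (hl : ∀ i ∈ l, I.s i ≤ 1 / 4) {acc : ℚ}
    (hacc : acc < 1 / 2) : acc + sizeSum I (takeQuarter I l acc).val < 1 / 2 := by
  induction l generalizing acc with
  | nil => simp only [takeQuarter, Timed.val_bind, Timed.val_pure, sizeSum_nil]; linarith
  | cons i t ih =>
    by_cases h : 1 / 4 ≤ acc
    · have : (takeQuarter I (i :: t) acc).val = [] := by
        simp only [one_div] at h; simp [takeQuarter, h]
      rw [this, sizeSum_nil]; linarith
    · have : (takeQuarter I (i :: t) acc).val = i :: (takeQuarter I t (acc + I.s i)).val := by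
        simp only [one_div] at h; simp [takeQuarter, h]
      rw [this, sizeSum_cons, ← add_assoc]
      exact ih (fun i' hi' => hl i' (by simp [hi'])) (by linarith [hl i (by simp)])

/-- The collection stops early only after 1/4 is reached; otherwise the whole list is taken. -/
theorem le_takeQuarter {I : Instance} {l : List (Fin I.n)} {acc : ℚ}
    (hacc : 1 / 4 ≤ acc + sizeSum I l) : 1 / 4 ≤ acc + sizeSum I (takeQuarter I l acc).val := by
  induction l generalizing acc with
  | nil => simpa [takeQuarter] using hacc
  | cons i t ih =>
    by_cases h : 1 / 4 ≤ acc
    · have : (takeQuarter I (i :: t) acc).val = [] := by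
        simp only [one_div] at h; simp [takeQuarter, h]
      rw [this, sizeSum_nil]; linarith
    · have : (takeQuarter I (i :: t) acc).val = i :: (takeQuarter I t (acc + I.s i)).val := by
        simp only [one_div] at h; simp [takeQuarter, h]
      rw [this, sizeSum_cons, ← add_assoc]
      exact ih (by rwa [sizeSum_cons, ← add_assoc] at hacc)

/-- The ads that are moved from slot `j₂` to slot `j₁`. -/
def movedAds {I : Instance} (j₁ j₂ : ℕ) (B : Slots I) : List (Fin I.n) :=
  (takeQuarter I ((content B j₂).filter (· ∉ content B j₁)) 0).val

theorem mem_of_mem_movedAds {I : Instance} {j₁ j₂ : ℕ} {B : Slots I} {i : Fin I.n}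
    (h : i ∈ movedAds j₁ j₂ B) : i ∈ content B j₂ ∧ i ∉ content B j₁ := by
  simpa using (takeQuarter_sublist I _ 0).subset h

theorem movedAds_nodup {I : Instance} {j₁ j₂ : ℕ} {B : Slots I} (h : (content B j₂).Nodup) :
    (movedAds j₁ j₂ B).Nodup := (h.filter _).sublist (takeQuarter_sublist I _ 0)

section move
variable {I : Instance} {j₁ j₂ : ℕ} {B : Slots I}

theorem moveAds_length (h₁ : 1 ≤ j₁) (h₂ : 1 ≤ j₂) :
    (moveAds I j₁ j₂ B).val.length = B.length := by
  simp only [moveAds, Timed.val_bind]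
  rw [setSlot_length _ _ _ h₂, setSlot_length _ _ _ h₁]

theorem content_moveAds (h₁ : 1 ≤ j₁) (h₁' : j₁ ≤ B.length) (h₂ : 1 ≤ j₂) (h₂' : j₂ ≤ B.length)
    (k : ℕ) : content (moveAds I j₁ j₂ B).val k =
      if k = j₂ then (content B j₂).filter (· ∉ movedAds j₁ j₂ B)
      else if k = j₁ then movedAds j₁ j₂ B ++ content B j₁ else content B k := by
  simp only [moveAds, Timed.val_bind, diffAds_val, appendAds_val, getSlot_val I _ h₁,
    getSlot_val I _ h₂]
  rw [content_setSlot _ _ _ _ h₂ (by rwa [setSlot_length _ _ _ h₁]),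
    content_setSlot _ _ _ _ h₁ h₁']
  rfl

theorem mem_content_moveAds (h₁ : 1 ≤ j₁) (h₁' : j₁ ≤ B.length) (h₂ : 1 ≤ j₂)
    (h₂' : j₂ ≤ B.length) (hne : j₁ ≠ j₂) (k : ℕ) (i : Fin I.n) :
    i ∈ content (moveAds I j₁ j₂ B).val k ↔
      (i ∈ movedAds j₁ j₂ B ∧ k = j₁) ∨
        (i ∈ content B k ∧ ¬ (i ∈ movedAds j₁ j₂ B ∧ k = j₂)) := by
  rw [content_moveAds h₁ h₁' h₂ h₂']
  split_ifs with h h'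
  · subst h; simp [Ne.symm hne]
  · subst h'; simp [hne]
  · simp [h, h']

theorem Valid.moveAds {A : Finset (Fin I.n)} (h : Valid I A B) (h₁ : 1 ≤ j₁)
    (h₁' : j₁ ≤ I.K) (h₂ : 1 ≤ j₂) (h₂' : j₂ ≤ I.K) (hne : j₁ ≠ j₂) :
    Valid I A (moveAds I j₁ j₂ B).val := by
  rw [← h.length] at h₁' h₂'
  refine ⟨by rw [moveAds_length h₁ h₂, h.length], fun j => ?_, fun j i hi => ?_⟩
  · rw [content_moveAds h₁ h₁' h₂ h₂']
    split_ifs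
    · exact (h.nodup j₂).filter _
    · exact List.nodup_append'.2 ⟨movedAds_nodup (h.nodup j₂), h.nodup j₁,
        fun i hi hi' => (mem_of_mem_movedAds hi).2 hi'⟩
    · exact h.nodup j
  · rcases (mem_content_moveAds h₁ h₁' h₂ h₂' hne j i).1 hi with hi | hi
    · exact h.sub j₂ i (mem_of_mem_movedAds hi.1).1
    · exact h.sub j i hi.1

/-- A moved ad trades its copy in `j₂` for one in `j₁`, where it was absent. -/
theorem card_copies_moveAds (h₁ : 1 ≤ j₁) (h₁' : j₁ ≤ B.length) (h₂ : 1 ≤ j₂)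
    (h₂' : j₂ ≤ B.length) (hne : j₁ ≠ j₂) (i : Fin I.n) :
    (copies (moveAds I j₁ j₂ B).val i).card = (copies B i).card := by
  by_cases hi : i ∈ movedAds j₁ j₂ B
  · have e : copies (moveAds I j₁ j₂ B).val i = insert j₁ ((copies B i).erase j₂) := by
      ext k
      simp only [mem_copies, mem_content_moveAds h₁ h₁' h₂ h₂' hne, hi, Finset.mem_insert,
        Finset.mem_erase, true_and]
      tauto
    have := mem_of_mem_movedAds hi
    rw [e, Finset.card_insert_of_notMem (by simp [mem_copies, this.2]),
      Finset.card_erase_add_one (mem_copies.2 this.1)]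
  · congr 1
    ext k
    simp [mem_copies, mem_content_moveAds h₁ h₁' h₂ h₂' hne, hi]

theorem fill_moveAds (h₁ : 1 ≤ j₁) (h₁' : j₁ ≤ B.length) (h₂ : 1 ≤ j₂) (h₂' : j₂ ≤ B.length)
    (hn : (content B j₂).Nodup) (k : ℕ) : fill (moveAds I j₁ j₂ B).val k =
      if k = j₂ then fill B j₂ - sizeSum I (movedAds j₁ j₂ B)
      else if k = j₁ then sizeSum I (movedAds j₁ j₂ B) + fill B j₁ else fill B k := by
  simp only [fill, content_moveAds h₁ h₁' h₂ h₂']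
  split_ifs
  · have h := sizeSum_filter_add I (· ∉ movedAds j₁ j₂ B) (content B j₂)
    -- What the filter removes from `j₂` is exactly the moved set, because the moved ads all come
    -- from `j₂`.
    have h' : sizeSum I ((content B j₂).filter fun i => !decide (i ∉ movedAds j₁ j₂ B)) =
        sizeSum I (movedAds j₁ j₂ B) := by
      rw [sizeSum_eq_sum (hn.filter _), sizeSum_eq_sum (movedAds_nodup hn)]
      congr 1
      ext i
      simp only [List.mem_toFinset, List.mem_filter]
      constructor
      · simp
      · intro hi; simp [hi, (mem_of_mem_movedAds hi).1]
    linarith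
  · rw [sizeSum_append]
  · rfl

/-- Discarding the ads that also occur in `j₁` costs less than 1/4 of the 3/4 in `j₂`, so more than
1/2 is available for the collection. -/
theorem sizeSum_movedAds {A : Finset (Fin I.n)} (h : Valid I A B) (hA : ∀ i ∈ A, I.s i ≤ 1 / 4)
    (hf₁ : fill B j₁ < 1 / 4) (hf₂ : 3 / 4 ≤ fill B j₂) :
    1 / 4 ≤ sizeSum I (movedAds j₁ j₂ B) ∧ sizeSum I (movedAds j₁ j₂ B) < 1 / 2 := by
  constructor
  · rw [← zero_add (sizeSum I _)]
    refine le_takeQuarter ?_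
    have h1 := sizeSum_filter_add I (· ∉ content B j₁) (content B j₂)
    have h2 : sizeSum I ((content B j₂).filter fun i => !decide (i ∉ content B j₁)) ≤
        sizeSum I (content B j₁) :=
      sizeSum_le_of_subset ((h.nodup j₂).filter _) (h.nodup j₁) fun i hi => by
        simpa using (List.mem_filter.1 hi).2
    rw [fill] at hf₁ hf₂
    linarith
  · rw [← zero_add (sizeSum I _)]
    refine takeQuarter_lt (fun i hi => hA i (h.sub j₂ i (List.mem_filter.1 hi).1)) (by norm_num)

end move

/-- Ads are moved from slot `j₂` to the first slot of `X` of fullness less than `1/4`,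
and `j₂` is chosen. -/
theorem move_spec {I : Instance} {A : Finset (Fin I.n)} {B : Slots I} {i : Fin I.n} {k : ℕ}
    {X : List ℕ} {j₁ j₂ : ℕ} (h : FeasibleSlots I A B) (hl : LowFilled I A B)
    (hA : ∀ i ∈ A, I.s i ≤ 1 / 4) (hi : I.s i ≤ 1 / 4) (hr : ∀ i' ∈ A, I.r i' ≤ I.r i)
    (hX : LoopState I i (k + 1) X B) (ha : (findSlot I (isLowFree I i X) 1 B).val = none)
    (hu : (findSlot I (isLowUsed I i X) 1 B).val = some j₁)
    (hv : (findSlot I (isHighFree I i X) 1 B).val = some j₂) :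
    FeasibleSlots I A (moveAds I j₁ j₂ B).val ∧ LowFilled I A (moveAds I j₁ j₂ B).val ∧
      LoopState I i k (j₂ :: X) (moveAds I j₁ j₂ B).val := by
  obtain ⟨u1, u2, u3, u4, u5⟩ := findSlot_lowUsed_some hu
  obtain ⟨v1, v2, v3, v4⟩ := findSlot_highFree_some hv
  have p1 : 1 ≤ j₁ := (I.r_pos i).trans u2
  have p2 : 1 ≤ j₂ := (I.r_pos i).trans v2
  have hne : j₁ ≠ j₂ := by rintro rfl; exact v1 u1
  obtain ⟨t1, t2⟩ := sizeSum_movedAds h.toValid hA u4 v4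
  have hfill := fill_moveAds p1 u3 p2 v3 (h.nodup j₂)
  have hmem := mem_content_moveAds p1 u3 p2 v3 hne
  have hcard := card_copies_moveAds p1 u3 p2 v3 hne
  -- A move creates no low slot: `j₁` gains at least 1/4, and `j₂` keeps more than 3/4 - 1/2.
  have hlow : ∀ j, fill (moveAds I j₁ j₂ B).val j < 1 / 4 → j ≠ j₁ ∧ j ≠ j₂ ∧ fill B j < 1 / 4 := by
    intro j hj
    rw [hfill] at hj
    split_ifs at hj with e1 e2
    · linarith
    · have := sizeSum_nonneg I (content B j₁)
      rw [fill] at hj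
      linarith
    · exact ⟨e2, e1, hj⟩
  refine ⟨⟨h.toValid.moveAds p1 (h.length ▸ u3) p2 (h.length ▸ v3) hne, ?_, ?_, ?_⟩, ?_, ?_⟩
  · intro j i' hi'
    rcases (hmem j i').1 hi' with ⟨hm, rfl⟩ | hi'
    -- Earlier ads are released no later than `i`, and `j₁` is at least `r i`.
    · exact (hr i' (h.sub j₂ i' (mem_of_mem_movedAds hm).1)).trans u2
    · exact h.released j i' hi'.1
  · intro j
    rw [hfill]
    split_ifs
    · linarith [h.fill_le j₂]
    · linarith
    · exact h.fill_le j
  · intro i'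
    rw [hcard]; exact h.count i'
  · intro i' hi' j hj hrj hf hij
    obtain ⟨e1, e2, hf'⟩ := hlow j hf
    have hij' : i' ∉ content B j := fun hc => hij ((hmem j i').2 (Or.inr ⟨hc, fun hc' => e2 hc'.2⟩))
    obtain ⟨q1, q2⟩ := hl i' hi' j hj hrj hf' hij'
    refine ⟨by rw [hcard, q1], fun j' hj' => ?_⟩
    rcases (hmem j' i').1 hj' with ⟨hm, rfl⟩ | hj'
    -- The crucial case: a moved ad is missing in a low slot `j`. Its old copy gives `j₂ < j`, hence
    -- `r i ≤ j`; no available slot is low, so `j` is chosen; and `j₁` is the first low chosen slot,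
    -- which is different from `j`.
    · have hlt := q2 j₂ (mem_of_mem_movedAds hm).1
      have hjX : j ∈ X := by
        by_contra hjX
        exact absurd hf' (not_lt.2 (findSlot_lowFree_none ha (by omega) (h.length ▸ hj) hjX))
      have := u5 j hjX (by omega) hf'
      omega
    · exact q2 j' hj'.1
  · refine ⟨List.nodup_cons.2 ⟨v1, hX.nodup⟩, by simpa [v2] using hX.release_le,
      by simpa [h.length ▸ v3] using hX.le_K, by have := hX.length; simp; omega, ?_, ?_⟩
    · intro j hj
      rw [hfill]
      -- Both slots end up with fullness at most 3/4, which leaves room for a copy of size at most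
      -- 1/4.
      split_ifs with e1 e2
      · linarith [h.fill_le j₂]
      · linarith
      · rcases List.mem_cons.1 hj with rfl | hj
        · exact absurd rfl e1
        · exact hX.room j hj
    · intro j hj hrj hjX hf
      obtain ⟨e1, e2, hf'⟩ := hlow j hf
      exact absurd hf' (not_lt.2 (findSlot_lowFree_none ha hrj (h.length ▸ hj)
        fun hc => hjX (List.mem_cons_of_mem _ hc)))

section run
variable {I : Instance} {i : Fin I.n} {k : ℕ} {X : List ℕ} {B : Slots I}

/-! ### One round of the loop for small ads -/

theorem smallLoop_low {j : ℕ} (ha : (findSlot I (isLowFree I i X) 1 B).val = some j) :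
    (smallLoop I i (k + 1) X B).val = (smallLoop I i k (j :: X) B).val := by
  simp only [smallLoop, Timed.val_bind, ha]

theorem smallLoop_move (ha : (findSlot I (isLowFree I i X) 1 B).val = none) {j₁ j₂ : ℕ}
    (hu : (findSlot I (isLowUsed I i X) 1 B).val = some j₁)
    (hv : (findSlot I (isHighFree I i X) 1 B).val = some j₂) :
    (smallLoop I i (k + 1) X B).val =
      (smallLoop I i k (j₂ :: X) (moveAds I j₁ j₂ B).val).val := by
  simp only [smallLoop, Timed.val_bind, ha, hu, hv]

theorem smallLoop_discard (ha : (findSlot I (isLowFree I i X) 1 B).val = none)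
    (huv : (findSlot I (isLowUsed I i X) 1 B).val = none ∨
      (findSlot I (isHighFree I i X) 1 B).val = none)
    (hc : (findSlot I (isRoomFree I i X) 1 B).val = none) :
    (smallLoop I i (k + 1) X B).val = (B, none) := by
  rcases huv with h | h
  · simp only [smallLoop, Timed.val_bind, ha, h, hc, Timed.val_pure]
  -- The joint match reduces to its default branch only after the first option is known as well.
  · rcases hu : (findSlot I (isLowUsed I i X) 1 B).val with _ | j <;>
    simp only [smallLoop, Timed.val_bind, ha, h, hc, hu, Timed.val_pure]

theorem smallLoop_least (ha : (findSlot I (isLowFree I i X) 1 B).val = none)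
    (huv : (findSlot I (isLowUsed I i X) 1 B).val = none ∨
      (findSlot I (isHighFree I i X) 1 B).val = none) {j₁ j : ℕ} {g : ℚ}
    (hc : (findSlot I (isRoomFree I i X) 1 B).val = some j₁)
    (hd : (leastFull I i X 1 B).val = some (j, g)) :
    (smallLoop I i (k + 1) X B).val = (smallLoop I i k (j :: X) B).val := by
  rcases huv with h | h
  · simp only [smallLoop, Timed.val_bind, ha, h, hc, hd]
  · rcases hu : (findSlot I (isLowUsed I i X) 1 B).val with _ | j <;>
    simp only [smallLoop, Timed.val_bind, ha, h, hc, hd, hu]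

end run

/-- A discard leaves a free slot without room, of fullness above `1 - s i ≥ 3/4`. The search for a
high free slot thus succeeds, so case (b) can have failed only for want of a low chosen slot; low
free slots are excluded by case (a). -/
theorem smallLoop_spec {I : Instance} {A : Finset (Fin I.n)} {i : Fin I.n}
    (hA : ∀ i ∈ A, I.s i ≤ 1 / 4) (hi : I.s i ≤ 1 / 4) (hr : ∀ i' ∈ A, I.r i' ≤ I.r i) (k : ℕ)
    (X : List ℕ) (B : Slots I) (h : FeasibleSlots I A B) (hl : LowFilled I A B)
    (hX : LoopState I i k X B) :
    match (smallLoop I i k X B).val with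
    | (B', none) => FeasibleSlots I A B' ∧ LowFilled I A B' ∧
        ∀ j ≤ I.K, I.r i ≤ j → 1 / 4 ≤ fill B' j
    | (B', some Y) => FeasibleSlots I A B' ∧ LowFilled I A B' ∧ LoopState I i 0 Y B' := by
  induction k generalizing X B with
  | zero => exact ⟨h, hl, hX⟩
  | succ k ih =>
    rcases ha : (findSlot I (isLowFree I i X) 1 B).val with _ | j
    swap
    · rw [smallLoop_low ha]
      exact ih _ _ h hl (hX.cons_low h.length (by linarith) ha)
    by_cases huv : (findSlot I (isLowUsed I i X) 1 B).val = none ∨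
        (findSlot I (isHighFree I i X) 1 B).val = none
    swap
    · rw [not_or] at huv
      obtain ⟨j₁, hu⟩ := Option.ne_none_iff_exists'.1 huv.1
      obtain ⟨j₂, hv⟩ := Option.ne_none_iff_exists'.1 huv.2
      rw [smallLoop_move ha hu hv]
      obtain ⟨m1, m2, m3⟩ := move_spec h hl hA hi hr hX ha hu hv
      exact ih _ _ m1 m2 m3
    rcases hc : (findSlot I (isRoomFree I i X) 1 B).val with _ | j₁
    · rw [smallLoop_discard ha huv hc]
      refine ⟨h, hl, fun j hK hrj => ?_⟩
      obtain ⟨j₀, hj₀, hr₀, hK₀⟩ := hX.exists_not_mem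
      have hf₀ := findSlot_roomFree_none hc hr₀ (h.length ▸ hK₀) hj₀
      rcases huv with hu | hv
      · by_cases hjX : j ∈ X
        · exact findSlot_lowUsed_none hu hrj (h.length ▸ hK) hjX
        · exact findSlot_lowFree_none ha hrj (h.length ▸ hK) hjX
      -- This alternative is contradictory: the free slot `j₀` is high.
      · have := findSlot_highFree_none hv hr₀ (h.length ▸ hK₀) hj₀
        linarith
    · rcases hd : (leastFull I i X 1 B).val with _ | ⟨j, g⟩
      · obtain ⟨g1, g2, g3, g4⟩ := findSlot_roomFree_some hc
        exact (leastFull_ne_none_aux ((I.r_pos i).trans g2) (by omega) g1 g2 hd).elim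
      · rw [smallLoop_least ha huv hc hd]
        exact ih _ _ h hl (hX.cons_least h.length ha hc hd)

/-- The hypothesis `hr` is maintained by sorting; it is what allows ads that were placed earlier to
be moved to any slot from the current release date on. -/
theorem smallAds_spec {I : Instance} (L : List (Fin I.n)) (A : Finset (Fin I.n)) (B : Slots I)
    (h : FeasibleSlots I A B) (hl : LowFilled I A B)
    (hA : ∀ i ∈ A, I.s i ≤ 1 / 4) (hL : ∀ i ∈ L, I.s i ≤ 1 / 4)
    (hLA : ∀ i ∈ L, i ∉ A) (hLn : L.Nodup) (hsort : L.Pairwise fun a b => I.r a ≤ I.r b)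
    (hr : ∀ i ∈ L, ∀ i' ∈ A, I.r i' ≤ I.r i) :
    FeasibleSlots I (A ∪ L.toFinset) (smallAds I L B).val ∧
      LowFilled I (A ∪ L.toFinset) (smallAds I L B).val := by
  induction L generalizing A B with
  | nil => simpa [smallAds] using ⟨h, hl⟩
  | cons i t ih =>
    have hi := hL i (by simp)
    have hiA := hLA i (by simp)
    rw [List.nodup_cons] at hLn
    rw [List.pairwise_cons] at hsort
    have hA' : ∀ i' ∈ insert i A, I.s i' ≤ 1 / 4 := by
      intro i' hi'
      rcases Finset.mem_insert.1 hi' with rfl | hi'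
      · exact hi
      · exact hA i' hi'
    have hLA' : ∀ i' ∈ t, i' ∉ insert i A := by
      intro i' hi' hmem
      rcases Finset.mem_insert.1 hmem with rfl | hmem
      · exact hLn.1 hi'
      · exact hLA i' (by simp [hi']) hmem
    have hr' : ∀ a ∈ t, ∀ i' ∈ insert i A, I.r i' ≤ I.r a := by
      intro a ha i' hi'
      rcases Finset.mem_insert.1 hi' with rfl | hi'
      · exact hsort.1 a ha
      · exact hr a (by simp [ha]) i' hi'
    have hun : A ∪ (i :: t).toFinset = insert i A ∪ t.toFinset := by ext; simp
    rw [hun]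
    have hspec := smallLoop_spec hA hi (hr i (by simp)) (I.w i) [] B h hl (LoopState.init I i B)
    rcases ho : (smallLoop I i (I.w i) [] B).val with ⟨B', _ | X⟩
    · have hrun : (smallAds I (i :: t) B).val = (smallAds I t B').val := by
        simp only [smallAds, Timed.val_bind, readFreq_val, ho]
      rw [ho] at hspec
      obtain ⟨q1, q2, q3⟩ := hspec
      rw [hrun]
      exact ih (insert i A) B' (q1.insert i) (q2.insert q3) hA'
        (fun i' hi' => hL i' (by simp [hi'])) hLA' hLn.2 hsort.2 hr'
    · have hrun : (smallAds I (i :: t) B).val = (smallAds I t (addCopies I i X 1 B').val).val := by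
        simp only [smallAds, Timed.val_bind, readFreq_val, ho]
      rw [ho] at hspec
      obtain ⟨q1, q2, q3⟩ := hspec
      rw [hrun]
      exact ih (insert i A) _ (q1.addCopies hiA q3) (q2.addCopies q1.toValid hiA q3) hA'
        (fun i' hi' => hL i' (by simp [hi'])) hLA' hLn.2 hsort.2 hr'

theorem algSmall_spec {I : Instance} {P : List (Fin I.n)} (hP : P.Nodup)
    (hs : ∀ i ∈ P, I.s i ≤ 1 / 4) :
    FeasibleSlots I P.toFinset (algSmall I P).val ∧
      LowFilled I P.toFinset (algSmall I P).val := by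
  have hp := sortAds_perm I P
  have := smallAds_spec (sortAds I P).val ∅ (List.replicate I.K []) (feasibleSlots_replicate I)
    (lowFilled_empty I _) (by simp) (fun i hi => hs i (hp.mem_iff.1 hi)) (by simp)
    (hp.nodup_iff.2 hP) (sortAds_pairwise I P) (by simp)
  rw [Finset.empty_union, List.toFinset_eq_of_perm _ _ hp] at this
  simpa [algSmall] using this


/-! ## Large ads -/

/-- The entry in column `j` after processing the ads of the list, the last one first. -/
def dp (I : Instance) : List (Fin I.n) → ℕ → ℚ
  | [], _ => 0
  | i :: t, j =>
    if I.r i + I.w i - 1 ≤ j then max (dp I t j) (dp I t (j - I.w i) + I.w i * I.s i)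
    else dp I t j

/-- The row of the entries `dp I t 0, …, dp I t K`. -/
def dpList (I : Instance) (t : List (Fin I.n)) : List ℚ := (List.range (I.K + 1)).map (dp I t)

/-- The processed ads, each with the row before it. -/
def dpStack (I : Instance) : List (Fin I.n) → List (Fin I.n × List ℚ)
  | [] => []
  | i :: t => (i, dpList I t) :: dpStack I t

theorem dpList_getD (I : Instance) (t : List (Fin I.n)) {j : ℕ} (hj : j ≤ I.K) :
    (dpList I t).getD j 0 = dp I t j := by
  have : j < (dpList I t).length := by simp [dpList]; omega
  rw [List.getD_eq_getElem _ _ this]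
  simp [dpList]

theorem dpEntry_val (I : Instance) (i : Fin I.n) (t : List (Fin I.n)) {j : ℕ} (hj : j ≤ I.K) :
    (dpEntry I i (dpList I t) j).val = dp I (i :: t) j := by
  have h1 := dpList_getD I t hj
  have h2 := dpList_getD I t (show j - I.w i ≤ I.K by omega)
  by_cases h : I.r i + I.w i - 1 ≤ j
  · by_cases h' : dp I t j ≤ dp I t (j - I.w i) + I.w i * I.s i
    · simp only [dpEntry, Timed.val_bind, readSize_val, readFreq_val, readRel_val, addNat_val,
        subNat_val, entry_val, leNat_val, h, decide_true, if_true, h1, h2, mulNatRat_val,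
        addRat_val, leRat_val, h', Timed.val_pure, dp, max_eq_right h']
    · simp only [dpEntry, Timed.val_bind, readSize_val, readFreq_val, readRel_val, addNat_val,
        subNat_val, entry_val, leNat_val, h, decide_true, if_true, h1, h2, mulNatRat_val,
        addRat_val, leRat_val, h', Timed.val_pure, dp, max_eq_left (not_le.1 h').le, decide_false,
        Bool.false_eq_true, if_false]
  · simp only [dpEntry, Timed.val_bind, readSize_val, readFreq_val, readRel_val, addNat_val,
      subNat_val, entry_val, leNat_val, h, h1, Timed.val_pure, dp, decide_false,
      Bool.false_eq_true, if_false]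

theorem dpRow_val (I : Instance) (i : Fin I.n) (t : List (Fin I.n)) (j k : ℕ)
    (hk : j + k ≤ I.K + 1) :
    (dpRow I i (dpList I t) j k).val = (List.range' j k).map (dp I (i :: t)) := by
  induction k generalizing j with
  | zero => simp [dpRow]
  | succ k ih =>
    simp only [dpRow, Timed.val_bind, dpEntry_val I i t (show j ≤ I.K by omega), addNat_val,
      ih (j + 1) (by omega), Timed.val_pure, List.range'_succ, List.map_cons]

theorem dpRow_eq_dpList (I : Instance) (i : Fin I.n) (t : List (Fin I.n)) :
    (dpRow I i (dpList I t) 0 (I.K + 1)).val = dpList I (i :: t) := by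
  rw [dpRow_val I i t 0 _ (by omega), dpList, List.range_eq_range']

/-- The accumulator holds the latest ad first, which is why the processed list appears reversed; the
induction needs an arbitrary list of ads already processed. -/
theorem dpTable_val (I : Instance) (L t : List (Fin I.n)) :
    (dpTable I L (dpList I t) (dpStack I t)).val =
      (dpList I (L.reverse ++ t), dpStack I (L.reverse ++ t)) := by
  induction L generalizing t with
  | nil => simp [dpTable]
  | cons i L ih =>
    have := ih (i :: t)
    rw [dpStack] at this
    simp only [dpTable, Timed.val_bind, readK_val, addNat_val, dpRow_eq_dpList, this,
      List.reverse_cons, List.append_assoc, List.singleton_append]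

theorem dpList_nil (I : Instance) : dpList I [] = List.replicate (I.K + 1) 0 := by
  rw [dpList, List.eq_replicate_iff]
  refine ⟨by simp, fun x hx => ?_⟩
  obtain ⟨j, -, rfl⟩ := List.mem_map.1 hx
  rfl

/-! ### The recursion bounds all schedules of large ads -/

/-- An upper bound for sets of ads that satisfy the counting condition of Hall for the slots
`1, …, j`. -/
theorem sum_le_dp {I : Instance} (t : List (Fin I.n)) (hn : t.Nodup)
    (hsort : t.Pairwise fun a b => I.r b ≤ I.r a) (A : Finset (Fin I.n)) (hA : ∀ i ∈ A, i ∈ t)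
    (j : ℕ) (hj : ∀ i ∈ A, I.r i + ∑ i' ∈ A with I.r i ≤ I.r i', I.w i' ≤ j + 1) :
    ∑ i ∈ A, (I.w i : ℚ) * I.s i ≤ dp I t j := by
  induction t generalizing A j with
  | nil =>
    have : A = ∅ := Finset.eq_empty_of_forall_notMem fun i hi => by simpa using hA i hi
    simp [this, dp]
  | cons a t ih =>
    rw [List.nodup_cons] at hn
    rw [List.pairwise_cons] at hsort
    by_cases ha : a ∈ A
    · have hcond := hj a ha
      have hmem : a ∈ A.filter fun i' => I.r a ≤ I.r i' := by simp [ha]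
      have hle : I.w a ≤ ∑ i' ∈ A with I.r a ≤ I.r i', I.w i' :=
        Finset.single_le_sum (f := I.w) (fun _ _ => Nat.zero_le _) hmem
      -- The condition of `a` itself gives `r a + w a ≤ j + 1`, so the recursion may take `a` in
      -- column `j`.
      rw [dp, if_pos (by omega), ← Finset.add_sum_erase A _ ha, add_comm]
      refine le_trans ?_ (le_max_right _ _)
      refine add_le_add ?_ le_rfl
      refine ih hn.2 hsort.2 (A.erase a) (fun i hi => ?_) _ fun i hi => ?_
      · rw [Finset.mem_erase] at hi
        exact (List.mem_cons.1 (hA i hi.2)).resolve_left hi.1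
      · rw [Finset.mem_erase] at hi
        have hit := (List.mem_cons.1 (hA i hi.2)).resolve_left hi.1
        have hc := hj i hi.2
        have hra := hsort.1 i hit
        -- The head has the latest release date, so it is counted in the condition of every other
        -- ad, and its removal lowers each count by `w a`.
        have hmem : a ∈ A.filter fun i' => I.r i ≤ I.r i' := by simp [ha, hra]
        rw [← Finset.add_sum_erase _ _ hmem, ← Finset.filter_erase] at hc
        -- Positivity of `r i` yields `w a ≤ j`, so `j - w a` is not truncated.
        have := I.r_pos i
        omega
    · have hle := ih hn.2 hsort.2 A (fun i hi => (List.mem_cons.1 (hA i hi)).resolve_left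
        (by rintro rfl; exact ha hi)) j hj
      rw [dp]
      split_ifs
      · exact hle.trans (le_max_left _ _)
      · exact hle

theorem Schedule.value_eq_sum {I : Instance} (S : Schedule I) {A' : Finset (Fin I.n)}
    (hSA : ∀ j, S j ⊆ A') (hc : ∀ i ∈ A', (Finset.univ.filter fun j => i ∈ S j).card = I.w i) :
    S.value = ∑ i ∈ A', (I.w i : ℚ) * I.s i := by
  have : S.value = ∑ j, ∑ i ∈ A', if i ∈ S j then I.s i else 0 := by
    refine Finset.sum_congr rfl fun j _ => ?_
    rw [← Finset.sum_filter, Schedule.fullness]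
    refine Finset.sum_congr ?_ fun _ _ => rfl
    ext i
    simpa using fun h => hSA j h
  rw [this, Finset.sum_comm]
  refine Finset.sum_congr rfl fun i hi => ?_
  rw [← Finset.sum_filter, Finset.sum_const, hc i hi, nsmul_eq_mul]

/-- Two large ads together exceed size 1, so the slot sets of distinct ads are disjoint; counting
those of all ads released at `r i` or later gives the hypothesis of `sum_le_dp`. -/
theorem value_le_dp {I : Instance} {A : Finset (Fin I.n)} (hA : ∀ i ∈ A, 1 / 2 < I.s i)
    {t : List (Fin I.n)} (hn : t.Nodup) (hsort : t.Pairwise fun a b => I.r b ≤ I.r a)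
    (ht : ∀ i ∈ A, i ∈ t) {S : Schedule I} (hS : S.Feasible A) : S.value ≤ dp I t I.K := by
  obtain ⟨A', hA', hSA, hcount, hfull, hrel⟩ := hS
  rw [S.value_eq_sum hSA hcount]
  refine sum_le_dp t hn hsort A' (fun i hi => ht i (hA' hi)) _ fun i hi => ?_
  have hdisj : ∀ i₁ ∈ A', ∀ i₂ ∈ A', i₁ ≠ i₂ → ∀ j, i₁ ∈ S j → i₂ ∉ S j := by
    intro i₁ h₁ i₂ h₂ hne j hj₁ hj₂
    have hsub : ({i₁, i₂} : Finset (Fin I.n)) ⊆ S j := by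
      intro x hx
      rcases Finset.mem_insert.1 hx with rfl | hx
      · exact hj₁
      · rw [Finset.mem_singleton.1 hx]; exact hj₂
    have := Finset.sum_le_sum_of_subset_of_nonneg hsub fun i _ _ => (I.s_pos i).le
    rw [Finset.sum_pair hne] at this
    have := hfull j
    rw [Schedule.fullness] at this
    linarith [hA i₁ (hA' h₁), hA i₂ (hA' h₂)]
  have hsum : ∑ i' ∈ A' with I.r i ≤ I.r i', I.w i' =
      ((A'.filter fun i' => I.r i ≤ I.r i').biUnion
        fun i' => Finset.univ.filter fun j => i' ∈ S j).card := by
    rw [Finset.card_biUnion]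
    · exact Finset.sum_congr rfl fun i' hi' => (hcount i' (Finset.mem_filter.1 hi').1).symm
    · intro i₁ h₁ i₂ h₂ hne
      rw [Function.onFun, Finset.disjoint_left]
      intro j hj₁ hj₂
      exact hdisj i₁ (Finset.mem_filter.1 h₁).1 i₂ (Finset.mem_filter.1 h₂).1 hne j
        (Finset.mem_filter.1 hj₁).2 (Finset.mem_filter.1 hj₂).2
  have hcard : ((A'.filter fun i' => I.r i ≤ I.r i').biUnion
      fun i' => Finset.univ.filter fun j => i' ∈ S j).card ≤ (Finset.Icc (I.r i) I.K).card := by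
    -- The shift by one turns an index of `Fin K` into a slot number.
    refine Finset.card_le_card_of_injOn (fun j => (j : ℕ) + 1) (fun j hj => ?_)
      fun j _ k _ e => Fin.ext (by simpa using e)
    simp only [Finset.coe_biUnion, Set.mem_iUnion, Finset.mem_coe, Finset.mem_filter,
      Finset.mem_univ, true_and] at hj
    obtain ⟨i', ⟨-, hr⟩, hj⟩ := hj
    have := hrel j i' hj
    have := j.2
    simp only [Finset.coe_Icc, Set.mem_Icc]
    omega
  rw [Nat.card_Icc] at hcard
  have := I.compatible i
  omega

/-! ### Backtracking realises the table value -/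

/-- What backtracking from column `j` does: the slots `1, …, j` are filled with a schedule of ads
of `t` of value `dp I t j`, with at most one ad in each slot. -/
structure DpPlaced (I : Instance) (t : List (Fin I.n)) (j : ℕ) (B R : Slots I) : Prop where
  length : R.length = B.length
  later : ∀ k, j < k → content R k = content B k
  single : ∀ k ≤ j, (content R k).length ≤ 1
  sub : ∀ k ≤ j, ∀ i ∈ content R k, i ∈ t ∧ I.r i ≤ k
  count : ∀ i ∈ t, ((Finset.Icc 1 j).filter fun k => i ∈ content R k).card = I.w i ∨
    ((Finset.Icc 1 j).filter fun k => i ∈ content R k).card = 0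
  value : ∑ k ∈ Finset.Icc 1 j, fill R k = dp I t j

/-- An ad that is taken fills the block that ends in column `j`, and the remaining ads only use
columns to the left of it. So blocks are disjoint, and the part to the right is final, which is why
the slots up to `j` may be assumed empty. -/
theorem dpBacktrack_spec {I : Instance} (t : List (Fin I.n)) (hn : t.Nodup) (j : ℕ)
    (hj : j ≤ I.K) (B : Slots I) (hB : B.length = I.K) (he : ∀ k ≤ j, content B k = []) :
    DpPlaced I t j B (dpBacktrack I (dpStack I t) (dpList I t) j B).val := by
  induction t generalizing j B with
  | nil =>
    have : (dpBacktrack I (dpStack I []) (dpList I []) j B).val = B := rfl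
    rw [this]
    refine ⟨rfl, fun _ _ => rfl, fun k hk => by simp [he k hk], fun k hk => by simp [he k hk],
      by simp, ?_⟩
    rw [dp]
    exact Finset.sum_eq_zero fun k hk => by simp [fill, he k (Finset.mem_Icc.1 hk).2]
  | cons a t ih =>
    rw [List.nodup_cons] at hn
    -- A strict increase shows that the guard of the recursion holds and that the maximum is
    -- attained by taking `a`.
    by_cases hlt : dp I t j < dp I (a :: t) j
    · have hbr : I.r a + I.w a - 1 ≤ j := by
        by_contra hbr
        rw [dp, if_neg hbr] at hlt
        exact lt_irrefl _ hlt
      have hra := I.r_pos a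
      have hwa := I.w_pos a
      have hval : dp I (a :: t) j = dp I t (j - I.w a) + I.w a * I.s a := by
        rw [dp, if_pos hbr] at hlt ⊢
        rcases max_cases (dp I t j) (dp I t (j - I.w a) + I.w a * I.s a) with h | h
        · rw [h.1] at hlt; exact absurd hlt (lt_irrefl _)
        · exact h.1
      set X := (interval (j - I.w a) (I.w a)).val with hXdef
      have hXmem : ∀ k, k ∈ X ↔ j - I.w a < k ∧ k ≤ j := fun k => by
        rw [hXdef, mem_interval, show j - I.w a + I.w a = j by omega]
      have hX : ∀ k ∈ X, 1 ≤ k ∧ k ≤ B.length := fun k hk => by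
        have := (hXmem k).1 hk; omega
      have hrun : (dpBacktrack I (dpStack I (a :: t)) (dpList I (a :: t)) j B).val =
          (dpBacktrack I (dpStack I t) (dpList I t) (j - I.w a) (addCopies I a X 1 B).val).val := by
        simp only [dpStack, dpBacktrack, Timed.val_bind, entry_val, dpList_getD I _ hj, ltRat_val,
          hlt, decide_true, if_true, readFreq_val, subNat_val, ← hXdef]
      rw [hrun]
      have hc := content_addCopies_of_subset a hX
      have hI := ih hn.2 (j - I.w a) (by omega) (addCopies I a X 1 B).val
        (by rw [addCopies_length, hB]) fun k hk => by
          rw [hc, if_neg (fun h => by have := (hXmem k).1 h; omega), he k (by omega)]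
      set R := (dpBacktrack I (dpStack I t) (dpList I t) (j - I.w a)
        (addCopies I a X 1 B).val).val
      have hmid : ∀ k, j - I.w a < k → k ≤ j → content R k = [a] := fun k h1 h2 => by
        rw [hI.later k h1, hc, if_pos ((hXmem k).2 ⟨h1, h2⟩), he k h2]
      have ha : ∀ k ≤ j - I.w a, a ∉ content R k := fun k hk h => hn.1 (hI.sub k hk a h).1
      refine ⟨by rw [hI.length, addCopies_length], fun k hk => ?_, fun k hk => ?_,
        fun k hk i hi => ?_, fun i hi => ?_, ?_⟩
      · rw [hI.later k (by omega), hc, if_neg (fun h => by have := (hXmem k).1 h; omega)]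
      · by_cases h : k ≤ j - I.w a
        · exact hI.single k h
        · rw [hmid k (by omega) hk]; simp
      · by_cases h : k ≤ j - I.w a
        · exact ⟨List.mem_cons_of_mem _ (hI.sub k h i hi).1, (hI.sub k h i hi).2⟩
        · rw [hmid k (by omega) hk, List.mem_singleton] at hi
          subst hi
          -- The guard gives `r a ≤ j - w a + 1`, the first slot of the block.
          exact ⟨List.mem_cons_self, by omega⟩
      · rcases List.mem_cons.1 hi with rfl | hi
        · left
          have : ((Finset.Icc 1 j).filter fun k => i ∈ content R k) =
              Finset.Ioc (j - I.w i) j := by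
            ext k
            simp only [Finset.mem_filter, Finset.mem_Icc, Finset.mem_Ioc]
            constructor
            · rintro ⟨⟨h1, h2⟩, h3⟩
              exact ⟨by by_contra h; exact ha k (by omega) h3, h2⟩
            · rintro ⟨h1, h2⟩
              exact ⟨⟨by omega, h2⟩, by rw [hmid k h1 h2]; simp⟩
          rw [this, Nat.card_Ioc]; omega
        · have : ((Finset.Icc 1 j).filter fun k => i ∈ content R k) =
              (Finset.Icc 1 (j - I.w a)).filter fun k => i ∈ content R k := by
            ext k
            simp only [Finset.mem_filter, Finset.mem_Icc]
            constructor
            · rintro ⟨⟨h1, h2⟩, h3⟩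
              refine ⟨⟨h1, ?_⟩, h3⟩
              by_contra h
              rw [hmid k (by omega) h2, List.mem_singleton] at h3
              exact hn.1 (h3 ▸ hi)
            · rintro ⟨⟨h1, h2⟩, h3⟩
              exact ⟨⟨h1, by omega⟩, h3⟩
          rw [this]; exact hI.count i hi
      · have hun : Finset.Icc 1 j = Finset.Icc 1 (j - I.w a) ∪ Finset.Ioc (j - I.w a) j := by
          ext k; simp only [Finset.mem_union, Finset.mem_Icc, Finset.mem_Ioc]; omega
        have hd : Disjoint (Finset.Icc 1 (j - I.w a)) (Finset.Ioc (j - I.w a) j) := by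
          rw [Finset.disjoint_left]; intro k; simp only [Finset.mem_Icc, Finset.mem_Ioc]; omega
        rw [hun, Finset.sum_union hd, hI.value, hval]
        congr 1
        have : ∀ k ∈ Finset.Ioc (j - I.w a) j, fill R k = I.s a := fun k hk => by
          rw [Finset.mem_Ioc] at hk
          rw [fill, hmid k hk.1 hk.2]; simp
        rw [Finset.sum_congr rfl this, Finset.sum_const, Nat.card_Ioc, nsmul_eq_mul,
          show j - (j - I.w a) = I.w a by omega]
    · have hrun : (dpBacktrack I (dpStack I (a :: t)) (dpList I (a :: t)) j B).val =
          (dpBacktrack I (dpStack I t) (dpList I t) j B).val := by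
        simp only [dpStack, dpBacktrack, Timed.val_bind, entry_val, dpList_getD I _ hj, ltRat_val,
          hlt, decide_false, Bool.false_eq_true, if_false]
      -- The recursion never decreases an entry, so without a strict increase the two entries agree.
      have hval : dp I (a :: t) j = dp I t j := by
        refine le_antisymm (not_lt.1 hlt) ?_
        rw [dp]
        split_ifs
        · exact le_max_left _ _
        · exact le_rfl
      rw [hrun]
      have hI := ih hn.2 j hj B hB he
      refine ⟨hI.length, hI.later, hI.single, fun k hk i hi => ⟨List.mem_cons_of_mem _
        (hI.sub k hk i hi).1, (hI.sub k hk i hi).2⟩, fun i hi => ?_, hval ▸ hI.value⟩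
      rcases List.mem_cons.1 hi with rfl | hi
      · right
        rw [Finset.card_eq_zero]
        refine Finset.filter_eq_empty_iff.2 fun k hk h => hn.1 ?_
        exact (hI.sub k (Finset.mem_Icc.1 hk).2 i h).1
      · exact hI.count i hi

theorem algLarge_val (I : Instance) (G : List (Fin I.n)) : (algLarge I G).val =
    (dpBacktrack I (dpStack I (sortAds I G).val.reverse) (dpList I (sortAds I G).val.reverse) I.K
      (List.replicate I.K [])).val := by
  have h := dpTable_val I (sortAds I G).val []
  rw [List.append_nil, dpList_nil] at h
  have h' : dpStack I [] = [] := rfl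
  rw [h'] at h
  simp only [algLarge, Timed.val_bind, readK_val, addNat_val, zeros_val, h, emptySlots_val]

theorem algLarge_spec {I : Instance} {G : List (Fin I.n)} (hG : G.Nodup) :
    FeasibleSlots I G.toFinset (algLarge I G).val ∧
      slotsSum I (algLarge I G).val = dp I (sortAds I G).val.reverse I.K := by
  have hp := (List.reverse_perm (sortAds I G).val).trans (sortAds_perm I G)
  have hI := dpBacktrack_spec (sortAds I G).val.reverse (hp.nodup_iff.2 hG) I.K le_rfl
    (List.replicate I.K []) (by simp) fun k _ => content_replicate _ _
  rw [← algLarge_val] at hI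
  set R := (algLarge I G).val
  have hlen : R.length = I.K := by rw [hI.length]; simp
  have hK : ∀ {k i}, i ∈ content R k → k ≤ I.K := fun h => hlen ▸ (mem_Icc_of_mem_content h).2
  have hs1 : ∀ k, (content R k).length ≤ 1 := fun k => by
    by_cases h : k ≤ I.K
    · exact hI.single k h
    · rw [content_of_length_lt R (by omega)]; simp
  refine ⟨⟨⟨hlen, fun k => ?_, fun k i hi => ?_⟩, fun k i hi => ?_, fun k => ?_, fun i => ?_⟩, ?_⟩
  · have := hs1 k
    rcases h : content R k with _ | ⟨a, _ | ⟨b, l⟩⟩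
    · exact List.nodup_nil
    · exact List.nodup_singleton a
    · rw [h] at this
      simp at this
  · exact List.mem_toFinset.2 (hp.mem_iff.1 (hI.sub k (hK hi) i hi).1)
  · exact (hI.sub k (hK hi) i hi).2
  · have h1 := sizeSum_le_length I (content R k)
    have h2 : ((content R k).length : ℚ) ≤ 1 := by exact_mod_cast hs1 k
    exact h1.trans h2
  · by_cases hi : i ∈ (sortAds I G).val.reverse
    · have := hI.count i hi
      rwa [← hlen] at this
    · right
      rw [Finset.card_eq_zero, copies]
      exact Finset.filter_eq_empty_iff.2 fun k _ h => hi (hI.sub k (hK h) i h).1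
  · rw [← hI.value, slotsSum_eq_sum, hlen, Finset.range_eq_Ico, Finset.sum_Ico_add' (fill R)]
    exact Finset.sum_congr (by ext; simp) fun _ _ => rfl

theorem isApproxSolution_algLarge {I : Instance} {G : List (Fin I.n)} (hG : G.Nodup)
    (hs : ∀ i ∈ G, 1 / 2 < I.s i) : IsApproxSolution I G.toFinset 1 (algLarge I G).val := by
  obtain ⟨h, hv⟩ := algLarge_spec hG
  refine ⟨_, represents_toSchedule h.toValid, h.feasible, fun S hS => ?_⟩
  rw [one_mul, value_toSchedule h.toValid, hv]
  have hp := (List.reverse_perm (sortAds I G).val).trans (sortAds_perm I G)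
  refine value_le_dp (fun i hi => hs i (by simpa using hi)) (hp.nodup_iff.2 hG)
    (List.pairwise_reverse.2 (sortAds_pairwise I G)) (fun i hi => ?_) hS
  exact hp.mem_iff.2 (by simpa using hi)

/-! ## The general algorithm -/

/-- The part of a schedule that consists of ads of `C`. -/
def Schedule.restrict {I : Instance} (S : Schedule I) (C : Finset (Fin I.n)) : Schedule I :=
  fun j => S j ∩ C

theorem Schedule.Feasible.restrict {I : Instance} {A : Finset (Fin I.n)} {S : Schedule I}
    (h : S.Feasible A) (C : Finset (Fin I.n)) : (S.restrict C).Feasible C := by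
  obtain ⟨A', hA', hSA, hcount, hfull, hrel⟩ := h
  refine ⟨A' ∩ C, Finset.inter_subset_right, fun j => Finset.inter_subset_inter_right (hSA j),
    fun i hi => ?_, fun j => ?_, fun j i hi => hrel j i (Finset.mem_inter.1 hi).1⟩
  · rw [Finset.mem_inter] at hi
    rw [← hcount i hi.1]
    congr 1
    ext j
    simp [Schedule.restrict, hi.2]
  · refine le_trans ?_ (hfull j)
    exact Finset.sum_le_sum_of_subset_of_nonneg Finset.inter_subset_left
      fun i _ _ => (I.s_pos i).le

/-- Only covering is needed: each displayed ad is counted in at least one part, and the other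
contributions are nonnegative. -/
theorem Schedule.value_le_restrict {I : Instance} (S : Schedule I) (C₁ C₂ C₃ : Finset (Fin I.n))
    (h : ∀ i, i ∈ C₁ ∨ i ∈ C₂ ∨ i ∈ C₃) :
    S.value ≤ (S.restrict C₁).value + (S.restrict C₂).value + (S.restrict C₃).value := by
  simp only [Schedule.value, ← Finset.sum_add_distrib]
  refine Finset.sum_le_sum fun j _ => ?_
  simp only [Schedule.fullness, Schedule.restrict, ← Finset.filter_mem_eq_inter, Finset.sum_filter,
    ← Finset.sum_add_distrib]
  refine Finset.sum_le_sum fun i _ => ?_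
  have := I.s_pos i
  rcases h i with h | h | h <;> rw [if_pos h] <;> split_ifs <;> linarith

/-- Forgets the class to which the schedule belongs and expresses its value by `slotsSum`, the
quantity that `better` compares. -/
theorem IsApproxSolution.exists_valid {I : Instance} {A : Finset (Fin I.n)} {α : ℚ} {L : Slots I}
    (h : IsApproxSolution I A α L) : ∃ B : Schedule I, Represents L B ∧ B.Feasible Finset.univ ∧
      B.value = slotsSum I L ∧ ∀ S : Schedule I, S.Feasible A → α * S.value ≤ slotsSum I L := by
  obtain ⟨B, hR, ⟨A', -, hB⟩, hS⟩ := h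
  have hv : B.value = slotsSum I L := by
    rw [Schedule.value, slotsSum_eq_sum, hR.1, Finset.sum_range]
    refine Finset.sum_congr rfl fun j _ => ?_
    rw [Schedule.fullness, hR.2.2 j, fill, content_succ, sizeSum_eq_sum]
    have hj : (j : ℕ) < L.length := by rw [hR.1]; exact j.2
    rw [List.getD_eq_getElem _ _ hj]
    exact hR.2.1 _ (List.getElem_mem _)
  exact ⟨B, hR, ⟨A', Finset.subset_univ _, hB⟩, hv, hv ▸ hS⟩

theorem splitAds_finRange (I : Instance) :
    ((splitAds I (List.finRange I.n)).val.1.Nodup ∧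
      (splitAds I (List.finRange I.n)).val.2.1.Nodup ∧
      (splitAds I (List.finRange I.n)).val.2.2.Nodup) ∧
    (∀ i, i ∈ (splitAds I (List.finRange I.n)).val.1 ↔ 1 / 2 < I.s i) ∧
    (∀ i, i ∈ (splitAds I (List.finRange I.n)).val.2.1 ↔ 1 / 4 < I.s i ∧ I.s i ≤ 1 / 2) ∧
    ∀ i, i ∈ (splitAds I (List.finRange I.n)).val.2.2 ↔ I.s i ≤ 1 / 4 := by
  rw [splitAds_val]
  refine ⟨⟨(List.nodup_finRange _).filter _, (List.nodup_finRange _).filter _,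
    (List.nodup_finRange _).filter _⟩, fun i => ?_, fun i => ?_, fun i => ?_⟩ <;> simp

theorem isApproxSolution_algGeneral (I : Instance) :
    IsApproxSolution I Finset.univ (1 / 9) (algGeneral I).val := by
  obtain ⟨⟨n₁, n₂, n₃⟩, m₁, m₂, m₃⟩ := splitAds_finRange I
  set R := (splitAds I (List.finRange I.n)).val with hR
  have hs₂ := algMedium_spec n₂ fun i hi => (m₂ i).1 hi
  have hs₃ := algSmall_spec n₃ fun i hi => (m₃ i).1 hi
  obtain ⟨B₁, r₁, f₁, v₁, s₁⟩ :=
    (isApproxSolution_algLarge n₁ fun i hi => (m₁ i).1 hi).exists_valid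
  obtain ⟨B₂, r₂, f₂, v₂, s₂⟩ := (hs₂.1.quarter hs₂.2).exists_valid
  obtain ⟨B₃, r₃, f₃, v₃, s₃⟩ := (hs₃.1.quarter hs₃.2).exists_valid
  have hval : (algGeneral I).val = (better I (better I (algLarge I R.1).val
      (algMedium I R.2.1).val).val (algSmall I R.2.2).val).val := rfl
  rw [hval, better_val, better_val]
  have key : ∀ S : Schedule I, S.Feasible Finset.univ → S.value ≤
      slotsSum I (algLarge I R.1).val + 4 * slotsSum I (algMedium I R.2.1).val +
        4 * slotsSum I (algSmall I R.2.2).val := by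
    intro S hS
    have h := S.value_le_restrict R.1.toFinset R.2.1.toFinset R.2.2.toFinset fun i => by
      simp only [List.mem_toFinset, m₁, m₂, m₃]
      rcases le_or_gt (I.s i) (1 / 4) with h | h
      · exact Or.inr (Or.inr h)
      · rcases le_or_gt (I.s i) (1 / 2) with h' | h'
        · exact Or.inr (Or.inl ⟨h, h'⟩)
        · exact Or.inl h'
    linarith [s₁ _ (hS.restrict _), s₂ _ (hS.restrict _), s₃ _ (hS.restrict _)]
  -- In each case the largest value, taken 1 + 4 + 4 = 9 times, dominates the right-hand side of
  -- `key`.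
  split_ifs with h1 h2 h2
  · exact ⟨B₁, r₁, f₁, fun S hS => by rw [v₁]; linarith [key S hS]⟩
  · exact ⟨B₃, r₃, f₃, fun S hS => by rw [v₃]; linarith [key S hS]⟩
  · exact ⟨B₂, r₂, f₂, fun S hS => by rw [v₂]; linarith [key S hS]⟩
  · exact ⟨B₃, r₃, f₃, fun S hS => by rw [v₃]; linarith [key S hS]⟩


/-! ## Lengths of the numbers that occur -/

/-- A crude bound by the number itself suffices, because counters and indices are bounded in terms
of `K` and the number of ads. -/
theorem natBits_le (a : ℕ) : natBits a ≤ a + 1 :=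
  Nat.add_le_add_right (Nat.size_le.2 Nat.lt_two_pow_self) 1

theorem natBits_pos (a : ℕ) : 1 ≤ natBits a := Nat.le_add_left 1 _

theorem natBits_mono {a b : ℕ} (h : a ≤ b) : natBits a ≤ natBits b :=
  Nat.add_le_add_right (Nat.size_le_size h) 1

theorem size_mul_le (a b : ℕ) : (a * b).size ≤ a.size + b.size := by
  rw [Nat.size_le, pow_add]
  exact Nat.mul_lt_mul'' a.lt_size_self b.lt_size_self

theorem size_prod_le {ι : Type} (s : Finset ι) (f : ι → ℕ) :
    (∏ i ∈ s, f i).size ≤ 1 + ∑ i ∈ s, (f i).size := by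
  classical
  induction s using Finset.induction_on with
  | empty => simp
  | insert a s ha ih =>
    rw [Finset.prod_insert ha, Finset.sum_insert ha]
    have := size_mul_le (f a) (∏ i ∈ s, f i)
    omega

namespace Instance

/-- A bound for the numbers of slots and ads and for the length of the input. -/
def bound (I : Instance) : ℕ := I.size + I.K + 2

/-- A bound for the cost of an operation on natural numbers. -/
def unit (I : Instance) : ℕ := 100 * I.bound

variable (I : Instance)

theorem n_le_size : I.n ≤ I.size := by
  have h : ∑ _i : Fin I.n, 1 ≤
      ∑ i, (ratBits (I.s i) + natBits (I.w i) + natBits (I.r i)) :=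
    Finset.sum_le_sum fun i _ => by have := natBits_pos (I.r i); omega
  rw [Finset.sum_const, Finset.card_univ, Fintype.card_fin, smul_eq_mul, mul_one] at h
  rw [Instance.size]; omega

theorem n_le_bound : I.n ≤ I.bound := by have := I.n_le_size; rw [bound]; omega
theorem K_le_bound : I.K + 2 ≤ I.bound := by rw [bound]; omega
theorem w_le_K (i : Fin I.n) : I.w i ≤ I.K := by
  have := I.compatible i; have := I.r_pos i; omega
theorem r_le_K (i : Fin I.n) : I.r i ≤ I.K := by
  have := I.compatible i; have := I.w_pos i; omega
theorem idx_le_bound (i : Fin I.n) : (i : ℕ) ≤ I.bound := i.2.le.trans I.n_le_bound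

theorem natBits_le_bound {a : ℕ} (ha : a ≤ 4 * I.bound) : natBits a ≤ 5 * I.bound := by
  have := natBits_le a
  have : 2 ≤ I.bound := by rw [bound]; omega
  omega

theorem natOp_le {a b : ℕ} (ha : a ≤ 4 * I.bound) (hb : b ≤ 4 * I.bound) :
    natBits a + natBits b ≤ I.unit := by
  have := I.natBits_le_bound ha
  have := I.natBits_le_bound hb
  rw [unit]; omega

theorem natBits_le_unit {a : ℕ} (ha : a ≤ 4 * I.bound) : natBits a ≤ I.unit := by
  have := I.natOp_le ha ha; omega

/-- As `bound ≥ 2`, `unit` is at least 200: one further power pays for up to 200 operations of the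
previous order, which leaves the cost estimates to linear arithmetic. -/
theorem pow_step (k : ℕ) : 200 * I.unit ^ k ≤ I.unit ^ (k + 1) := by
  rw [pow_succ']
  exact Nat.mul_le_mul_right _ (by rw [unit, bound]; omega)

theorem unit_pows : 200 ≤ I.unit ∧ 200 * I.unit ≤ I.unit ^ 2 ∧ 200 * I.unit ^ 2 ≤ I.unit ^ 3 ∧
    200 * I.unit ^ 3 ≤ I.unit ^ 4 ∧ 200 * I.unit ^ 4 ≤ I.unit ^ 5 ∧
    200 * I.unit ^ 5 ≤ I.unit ^ 6 ∧ 200 * I.unit ^ 6 ≤ I.unit ^ 7 ∧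
    200 * I.unit ^ 7 ≤ I.unit ^ 8 :=
  ⟨by simpa using I.pow_step 0, by simpa using I.pow_step 1, I.pow_step 2, I.pow_step 3,
    I.pow_step 4, I.pow_step 5, I.pow_step 6, I.pow_step 7⟩

/-- A loop of at most `unit` rounds raises the exponent by one; most cost bounds below end with this
step. -/
theorem mul_pow_le {a : ℕ} (ha : a ≤ I.unit) (k : ℕ) : a * I.unit ^ k ≤ I.unit ^ (k + 1) := by
  rw [pow_succ']
  exact Nat.mul_le_mul_right _ ha

theorem n_lt_unit : I.n + 1 ≤ I.unit := by
  have := I.n_le_bound; have := I.K_le_bound; rw [unit]; omega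

theorem K_lt_unit : I.K + 2 ≤ I.unit := by
  have := I.K_le_bound; rw [unit]; omega

theorem le_bound_of_le {a : ℕ} (h : a ≤ I.K + 1) : a ≤ 4 * I.bound := by
  have := I.K_le_bound; omega

/-! ### Rational numbers with a common denominator -/

/-- A common denominator of the rational numbers that occur. -/
def denom : ℕ := 4 * ∏ i, (I.s i).den

/-- Multiples of the unit fraction of the common denominator. -/
def IsMultiple (q : ℚ) : Prop := ∃ m : ℤ, q * I.denom = m

/-- The rational numbers that occur in the algorithms. -/
structure Nice (q : ℚ) : Prop where
  nonneg : 0 ≤ q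
  le : q ≤ (I.bound : ℚ) ^ 2
  mul : I.IsMultiple q

variable {I}

theorem IsMultiple.add {p q : ℚ} (hp : I.IsMultiple p) (hq : I.IsMultiple q) :
    I.IsMultiple (p + q) := by
  obtain ⟨a, ha⟩ := hp
  obtain ⟨b, hb⟩ := hq
  exact ⟨a + b, by rw [add_mul, ha, hb]; push_cast; ring⟩

theorem IsMultiple.sub {p q : ℚ} (hp : I.IsMultiple p) (hq : I.IsMultiple q) :
    I.IsMultiple (p - q) := by
  obtain ⟨a, ha⟩ := hp
  obtain ⟨b, hb⟩ := hq
  exact ⟨a - b, by rw [sub_mul, ha, hb]; push_cast; ring⟩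

theorem IsMultiple.natMul {q : ℚ} (hq : I.IsMultiple q) (a : ℕ) : I.IsMultiple (a * q) := by
  obtain ⟨b, hb⟩ := hq
  exact ⟨a * b, by rw [mul_assoc, hb]; push_cast; ring⟩

/-- The factor 4 in `denom` is there for the thresholds 1/4, 1/2 and 3/4. -/
theorem isMultiple_quarter (I : Instance) : I.IsMultiple (1 / 4) :=
  ⟨∏ i, (I.s i).den, by rw [denom]; push_cast; ring⟩

theorem isMultiple_quarters (I : Instance) (a : ℕ) : I.IsMultiple (a / 4) := by
  have := (isMultiple_quarter I).natMul a
  rwa [mul_one_div] at this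

theorem isMultiple_size (i : Fin I.n) : I.IsMultiple (I.s i) := by
  refine ⟨4 * (I.s i).num * ∏ i' ∈ Finset.univ.erase i, ((I.s i').den : ℤ), ?_⟩
  rw [denom, ← Finset.mul_prod_erase _ _ (Finset.mem_univ i)]
  push_cast
  have := Rat.mul_den_eq_num (I.s i)
  calc _ = 4 * (I.s i * (I.s i).den) * ∏ x ∈ Finset.univ.erase i, ((I.s x).den : ℚ) := by ring
    _ = _ := by rw [this]

theorem bound_cast (I : Instance) : (2 : ℚ) ≤ I.bound := by
  have : 2 ≤ I.bound := by rw [bound]; omega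
  exact_mod_cast this

theorem nice_quarters (I : Instance) {a : ℕ} (ha : a ≤ 4) : I.Nice (a / 4) := by
  refine ⟨by positivity, ?_, isMultiple_quarters I a⟩
  have : (a : ℚ) ≤ 4 := by exact_mod_cast ha
  nlinarith [bound_cast I]

theorem nice_one_quarter (I : Instance) : I.Nice (1 / 4) := by
  simpa using nice_quarters I (a := 1) (by norm_num)
theorem nice_three_quarters (I : Instance) : I.Nice (3 / 4) := by
  simpa using nice_quarters I (a := 3) (by norm_num)
theorem nice_half (I : Instance) : I.Nice (1 / 2) := by
  have := nice_quarters I (a := 2) (by norm_num)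
  norm_num at this ⊢; exact this
theorem nice_one (I : Instance) : I.Nice 1 := by
  simpa using nice_quarters I (a := 4) (by norm_num)
theorem nice_zero (I : Instance) : I.Nice 0 := by
  simpa using nice_quarters I (a := 0) (by norm_num)

theorem nice_size (i : Fin I.n) : I.Nice (I.s i) :=
  ⟨(I.s_pos i).le, (I.s_le_one i).trans (nice_one I).le, isMultiple_size i⟩

theorem nice_one_sub_size (i : Fin I.n) : I.Nice (1 - I.s i) :=
  ⟨by linarith [I.s_le_one i], by linarith [I.s_pos i, (nice_one I).le],
    (nice_one I).mul.sub (isMultiple_size i)⟩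

theorem isMultiple_sizeSum (b : List (Fin I.n)) : I.IsMultiple (sizeSum I b) := by
  induction b with
  | nil => exact (nice_zero I).mul
  | cons i t ih => rw [sizeSum_cons]; exact (isMultiple_size i).add ih

theorem nice_sizeSum {b : List (Fin I.n)} (hb : b.length ≤ I.n) : I.Nice (sizeSum I b) := by
  refine ⟨sizeSum_nonneg I b, ?_, isMultiple_sizeSum b⟩
  have h1 := sizeSum_le_length I b
  have h2 : (b.length : ℚ) ≤ I.bound := by exact_mod_cast hb.trans I.n_le_bound
  nlinarith [bound_cast I]

theorem nice_slotsSum {B : Slots I} (hB : ∀ b ∈ B, b.length ≤ I.n) (hl : B.length ≤ I.K) :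
    I.Nice (slotsSum I B) := by
  have key : 0 ≤ slotsSum I B ∧ slotsSum I B ≤ B.length * I.n ∧ I.IsMultiple (slotsSum I B) := by
    clear hl
    induction B with
    | nil => simpa using (nice_zero I).mul
    | cons b t ih =>
      obtain ⟨h1, h2, h3⟩ := ih fun b hb => hB b (by simp [hb])
      have h4 := sizeSum_le_length I b
      have h5 : (b.length : ℚ) ≤ I.n := by exact_mod_cast hB b (by simp)
      rw [slotsSum_cons]
      refine ⟨add_nonneg (sizeSum_nonneg I b) h1, ?_, (isMultiple_sizeSum b).add h3⟩
      rw [List.length_cons]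
      push_cast
      linarith
  refine ⟨key.1, key.2.1.trans ?_, key.2.2⟩
  have h1 : B.length * I.n ≤ I.bound * I.bound :=
    Nat.mul_le_mul (hl.trans (by have := I.K_le_bound; omega)) I.n_le_bound
  rw [pow_two]; exact_mod_cast h1

/-- Each ad raises an entry by at most `w i * s i ≤ K`, and no new denominators arise. -/
theorem dp_bounds (t : List (Fin I.n)) (j : ℕ) :
    0 ≤ dp I t j ∧ dp I t j ≤ t.length * I.K ∧ I.IsMultiple (dp I t j) := by
  induction t generalizing j with
  | nil => simpa [dp] using (nice_zero I).mul
  | cons i t ih =>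
    obtain ⟨h1, h2, h3⟩ := ih j
    obtain ⟨g1, g2, g3⟩ := ih (j - I.w i)
    have hK : (0 : ℚ) ≤ I.K := Nat.cast_nonneg _
    have hw : (I.w i : ℚ) ≤ I.K := by exact_mod_cast I.w_le_K i
    have hw0 : (0 : ℚ) ≤ I.w i := Nat.cast_nonneg _
    have hp : (I.w i : ℚ) * I.s i ≤ I.K := by nlinarith [I.s_le_one i, I.s_pos i]
    have hp0 : 0 ≤ (I.w i : ℚ) * I.s i := mul_nonneg hw0 (I.s_pos i).le
    rw [dp, List.length_cons]
    push_cast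
    split_ifs
    · rcases max_choice (dp I t j) (dp I t (j - I.w i) + I.w i * I.s i) with h | h <;> rw [h]
      · exact ⟨h1, by linarith, h3⟩
      · exact ⟨by linarith, by linarith, g3.add ((isMultiple_size i).natMul _)⟩
    · exact ⟨h1, by linarith, h3⟩

theorem le_bound_sq {a : ℕ} {q : ℚ} (ha : a ≤ I.n) (hq : q ≤ a * I.K) : q ≤ (I.bound : ℚ) ^ 2 := by
  have h1 : a * I.K ≤ I.bound * I.bound :=
    Nat.mul_le_mul (ha.trans I.n_le_bound) (by have := I.K_le_bound; omega)
  rw [pow_two]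
  exact hq.trans (by exact_mod_cast h1)

theorem nice_dp {t : List (Fin I.n)} (ht : t.length ≤ I.n) (j : ℕ) : I.Nice (dp I t j) :=
  ⟨(dp_bounds t j).1, le_bound_sq ht (dp_bounds t j).2.1, (dp_bounds t j).2.2⟩

/-- The candidate for the maximum counts one ad more than the row from which it is computed, hence
the stronger bound on the length. -/
theorem nice_dp_add {t : List (Fin I.n)} (ht : t.length + 1 ≤ I.n) (j : ℕ) (i : Fin I.n) :
    I.Nice (dp I t j + I.w i * I.s i) := by
  obtain ⟨g1, g2, g3⟩ := dp_bounds (I := I) t j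
  have hw : (I.w i : ℚ) ≤ I.K := by exact_mod_cast I.w_le_K i
  have hw0 : (0 : ℚ) ≤ I.w i := Nat.cast_nonneg _
  have hp : (I.w i : ℚ) * I.s i ≤ I.K := by nlinarith [I.s_le_one i, I.s_pos i]
  have hp0 : 0 ≤ (I.w i : ℚ) * I.s i := mul_nonneg hw0 (I.s_pos i).le
  refine ⟨by linarith, le_bound_sq ht ?_, g3.add ((isMultiple_size i).natMul _)⟩
  push_cast
  linarith

theorem nice_mul (i : Fin I.n) : I.Nice (I.w i * I.s i) := by
  have := nice_dp_add (I := I) (t := []) (by have := i.2; simp; omega) 0 i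
  simpa [dp] using this

theorem denom_pos (I : Instance) : 0 < I.denom :=
  Nat.mul_pos (by norm_num) (Finset.prod_pos fun i _ => (I.s i).den_pos)

theorem size_denom_le (I : Instance) : I.denom.size ≤ I.size + 4 := by
  have h1 := size_mul_le 4 (∏ i, (I.s i).den)
  have h2 := size_prod_le Finset.univ fun i => (I.s i).den
  have h3 : ∑ i, (I.s i).den.size ≤
      ∑ i, (ratBits (I.s i) + natBits (I.w i) + natBits (I.r i)) :=
    Finset.sum_le_sum fun i _ => by rw [ratBits, natBits, natBits]; omega
  have h4 : Nat.size 4 ≤ 3 := Nat.size_le.2 (by norm_num)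
  have h5 := natBits_pos I.K
  rw [denom, Instance.size]
  omega

/-- The reduced denominator divides `denom`, and the numerator is at most `bound ^ 2 * denom`. The
length of a product is at most the sum of the lengths, so `denom` itself is no longer than the input
up to a constant. -/
theorem Nice.ratBits_le {q : ℚ} (h : I.Nice q) : ratBits q ≤ 10 * I.bound := by
  obtain ⟨h0, h1, m, hm⟩ := h
  have hD := I.denom_pos
  have hD' : (0 : ℚ) < I.denom := by exact_mod_cast hD
  have hden : q.den ∣ I.denom := by
    have hq : q = ((m / (I.denom : ℤ) : ℚ)) := by
      rw [eq_div_iff (by exact_mod_cast hD.ne')]; exact_mod_cast hm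
    have := Rat.den_dvd m I.denom
    rw [Rat.divInt_eq_div] at this
    rw [← hq] at this
    exact_mod_cast this
  have hden' : q.den ≤ I.denom := Nat.le_of_dvd hD hden
  have hnum : q.num.natAbs ≤ I.bound ^ 2 * I.denom := by
    have e : ((q.num.natAbs : ℕ) : ℚ) = q * q.den := by
      rw [Rat.mul_den_eq_num, ← Int.cast_natCast, Int.natAbs_of_nonneg (Rat.num_nonneg.2 h0)]
    have hle : q * q.den ≤ (I.bound : ℚ) ^ 2 * I.denom :=
      mul_le_mul h1 (by exact_mod_cast hden') (Nat.cast_nonneg _) (by positivity)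
    rw [← e] at hle
    exact_mod_cast hle
  have s1 := natBits_mono hden'
  have s2 := natBits_mono hnum
  have s3 := size_mul_le (I.bound ^ 2) I.denom
  have s4 := size_mul_le I.bound I.bound
  have s5 := natBits_le I.bound
  have s6 := size_denom_le I
  rw [pow_two] at s2 s3
  have s7 : I.size + 2 ≤ I.bound := by rw [bound]; omega
  rw [ratBits]
  simp only [natBits] at *
  omega

theorem Nice.ratOp_le {p q : ℚ} (hp : I.Nice p) (hq : I.Nice q) :
    (ratBits p + ratBits q) ^ 2 ≤ I.unit ^ 2 := by
  refine Nat.pow_le_pow_left ?_ 2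
  have := hp.ratBits_le
  have := hq.ratBits_le
  rw [unit]; omega

theorem Nice.natRatOp_le {a : ℕ} {q : ℚ} (ha : a ≤ 4 * I.bound) (hq : I.Nice q) :
    (natBits a + ratBits q) ^ 2 ≤ I.unit ^ 2 := by
  refine Nat.pow_le_pow_left ?_ 2
  have := I.natBits_le_bound ha
  have := hq.ratBits_le
  rw [unit]; omega

end Instance

open Instance

/-! ## Costs of the elementary procedures -/

section costs
variable {I : Instance}

theorem addRat_cost_le {p q : ℚ} (hp : I.Nice p) (hq : I.Nice q) :
    (addRat p q).cost ≤ I.unit ^ 2 := hp.ratOp_le hq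
theorem subRat_cost_le {p q : ℚ} (hp : I.Nice p) (hq : I.Nice q) :
    (subRat p q).cost ≤ I.unit ^ 2 := hp.ratOp_le hq
theorem leRat_cost_le {p q : ℚ} (hp : I.Nice p) (hq : I.Nice q) :
    (leRat p q).cost ≤ I.unit ^ 2 := hp.ratOp_le hq
theorem ltRat_cost_le {p q : ℚ} (hp : I.Nice p) (hq : I.Nice q) :
    (ltRat p q).cost ≤ I.unit ^ 2 := hp.ratOp_le hq
theorem mulNatRat_cost_le {a : ℕ} {q : ℚ} (ha : a ≤ 4 * I.bound) (hq : I.Nice q) :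
    (mulNatRat a q).cost ≤ I.unit ^ 2 := hq.natRatOp_le ha

theorem readSize_cost_le (i : Fin I.n) : (readSize I i).cost ≤ I.unit := by
  have h1 := I.natBits_le_bound (a := i) (by have := I.idx_le_bound i; omega)
  have h2 := (nice_size i).ratBits_le
  change natBits i + ratBits (I.s i) ≤ _
  rw [unit]; omega

theorem readFreq_cost_le (i : Fin I.n) : (readFreq I i).cost ≤ I.unit :=
  I.natOp_le (by have := I.idx_le_bound i; omega)
    (I.le_bound_of_le ((I.w_le_K i).trans (Nat.le_succ _)))

theorem readRel_cost_le (i : Fin I.n) : (readRel I i).cost ≤ I.unit :=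
  I.natOp_le (by have := I.idx_le_bound i; omega)
    (I.le_bound_of_le ((I.r_le_K i).trans (Nat.le_succ _)))

theorem readK_cost_le (I : Instance) : (readK I).cost ≤ I.unit :=
  I.natBits_le_unit (I.le_bound_of_le (Nat.le_succ _))

theorem memNat_cost_le {a : ℕ} {l : List ℕ} (ha : a ≤ I.K + 1) (hl : ∀ x ∈ l, x ≤ I.K) :
    (memNat a l).cost ≤ (l.length + 1) * I.unit ^ 2 := by
  obtain ⟨p0, p1, p2, p3, p4, p5, p6, p7⟩ := I.unit_pows
  induction l with
  | nil => simp only [memNat, Timed.cost_bind, tick_cost, Timed.cost_pure, List.length_nil]; linarith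
  | cons x t ih =>
    have := ih fun y hy => hl y (by simp [hy])
    have hop := I.natOp_le (I.le_bound_of_le ha)
      (I.le_bound_of_le ((hl x (by simp)).trans (Nat.le_succ _)))
    simp only [memNat, Timed.cost_bind, tick_cost, eqNat_cost, List.length_cons]
    split_ifs
    -- On early exit the unspent product of the remaining length with a power of `unit` has to be
    -- seen to be nonnegative.
    · simp only [Timed.cost_pure]; nlinarith
    · linarith

/-- The set `X` of slot numbers as it occurs in the algorithms. -/
def SlotList (I : Instance) (X : List ℕ) : Prop := X.length ≤ I.K ∧ ∀ j ∈ X, 1 ≤ j ∧ j ≤ I.K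

theorem SlotList.memNat_cost_le {X : List ℕ} (h : SlotList I X) {a : ℕ} (ha : a ≤ I.K + 1) :
    (memNat a X).cost ≤ I.unit ^ 3 :=
  (MaxSpace.memNat_cost_le ha fun x hx => (h.2 x hx).2).trans
    (I.mul_pow_le (by have := h.1; have := I.K_lt_unit; omega) 2)

theorem memAd_cost_le (i : Fin I.n) {l : List (Fin I.n)} (hl : l.length ≤ I.n) :
    (memAd i l).cost ≤ I.unit ^ 3 := by
  have key : (memAd i l).cost ≤ (l.length + 1) * I.unit ^ 2 := by
    clear hl
    obtain ⟨p0, p1, p2, p3, p4, p5, p6, p7⟩ := I.unit_pows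
    induction l with
    | nil =>
      simp only [memAd, Timed.cost_bind, tick_cost, Timed.cost_pure, List.length_nil]; linarith
    | cons x t ih =>
      have hop := I.natOp_le (a := i) (b := x) (by have := I.idx_le_bound i; omega)
        (by have := I.idx_le_bound x; omega)
      simp only [memAd, Timed.cost_bind, tick_cost, eqNat_cost, List.length_cons]
      split_ifs
      · simp only [Timed.cost_pure]; nlinarith
      · linarith
  exact key.trans (I.mul_pow_le (by have := I.n_lt_unit; omega) 2)

theorem diffAds_cost_le {l c : List (Fin I.n)} (hl : l.length ≤ I.n) (hc : c.length ≤ I.n) :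
    (diffAds l c).cost ≤ I.unit ^ 5 := by
  have key : (diffAds l c).cost ≤ (l.length + 1) * I.unit ^ 4 := by
    clear hl
    obtain ⟨p0, p1, p2, p3, p4, p5, p6, p7⟩ := I.unit_pows
    induction l with
    | nil =>
      simp only [diffAds, Timed.cost_bind, tick_cost, Timed.cost_pure, List.length_nil]; linarith
    | cons x t ih =>
      have hop := memAd_cost_le x hc
      simp only [diffAds, Timed.cost_bind, tick_cost, List.length_cons]
      split_ifs <;> simp only [Timed.cost_pure] <;> linarith
  exact key.trans (I.mul_pow_le (by have := I.n_lt_unit; omega) 4)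

theorem appendAds_cost {n : ℕ} (l c : List (Fin n)) : (appendAds l c).cost = l.length + 1 := by
  induction l with
  | nil => simp [appendAds]
  | cons x t ih => simp [appendAds, ih]; ring

theorem totalSize_cost_le {b : List (Fin I.n)} (hb : b.length ≤ I.n) :
    (totalSize I b).cost ≤ I.unit ^ 4 := by
  have key : (totalSize I b).cost ≤ (b.length + 1) * I.unit ^ 3 := by
    obtain ⟨p0, p1, p2, p3, p4, p5, p6, p7⟩ := I.unit_pows
    induction b with
    | nil =>
      simp only [totalSize, Timed.cost_bind, tick_cost, Timed.cost_pure, List.length_nil]; linarith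
    | cons i t ih =>
      rw [List.length_cons] at hb
      have h1 := readSize_cost_le i
      have h2 := addRat_cost_le (nice_size i) (nice_sizeSum (b := t) (by omega))
      have := ih (by omega)
      simp only [totalSize, Timed.cost_bind, tick_cost, readSize_val, totalSize_val,
        List.length_cons]
      linarith
  exact key.trans (I.mul_pow_le (by have := I.n_lt_unit; omega) 3)

theorem totalValue_cost_le {B : Slots I} (hB : ∀ b ∈ B, b.length ≤ I.n) (hl : B.length ≤ I.K) :
    (totalValue I B).cost ≤ I.unit ^ 6 := by
  have key : (totalValue I B).cost ≤ (B.length + 1) * I.unit ^ 5 := by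
    obtain ⟨p0, p1, p2, p3, p4, p5, p6, p7⟩ := I.unit_pows
    induction B with
    | nil =>
      simp only [totalValue, Timed.cost_bind, tick_cost, Timed.cost_pure, List.length_nil]; linarith
    | cons b t ih =>
      rw [List.length_cons] at hl
      have hB' : ∀ b ∈ t, b.length ≤ I.n := fun b hb => hB b (by simp [hb])
      have h1 := totalSize_cost_le (hB b (by simp))
      have h2 := addRat_cost_le (nice_sizeSum (hB b (by simp))) (nice_slotsSum hB' (by omega))
      have := ih hB' (by omega)
      simp only [totalValue, Timed.cost_bind, tick_cost, totalValue_val, totalSize_val,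
        List.length_cons]
      linarith
  exact key.trans (I.mul_pow_le (by have := I.K_lt_unit; omega) 5)

theorem emptySlots_cost_le {k : ℕ} (hk : k ≤ I.K) : (emptySlots I k).cost ≤ I.unit ^ 2 := by
  have key : (emptySlots I k).cost ≤ (k + 1) * I.unit ^ 1 := by
    obtain ⟨p0, p1, p2, p3, p4, p5, p6, p7⟩ := I.unit_pows
    induction k with
    | zero => simp only [emptySlots, Timed.cost_bind, tick_cost, Timed.cost_pure]; linarith
    | succ k ih =>
      have := ih (by omega)
      have hop := I.natBits_le_unit (a := k + 1) (I.le_bound_of_le (by omega))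
      simp only [emptySlots, Timed.cost_bind, tick_cost, Timed.cost_pure]
      linarith
  exact key.trans (I.mul_pow_le (by have := I.K_lt_unit; omega) 1)

theorem zeros_cost_le {k : ℕ} (hk : k ≤ I.K + 1) : (zeros k).cost ≤ I.unit ^ 2 := by
  have key : (zeros k).cost ≤ (k + 1) * I.unit ^ 1 := by
    obtain ⟨p0, p1, p2, p3, p4, p5, p6, p7⟩ := I.unit_pows
    induction k with
    | zero => simp only [zeros, Timed.cost_bind, tick_cost, Timed.cost_pure]; linarith
    | succ k ih =>
      have := ih (by omega)
      have hop := I.natBits_le_unit (a := k + 1) (I.le_bound_of_le (by omega))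
      simp only [zeros, Timed.cost_bind, tick_cost, Timed.cost_pure]
      linarith
  exact key.trans (I.mul_pow_le (by have := I.K_lt_unit; omega) 1)

/-- The walk ends after at most `j + 1` steps, so the length of the row plays no role. -/
theorem entry_cost_le (l : List ℚ) {j : ℕ} (hj : j ≤ I.K) : (entry l j).cost ≤ I.unit ^ 2 := by
  have key : (entry l j).cost ≤ (j + 1) * I.unit ^ 1 := by
    obtain ⟨p0, p1, p2, p3, p4, p5, p6, p7⟩ := I.unit_pows
    induction l generalizing j with
    | nil => simp only [entry, Timed.cost_bind, tick_cost, Timed.cost_pure]; nlinarith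
    | cons x t ih =>
      cases j with
      | zero => simp only [entry, Timed.cost_bind, tick_cost, Timed.cost_pure]; linarith
      | succ j =>
        have := ih (j := j) (by omega)
        have hop := I.natBits_le_unit (a := j + 1) (I.le_bound_of_le (by omega))
        simp only [entry, Timed.cost_bind, tick_cost]
        linarith
  exact key.trans (I.mul_pow_le (by have := I.K_lt_unit; omega) 1)

theorem interval_cost_le {a k : ℕ} (h : a + k ≤ I.K) : (interval a k).cost ≤ I.unit ^ 3 := by
  have key : (interval a k).cost ≤ (k + 1) * I.unit ^ 2 := by
    obtain ⟨p0, p1, p2, p3, p4, p5, p6, p7⟩ := I.unit_pows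
    induction k generalizing a with
    | zero => simp only [interval, Timed.cost_bind, tick_cost, Timed.cost_pure]; linarith
    | succ k ih =>
      have := ih (a := a + 1) (by omega)
      have hop := I.natBits_le_unit (a := k + 1) (I.le_bound_of_le (by omega))
      have hop' := I.natOp_le (a := a) (b := 1) (I.le_bound_of_le (by omega))
        (I.le_bound_of_le (by omega))
      simp only [interval, Timed.cost_bind, tick_cost, Timed.cost_pure, addNat_val, addNat_cost]
      linarith
  exact key.trans (I.mul_pow_le (by have := I.K_lt_unit; omega) 2)

theorem getSlot_cost_le {j j₀ : ℕ} {B : Slots I} (hj : j ≤ I.K) (h : j₀ + B.length ≤ I.K + 1) :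
    (getSlot I j j₀ B).cost ≤ I.unit ^ 3 := by
  have key : (getSlot I j j₀ B).cost ≤ (B.length + 1) * I.unit ^ 2 := by
    obtain ⟨p0, p1, p2, p3, p4, p5, p6, p7⟩ := I.unit_pows
    induction B generalizing j₀ with
    | nil =>
      simp only [getSlot, Timed.cost_bind, tick_cost, Timed.cost_pure, List.length_nil]; linarith
    | cons b t ih =>
      rw [List.length_cons] at h
      have := ih (j₀ := j₀ + 1) (by omega)
      have hop := I.natOp_le (a := j) (b := j₀) (I.le_bound_of_le (by omega))
        (I.le_bound_of_le (by omega))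
      have hop' := I.natOp_le (a := j₀) (b := 1) (I.le_bound_of_le (by omega))
        (I.le_bound_of_le (by omega))
      simp only [getSlot, Timed.cost_bind, tick_cost, addNat_val, addNat_cost, eqNat_cost,
        List.length_cons]
      split_ifs
      · simp only [Timed.cost_pure]; nlinarith
      · linarith
  exact key.trans (I.mul_pow_le (by have := I.K_lt_unit; omega) 2)

theorem setSlot_cost_le {j j₀ : ℕ} {c : List (Fin I.n)} {B : Slots I} (hj : j ≤ I.K)
    (h : j₀ + B.length ≤ I.K + 1) : (setSlot I j c j₀ B).cost ≤ I.unit ^ 3 := by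
  have key : (setSlot I j c j₀ B).cost ≤ (B.length + 1) * I.unit ^ 2 := by
    obtain ⟨p0, p1, p2, p3, p4, p5, p6, p7⟩ := I.unit_pows
    induction B generalizing j₀ with
    | nil =>
      simp only [setSlot, Timed.cost_bind, tick_cost, Timed.cost_pure, List.length_nil]; linarith
    | cons b t ih =>
      rw [List.length_cons] at h
      have := ih (j₀ := j₀ + 1) (by omega)
      have hop := I.natOp_le (a := j) (b := j₀) (I.le_bound_of_le (by omega))
        (I.le_bound_of_le (by omega))
      have hop' := I.natOp_le (a := j₀) (b := 1) (I.le_bound_of_le (by omega))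
        (I.le_bound_of_le (by omega))
      simp only [setSlot, Timed.cost_bind, tick_cost, addNat_val, addNat_cost, eqNat_cost,
        List.length_cons]
      split_ifs <;> simp only [Timed.cost_pure] <;> linarith
  exact key.trans (I.mul_pow_le (by have := I.K_lt_unit; omega) 2)

theorem addCopies_cost_le (i : Fin I.n) {X : List ℕ} (hX : SlotList I X) {j₀ : ℕ} {B : Slots I}
    (h : j₀ + B.length ≤ I.K + 1) : (addCopies I i X j₀ B).cost ≤ I.unit ^ 5 := by
  have key : (addCopies I i X j₀ B).cost ≤ (B.length + 1) * I.unit ^ 4 := by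
    obtain ⟨p0, p1, p2, p3, p4, p5, p6, p7⟩ := I.unit_pows
    induction B generalizing j₀ with
    | nil =>
      simp only [addCopies, Timed.cost_bind, tick_cost, Timed.cost_pure, List.length_nil]; linarith
    | cons b t ih =>
      rw [List.length_cons] at h
      have := ih (j₀ := j₀ + 1) (by omega)
      have hop := hX.memNat_cost_le (a := j₀) (by omega)
      have hop' := I.natOp_le (a := j₀) (b := 1) (I.le_bound_of_le (by omega))
        (I.le_bound_of_le (by omega))
      simp only [addCopies, Timed.cost_bind, tick_cost, addNat_val, addNat_cost, List.length_cons]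
      split_ifs <;> simp only [Timed.cost_pure] <;> linarith
  exact key.trans (I.mul_pow_le (by have := I.K_lt_unit; omega) 4)

theorem findSlot_cost_le {p : ℕ → List (Fin I.n) → Timed Bool} {B : Slots I}
    (hp : ∀ j ≤ I.K, ∀ b ∈ B, (p j b).cost ≤ I.unit ^ 5) {j₀ : ℕ}
    (h : j₀ + B.length ≤ I.K + 1) : (findSlot I p j₀ B).cost ≤ I.unit ^ 7 := by
  have key : (findSlot I p j₀ B).cost ≤ (B.length + 1) * I.unit ^ 6 := by
    obtain ⟨p0, p1, p2, p3, p4, p5, p6, p7⟩ := I.unit_pows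
    induction B generalizing j₀ with
    | nil =>
      simp only [findSlot, Timed.cost_bind, tick_cost, Timed.cost_pure, List.length_nil]; linarith
    | cons b t ih =>
      rw [List.length_cons] at h
      have := ih (fun j hj b hb => hp j hj b (by simp [hb])) (j₀ := j₀ + 1) (by omega)
      have hop := hp j₀ (by omega) b (by simp)
      have hop' := I.natOp_le (a := j₀) (b := 1) (I.le_bound_of_le (by omega))
        (I.le_bound_of_le (by omega))
      simp only [findSlot, Timed.cost_bind, tick_cost, addNat_val, addNat_cost, List.length_cons]
      split_ifs
      · simp only [Timed.cost_pure]; nlinarith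
      · linarith
  exact key.trans (I.mul_pow_le (by have := I.K_lt_unit; omega) 6)

theorem insertAd_cost_le (i : Fin I.n) {l : List (Fin I.n)} (hl : l.length ≤ I.n) :
    (insertAd I i l).cost ≤ I.unit ^ 3 := by
  have key : (insertAd I i l).cost ≤ (l.length + 1) * I.unit ^ 2 := by
    clear hl
    obtain ⟨p0, p1, p2, p3, p4, p5, p6, p7⟩ := I.unit_pows
    induction l with
    | nil =>
      simp only [insertAd, Timed.cost_bind, tick_cost, Timed.cost_pure, List.length_nil]; linarith
    | cons x t ih =>
      have h1 := readRel_cost_le i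
      have h2 := readRel_cost_le x
      have hop := I.natOp_le (I.le_bound_of_le ((I.r_le_K i).trans (Nat.le_succ _)))
        (I.le_bound_of_le ((I.r_le_K x).trans (Nat.le_succ _)))
      simp only [insertAd, Timed.cost_bind, tick_cost, readRel_val, leNat_cost, List.length_cons]
      split_ifs
      · simp only [Timed.cost_pure]; nlinarith
      · simp only [Timed.cost_pure, Timed.cost_bind]; linarith
  exact key.trans (I.mul_pow_le (by have := I.n_lt_unit; omega) 2)

theorem sortAds_cost_le {l : List (Fin I.n)} (hl : l.length ≤ I.n) :
    (sortAds I l).cost ≤ I.unit ^ 5 := by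
  have key : (sortAds I l).cost ≤ (l.length + 1) * I.unit ^ 4 := by
    obtain ⟨p0, p1, p2, p3, p4, p5, p6, p7⟩ := I.unit_pows
    induction l with
    | nil =>
      simp only [sortAds, Timed.cost_bind, tick_cost, Timed.cost_pure, List.length_nil]; linarith
    | cons x t ih =>
      rw [List.length_cons] at hl
      have := ih (by omega)
      have hop := insertAd_cost_le x (l := (sortAds I t).val)
        (by rw [(sortAds_perm I t).length_eq]; omega)
      simp only [sortAds, Timed.cost_bind, tick_cost, List.length_cons]
      linarith
  exact key.trans (I.mul_pow_le (by have := I.n_lt_unit; omega) 4)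

theorem splitAds_cost_le {l : List (Fin I.n)} (hl : l.length ≤ I.n) :
    (splitAds I l).cost ≤ I.unit ^ 4 := by
  have key : (splitAds I l).cost ≤ (l.length + 1) * I.unit ^ 3 := by
    clear hl
    obtain ⟨p0, p1, p2, p3, p4, p5, p6, p7⟩ := I.unit_pows
    induction l with
    | nil =>
      simp only [splitAds, Timed.cost_bind, tick_cost, Timed.cost_pure, List.length_nil]; linarith
    | cons x t ih =>
      have h1 := readSize_cost_le x
      have h2 := ltRat_cost_le (nice_half I) (nice_size x)
      have h3 := ltRat_cost_le (nice_one_quarter I) (nice_size x)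
      simp only [splitAds, Timed.cost_bind, tick_cost, readSize_val, List.length_cons]
      split_ifs <;> simp only [Timed.cost_pure] <;> linarith
  exact key.trans (I.mul_pow_le (by have := I.n_lt_unit; omega) 3)

/-- A slot without repetitions holds at most `n` ads. -/
theorem Valid.length_le {A : Finset (Fin I.n)} {B : Slots I} (h : Valid I A B) :
    ∀ b ∈ B, b.length ≤ I.n := fun b hb => by
  obtain ⟨j, -, -, rfl⟩ := exists_content_of_mem hb
  simpa using (h.nodup j).length_le_card

theorem Valid.length_content_le {A : Finset (Fin I.n)} {B : Slots I} (h : Valid I A B) (j : ℕ) :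
    (content B j).length ≤ I.n := by
  simpa using (h.nodup j).length_le_card

theorem SlotList.cons {X : List ℕ} {k j : ℕ} (hX : ∀ j ∈ X, 1 ≤ j ∧ j ≤ I.K) (h1 : 1 ≤ j)
    (hj : j ≤ I.K) (hk : X.length + (k + 1) ≤ I.K) :
    (∀ a ∈ j :: X, 1 ≤ a ∧ a ≤ I.K) ∧ (j :: X).length + k ≤ I.K := by
  refine ⟨fun a ha => ?_, by simp; omega⟩
  rcases List.mem_cons.1 ha with rfl | ha
  · exact ⟨h1, hj⟩
  · exact hX a ha

/-- The part of the cost that all tests on slots have in common. -/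
theorem test_cost_le (i : Fin I.n) {X : List ℕ} (hX : SlotList I X) {j : ℕ} (hj : j ≤ I.K)
    {b : List (Fin I.n)} (hb : b.length ≤ I.n) :
    (memNat j X).cost + (readRel I i).cost + (natBits (I.r i) + natBits j) +
      (totalSize I b).cost + 10 * I.unit ^ 2 + 1 ≤ I.unit ^ 5 := by
  obtain ⟨p0, p1, p2, p3, p4, p5, p6, p7⟩ := I.unit_pows
  have h1 := hX.memNat_cost_le (a := j) (by omega)
  have h2 := readRel_cost_le i
  have h3 := I.natOp_le (I.le_bound_of_le ((I.r_le_K i).trans (Nat.le_succ _)))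
    (I.le_bound_of_le (hj.trans (Nat.le_succ _)))
  have h4 := totalSize_cost_le hb
  linarith

theorem isLowFree_cost_le (i : Fin I.n) {X : List ℕ} (hX : SlotList I X) {j : ℕ} (hj : j ≤ I.K)
    {b : List (Fin I.n)} (hb : b.length ≤ I.n) : (isLowFree I i X j b).cost ≤ I.unit ^ 5 := by
  have h := test_cost_le i hX hj hb
  have h' := ltRat_cost_le (nice_sizeSum hb) (nice_one_quarter I)
  simp only [isLowFree, Timed.cost_bind, tick_cost, readRel_val, leNat_cost, totalSize_val,
    Timed.cost_pure]
  linarith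

theorem isLowUsed_cost_le (i : Fin I.n) {X : List ℕ} (hX : SlotList I X) {j : ℕ} (hj : j ≤ I.K)
    {b : List (Fin I.n)} (hb : b.length ≤ I.n) : (isLowUsed I i X j b).cost ≤ I.unit ^ 5 := by
  have h := test_cost_le i hX hj hb
  have h' := ltRat_cost_le (nice_sizeSum hb) (nice_one_quarter I)
  simp only [isLowUsed, Timed.cost_bind, tick_cost, readRel_val, leNat_cost, totalSize_val,
    Timed.cost_pure]
  linarith

theorem isHighFree_cost_le (i : Fin I.n) {X : List ℕ} (hX : SlotList I X) {j : ℕ} (hj : j ≤ I.K)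
    {b : List (Fin I.n)} (hb : b.length ≤ I.n) : (isHighFree I i X j b).cost ≤ I.unit ^ 5 := by
  have h := test_cost_le i hX hj hb
  have h' := leRat_cost_le (nice_three_quarters I) (nice_sizeSum hb)
  simp only [isHighFree, Timed.cost_bind, tick_cost, readRel_val, leNat_cost, totalSize_val,
    Timed.cost_pure]
  linarith

theorem isRoomFree_cost_le (i : Fin I.n) {X : List ℕ} (hX : SlotList I X) {j : ℕ} (hj : j ≤ I.K)
    {b : List (Fin I.n)} (hb : b.length ≤ I.n) : (isRoomFree I i X j b).cost ≤ I.unit ^ 5 := by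
  have p0 := I.unit_pows.1
  have p1 := I.unit_pows.2.1
  have h := test_cost_le i hX hj hb
  have h1 := subRat_cost_le (nice_one I) (nice_size i)
  have h2 := readSize_cost_le i
  have h3 := leRat_cost_le (nice_sizeSum hb) (nice_one_sub_size i)
  simp only [isRoomFree, Timed.cost_bind, tick_cost, readRel_val, leNat_cost, totalSize_val,
    Timed.cost_pure, readSize_val, subRat_val]
  linarith

theorem leastFull_cost_le (i : Fin I.n) {X : List ℕ} (hX : SlotList I X) {j₀ : ℕ} {B : Slots I}
    (hB : ∀ b ∈ B, b.length ≤ I.n) (h : j₀ + B.length ≤ I.K + 1) :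
    (leastFull I i X j₀ B).cost ≤ I.unit ^ 7 := by
  have key : (leastFull I i X j₀ B).cost ≤ (B.length + 1) * I.unit ^ 6 := by
    obtain ⟨p0, p1, p2, p3, p4, p5, p6, p7⟩ := I.unit_pows
    induction B generalizing j₀ with
    | nil =>
      simp only [leastFull, Timed.cost_bind, tick_cost, Timed.cost_pure, List.length_nil]; linarith
    | cons b t ih =>
      rw [List.length_cons] at h
      have hB' : ∀ b ∈ t, b.length ≤ I.n := fun b hb => hB b (by simp [hb])
      have := ih hB' (j₀ := j₀ + 1) (by omega)
      have hop := test_cost_le i hX (j := j₀) (by omega) (hB b (by simp))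
      have hop' := I.natOp_le (a := j₀) (b := 1) (I.le_bound_of_le (by omega))
        (I.le_bound_of_le (by omega))
      simp only [leastFull, Timed.cost_bind, tick_cost, addNat_val, addNat_cost, readRel_val,
        leNat_cost, totalSize_val, List.length_cons]
      split_ifs
      · rcases hr : (leastFull I i X (j₀ + 1) t).val with _ | ⟨j, g⟩
        · simp only [Timed.cost_pure]; linarith
        · obtain ⟨a1, a2, -, -, a5, -⟩ := leastFull_some_aux hr
          -- The stored minimum is the fullness of an actual slot of the list.
          have hg : I.Nice g := by
            rw [a5, List.getD_eq_getElem _ _ (by omega)]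
            exact nice_sizeSum (hB' _ (List.getElem_mem _))
          have hle := leRat_cost_le (nice_sizeSum (hB b (by simp))) hg
          simp only [Timed.cost_bind]
          split_ifs <;> simp only [Timed.cost_pure] <;> linarith
      · simp only [Timed.cost_pure]; linarith
  exact key.trans (I.mul_pow_le (by have := I.K_lt_unit; omega) 6)

/-- The accumulator is written as the size of a list `b` of ads taken before, so that its length as
a rational stays controlled during the induction. -/
theorem takeQuarter_cost_le {l : List (Fin I.n)} {b : List (Fin I.n)}
    (hl : l.length + b.length ≤ I.n) :
    (takeQuarter I l (sizeSum I b)).cost ≤ I.unit ^ 4 := by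
  have key : (takeQuarter I l (sizeSum I b)).cost ≤ (l.length + 1) * I.unit ^ 3 := by
    obtain ⟨p0, p1, p2, p3, p4, p5, p6, p7⟩ := I.unit_pows
    induction l generalizing b with
    | nil =>
      simp only [takeQuarter, Timed.cost_bind, tick_cost, Timed.cost_pure, List.length_nil]
      linarith
    | cons i t ih =>
      rw [List.length_cons] at hl
      have h0 := nice_sizeSum (I := I) (b := b) (by omega)
      have h1 := leRat_cost_le (nice_one_quarter I) h0
      have h2 := readSize_cost_le i
      have h3 := addRat_cost_le h0 (nice_size i)
      have := ih (b := i :: b) (by simp; omega)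
      rw [sizeSum_cons, add_comm] at this
      simp only [takeQuarter, Timed.cost_bind, tick_cost, List.length_cons]
      split_ifs
      · simp only [Timed.cost_pure]; nlinarith
      · simp only [Timed.cost_pure, Timed.cost_bind, readSize_val, addRat_val]; linarith
  exact key.trans (I.mul_pow_le (by have := I.n_lt_unit; omega) 3)

theorem moveAds_cost_le {A : Finset (Fin I.n)} {B : Slots I} (h : Valid I A B) {j₁ j₂ : ℕ}
    (h₁ : 1 ≤ j₁) (h₁' : j₁ ≤ I.K) (h₂ : 1 ≤ j₂) (h₂' : j₂ ≤ I.K) :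
    (moveAds I j₁ j₂ B).cost ≤ I.unit ^ 6 := by
  obtain ⟨p0, p1, p2, p3, p4, p5, p6, p7⟩ := I.unit_pows
  have hl := h.length
  have hD : ((content B j₂).filter (· ∉ content B j₁)).length ≤ I.n :=
    (List.length_filter_le _ _).trans (h.length_content_le _)
  have hT : (takeQuarter I ((content B j₂).filter (· ∉ content B j₁)) 0).val.length ≤ I.n :=
    (takeQuarter_sublist I _ 0).length_le.trans hD
  have c1 := getSlot_cost_le (j := j₁) (j₀ := 1) (B := B) h₁' (by omega)
  have c2 := getSlot_cost_le (j := j₂) (j₀ := 1) (B := B) h₂' (by omega)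
  have c3 := diffAds_cost_le (h.length_content_le j₂) (h.length_content_le j₁)
  have c4 := takeQuarter_cost_le (I := I) (l := (content B j₂).filter (· ∉ content B j₁)) (b := [])
    (by rw [List.length_nil]; exact hD)
  rw [sizeSum_nil] at c4
  have c5 := diffAds_cost_le (h.length_content_le j₂) hT
  have hn := I.n_lt_unit
  simp only [moveAds, Timed.cost_bind, tick_cost, getSlot_val I _ h₁, getSlot_val I _ h₂,
    diffAds_val, appendAds_cost, appendAds_val]
  -- Only the number of slots of the intermediate list matters for the second update.
  generalize hB' : (setSlot I j₁ _ 1 B).val = B'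
  have hB'l : B'.length = I.K := by rw [← hB', setSlot_length _ _ _ h₁, hl]
  have c6 := fun c => setSlot_cost_le (j := j₁) (j₀ := 1) (c := c) (B := B) h₁' (by omega)
  have c7 := fun c => setSlot_cost_le (j := j₂) (j₀ := 1) (c := c) (B := B') h₂' (by omega)
  have c6' := c6 ((takeQuarter I ((content B j₂).filter (· ∉ content B j₁)) 0).val ++ content B j₁)
  have c7' := c7 ((content B j₂).filter
    (· ∉ (takeQuarter I ((content B j₂).filter (· ∉ content B j₁)) 0).val))
  linarith

/-! ## Cost of the subroutine for large ads -/

theorem dpEntry_cost_le (i : Fin I.n) {t : List (Fin I.n)} (ht : t.length + 1 ≤ I.n) {j : ℕ}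
    (hj : j ≤ I.K) : (dpEntry I i (dpList I t) j).cost ≤ I.unit ^ 3 := by
  obtain ⟨p0, p1, p2, p3, p4, p5, p6, p7⟩ := I.unit_pows
  have c1 := readSize_cost_le i
  have c2 := readFreq_cost_le i
  have c3 := readRel_cost_le i
  have hr := I.r_le_K i
  have hw := I.w_le_K i
  have hc := I.compatible i
  have c4 := I.natOp_le (I.le_bound_of_le (hr.trans (Nat.le_succ _)))
    (I.le_bound_of_le (hw.trans (Nat.le_succ _)))
  have c5 := I.natOp_le (a := I.r i + I.w i) (b := 1) (I.le_bound_of_le (by omega))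
    (I.le_bound_of_le (by omega))
  have c6 := entry_cost_le (dpList I t) hj
  have c7 := I.natOp_le (a := I.r i + I.w i - 1) (b := j) (I.le_bound_of_le (by omega))
    (I.le_bound_of_le (by omega))
  have c8 := I.natOp_le (a := j) (b := I.w i) (I.le_bound_of_le (by omega))
    (I.le_bound_of_le (by omega))
  have c9 := entry_cost_le (I := I) (dpList I t) (j := j - I.w i) (by omega)
  have c10 := mulNatRat_cost_le (a := I.w i) (I.le_bound_of_le (hw.trans (Nat.le_succ _)))
    (nice_size i)
  have c11 := addRat_cost_le (nice_dp (t := t) (by omega) (j - I.w i)) (nice_mul i)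
  have c12 := leRat_cost_le (nice_dp (t := t) (by omega) j) (nice_dp_add ht (j - I.w i) i)
  simp only [dpEntry, Timed.cost_bind, tick_cost, readSize_val, readFreq_val, readRel_val,
    addNat_val, addNat_cost, subNat_val, subNat_cost, entry_val, leNat_cost, dpList_getD I t hj]
  split_ifs
  · simp only [Timed.cost_bind, subNat_val, subNat_cost, entry_val, mulNatRat_val, addRat_val,
      dpList_getD I t (show j - I.w i ≤ I.K by omega)]
    split_ifs <;> simp only [Timed.cost_pure] <;> linarith
  · simp only [Timed.cost_pure]; linarith

theorem dpRow_cost_le (i : Fin I.n) {t : List (Fin I.n)} (ht : t.length + 1 ≤ I.n) {j k : ℕ}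
    (hk : j + k ≤ I.K + 1) : (dpRow I i (dpList I t) j k).cost ≤ I.unit ^ 5 := by
  have key : (dpRow I i (dpList I t) j k).cost ≤ (k + 1) * I.unit ^ 4 := by
    obtain ⟨p0, p1, p2, p3, p4, p5, p6, p7⟩ := I.unit_pows
    induction k generalizing j with
    | zero => simp only [dpRow, Timed.cost_bind, tick_cost, Timed.cost_pure]; linarith
    | succ k ih =>
      have := ih (j := j + 1) (by omega)
      have h1 := dpEntry_cost_le i ht (j := j) (by omega)
      have h2 := I.natBits_le_unit (a := k + 1) (I.le_bound_of_le (by omega))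
      have h3 := I.natOp_le (a := j) (b := 1) (I.le_bound_of_le (by omega))
        (I.le_bound_of_le (by omega))
      simp only [dpRow, Timed.cost_bind, tick_cost, Timed.cost_pure, addNat_val, addNat_cost]
      linarith
  exact key.trans (I.mul_pow_le (by have := I.K_lt_unit; omega) 4)

theorem dpTable_cost_le {L t : List (Fin I.n)} (h : L.length + t.length ≤ I.n) :
    (dpTable I L (dpList I t) (dpStack I t)).cost ≤ I.unit ^ 7 := by
  have key : (dpTable I L (dpList I t) (dpStack I t)).cost ≤ (L.length + 1) * I.unit ^ 6 := by
    obtain ⟨p0, p1, p2, p3, p4, p5, p6, p7⟩ := I.unit_pows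
    induction L generalizing t with
    | nil =>
      simp only [dpTable, Timed.cost_bind, tick_cost, Timed.cost_pure, List.length_nil]; linarith
    | cons i L ih =>
      rw [List.length_cons] at h
      have := ih (t := i :: t) (by simp; omega)
      rw [dpStack] at this
      have h1 := dpRow_cost_le i (t := t) (by omega) (j := 0) (k := I.K + 1) (by omega)
      have h2 := readK_cost_le I
      have h3 := I.natOp_le (a := I.K) (b := 1) (I.le_bound_of_le (by omega))
        (I.le_bound_of_le (by omega))
      simp only [dpTable, Timed.cost_bind, tick_cost, readK_val, addNat_val, addNat_cost,
        dpRow_eq_dpList, List.length_cons]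
      linarith
  exact key.trans (I.mul_pow_le (by have := I.n_lt_unit; omega) 6)

theorem dpBacktrack_cost_le {t : List (Fin I.n)} (ht : t.length ≤ I.n) {j : ℕ} (hj : j ≤ I.K)
    {B : Slots I} (hB : B.length = I.K) :
    (dpBacktrack I (dpStack I t) (dpList I t) j B).cost ≤ I.unit ^ 7 := by
  have key : (dpBacktrack I (dpStack I t) (dpList I t) j B).cost ≤
      (t.length + 1) * I.unit ^ 6 := by
    obtain ⟨p0, p1, p2, p3, p4, p5, p6, p7⟩ := I.unit_pows
    induction t generalizing j B with
    | nil =>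
      simp only [dpStack, dpBacktrack, Timed.cost_bind, tick_cost, Timed.cost_pure,
        List.length_nil]
      linarith
    | cons i t ih =>
      rw [List.length_cons] at ht
      have c1 := entry_cost_le (dpList I t) hj
      have c2 := entry_cost_le (dpList I (i :: t)) hj
      have c3 := ltRat_cost_le (nice_dp (t := t) (by omega) j) (nice_dp (t := i :: t) ht j)
      simp only [dpStack, dpBacktrack, Timed.cost_bind, tick_cost, entry_val, dpList_getD I _ hj,
        List.length_cons]
      split_ifs with hlt
      · rw [ltRat_val, decide_eq_true_iff] at hlt
        -- A strict increase forces the guard, so the subtraction `j - w i` is not truncated and the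
        -- block stays within the slots.
        have hwj : I.w i ≤ j := by
          by_contra hwj
          rw [dp, if_neg (by have := I.r_pos i; omega)] at hlt
          exact lt_irrefl _ hlt
        have c4 := readFreq_cost_le i
        have c5 := I.natOp_le (a := j) (b := I.w i) (I.le_bound_of_le (by omega))
          (I.le_bound_of_le (by omega))
        have c6 := interval_cost_le (I := I) (a := j - I.w i) (k := I.w i) (by omega)
        have hX : SlotList I (interval (j - I.w i) (I.w i)).val := by
          refine ⟨by rw [interval_length]; omega, fun a ha => ?_⟩
          rw [mem_interval] at ha; omega
        have c7 := addCopies_cost_le i hX (j₀ := 1) (B := B) (by omega)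
        have := ih (by omega) (j := j - I.w i) (by omega)
          (B := (addCopies I i (interval (j - I.w i) (I.w i)).val 1 B).val)
          (by rw [addCopies_length, hB])
        simp only [Timed.cost_bind, readFreq_val, subNat_val, subNat_cost]
        linarith
      · have := ih (by omega) hj hB
        linarith
  exact key.trans (I.mul_pow_le (by have := I.n_lt_unit; omega) 6)

theorem algLarge_cost_le {G : List (Fin I.n)} (hG : G.length ≤ I.n) :
    (algLarge I G).cost ≤ I.unit ^ 8 := by
  obtain ⟨p0, p1, p2, p3, p4, p5, p6, p7⟩ := I.unit_pows
  have hl : (sortAds I G).val.length ≤ I.n := by rwa [(sortAds_perm I G).length_eq]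
  have c1 := readK_cost_le I
  have c2 := I.natOp_le (a := I.K) (b := 1) (I.le_bound_of_le (by omega))
    (I.le_bound_of_le (by omega))
  have c3 := zeros_cost_le (I := I) (k := I.K + 1) le_rfl
  have c4 := sortAds_cost_le hG
  have c5 := dpTable_cost_le (I := I) (L := (sortAds I G).val) (t := []) (by simpa using hl)
  have c6 := emptySlots_cost_le (I := I) le_rfl
  have c7 := dpBacktrack_cost_le (I := I) (t := (sortAds I G).val.reverse) (by simpa using hl)
    le_rfl (B := List.replicate I.K []) (by simp)
  have h := dpTable_val I (sortAds I G).val []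
  rw [List.append_nil, dpList_nil] at h
  rw [dpList_nil] at c5
  have h' : dpStack I [] = [] := rfl
  rw [h'] at h c5
  simp only [algLarge, Timed.cost_bind, tick_cost, readK_val, addNat_val, addNat_cost, zeros_val,
    emptySlots_val, h]
  linarith

/-! ## Cost of the subroutines for medium and small ads -/

/-- Cost estimates need only the range and number of the chosen slots, so no assumption on sizes is
made here. -/
theorem mediumLoop_bounds {i : Fin I.n} {B : Slots I} (hB : B.length = I.K) {k : ℕ} {X : List ℕ}
    (hX : ∀ j ∈ X, 1 ≤ j ∧ j ≤ I.K) (hk : X.length + k ≤ I.K) {Y : List ℕ}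
    (hY : (mediumLoop I i B k X).val = some Y) : SlotList I Y := by
  induction k generalizing X with
  | zero =>
    have : X = Y := by simpa [mediumLoop] using hY
    exact this ▸ ⟨hk, hX⟩
  | succ k ih =>
    simp only [mediumLoop, Timed.val_bind] at hY
    rcases ha : (findSlot I (isLowFree I i X) 1 B).val with _ | j
    · rcases hc : (findSlot I (isRoomFree I i X) 1 B).val with _ | j₁
      · simp [ha, hc] at hY
      · rcases hd : (leastFull I i X 1 B).val with _ | ⟨j, g⟩
        · simp [ha, hc, hd] at hY
        · simp only [ha, hc, hd, Timed.val_bind] at hY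
          obtain ⟨h1, h2, h3, -⟩ := leastFull_some hd
          have := SlotList.cons hX ((I.r_pos i).trans h2) (hB ▸ h3) hk
          exact ih this.1 this.2 hY
    · simp only [ha] at hY
      obtain ⟨h1, h2, h3, -⟩ := findSlot_lowFree_some ha
      have := SlotList.cons hX ((I.r_pos i).trans h2) (hB ▸ h3) hk
      exact ih this.1 this.2 hY

theorem mediumLoop_cost_le (i : Fin I.n) {A : Finset (Fin I.n)} {B : Slots I} (h : Valid I A B)
    {k : ℕ} {X : List ℕ} (hX : ∀ j ∈ X, 1 ≤ j ∧ j ≤ I.K) (hk : X.length + k ≤ I.K) :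
    (mediumLoop I i B k X).cost ≤ I.unit ^ 9 := by
  have hB := h.length
  have key : (mediumLoop I i B k X).cost ≤ (k + 1) * I.unit ^ 8 := by
    obtain ⟨p0, p1, p2, p3, p4, p5, p6, p7⟩ := I.unit_pows
    induction k generalizing X with
    | zero => simp only [mediumLoop, Timed.cost_bind, tick_cost, Timed.cost_pure]; linarith
    | succ k ih =>
      have hsl : SlotList I X := ⟨by omega, hX⟩
      have c0 := I.natBits_le_unit (a := k + 1) (I.le_bound_of_le (by omega))
      have c1 := findSlot_cost_le (fun j hj b hb => isLowFree_cost_le i hsl hj (h.length_le b hb))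
        (B := B) (j₀ := 1) (by omega)
      have c2 := findSlot_cost_le (fun j hj b hb => isRoomFree_cost_le i hsl hj (h.length_le b hb))
        (B := B) (j₀ := 1) (by omega)
      have c3 := leastFull_cost_le i hsl (j₀ := 1) h.length_le (by omega)
      have hpos := Nat.zero_le (k * I.unit ^ 8)
      simp only [mediumLoop, Timed.cost_bind, tick_cost]
      rcases ha : (findSlot I (isLowFree I i X) 1 B).val with _ | j
      · rcases hc : (findSlot I (isRoomFree I i X) 1 B).val with _ | j₁
        · simp only [Timed.cost_bind, hc, Timed.cost_pure]; linarith
        · rcases hd : (leastFull I i X 1 B).val with _ | ⟨j, g⟩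
          · simp only [Timed.cost_bind, hc, hd, Timed.cost_pure]; linarith
          · obtain ⟨h1, h2, h3, -⟩ := leastFull_some hd
            have hn := SlotList.cons hX ((I.r_pos i).trans h2) (hB ▸ h3) hk
            have := ih hn.1 hn.2
            simp only [Timed.cost_bind, hc, hd]; linarith
      · obtain ⟨h1, h2, h3, -⟩ := findSlot_lowFree_some ha
        have hn := SlotList.cons hX ((I.r_pos i).trans h2) (hB ▸ h3) hk
        have := ih hn.1 hn.2
        simp only; linarith
  exact key.trans (I.mul_pow_le (by have := I.K_lt_unit; omega) 8)

theorem length_le_of_nodup {l : List (Fin I.n)} (h : l.Nodup) : l.length ≤ I.n := by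
  simpa using h.length_le_card

theorem Valid.insert {A : Finset (Fin I.n)} {B : Slots I} (h : Valid I A B) (i : Fin I.n) :
    Valid I (insert i A) B :=
  { h with sub := fun j i' hi' => Finset.mem_insert_of_mem (h.sub j i' hi') }

theorem not_mem_insert_of_nodup_cons {A : Finset (Fin I.n)} {i : Fin I.n} {t : List (Fin I.n)}
    (hn : (i :: t).Nodup) (hA : ∀ a ∈ i :: t, a ∉ A) : ∀ a ∈ t, a ∉ insert i A := by
  intro a ha hmem
  rcases Finset.mem_insert.1 hmem with rfl | hmem
  · exact (List.nodup_cons.1 hn).1 ha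
  · exact hA a (List.mem_cons_of_mem _ ha) hmem

theorem mediumAds_cost_le {L : List (Fin I.n)} {A : Finset (Fin I.n)} {B : Slots I}
    (h : Valid I A B) (hn : L.Nodup) (hA : ∀ i ∈ L, i ∉ A) :
    (mediumAds I L B).cost ≤ I.unit ^ 11 := by
  have key : (mediumAds I L B).cost ≤ (L.length + 1) * I.unit ^ 10 := by
    obtain ⟨p0, p1, p2, p3, p4, p5, p6, p7⟩ := I.unit_pows
    have p8 : 200 * I.unit ^ 8 ≤ I.unit ^ 9 := I.pow_step 8
    have p9 : 200 * I.unit ^ 9 ≤ I.unit ^ 10 := I.pow_step 9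
    induction L generalizing A B with
    | nil =>
      simp only [mediumAds, Timed.cost_bind, tick_cost, Timed.cost_pure, List.length_nil]; linarith
    | cons i t ih =>
      have hA' := not_mem_insert_of_nodup_cons hn hA
      have hn' := (List.nodup_cons.1 hn).2
      have hw := I.w_le_K i
      have c1 := readFreq_cost_le i
      have c2 := mediumLoop_cost_le i h (k := I.w i) (X := []) (by simp) (by simpa using hw)
      simp only [mediumAds, Timed.cost_bind, tick_cost, readFreq_val, List.length_cons]
      rcases ho : (mediumLoop I i B (I.w i) []).val with _ | X
      · have := ih (h.insert i) hn' hA'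
        simp only; linarith
      · have hX := mediumLoop_bounds h.length (by simp) (by simpa using hw) ho
        have c3 := addCopies_cost_le i hX (j₀ := 1) (B := B) (by rw [h.length]; omega)
        have := ih (h.addCopies (hA i (by simp)) hX.2) hn' hA'
        simp only [Timed.cost_bind]; linarith
  exact key.trans (I.mul_pow_le (by have := I.n_lt_unit; have := length_le_of_nodup hn; omega) 10)

theorem algMedium_cost_le {M : List (Fin I.n)} (hM : M.Nodup) :
    (algMedium I M).cost ≤ I.unit ^ 12 := by
  obtain ⟨p0, p1, p2, p3, p4, p5, p6, p7⟩ := I.unit_pows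
  have p8 : 200 * I.unit ^ 8 ≤ I.unit ^ 9 := I.pow_step 8
  have p9 : 200 * I.unit ^ 9 ≤ I.unit ^ 10 := I.pow_step 9
  have p10 : 200 * I.unit ^ 10 ≤ I.unit ^ 11 := I.pow_step 10
  have p11 : 200 * I.unit ^ 11 ≤ I.unit ^ 12 := I.pow_step 11
  have c1 := readK_cost_le I
  have c2 := emptySlots_cost_le (I := I) le_rfl
  have c3 := sortAds_cost_le (length_le_of_nodup hM)
  have c4 := mediumAds_cost_le (feasibleSlots_replicate I).toValid
    ((sortAds_perm I M).nodup_iff.2 hM) (by simp)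
  simp only [algMedium, Timed.cost_bind, tick_cost, readK_val, emptySlots_val]
  linarith

theorem smallLoop_bounds {i : Fin I.n} {A : Finset (Fin I.n)} {B : Slots I} (h : Valid I A B)
    {k : ℕ} {X : List ℕ} (hX : ∀ j ∈ X, 1 ≤ j ∧ j ≤ I.K) (hk : X.length + k ≤ I.K) :
    Valid I A (smallLoop I i k X B).val.1 ∧
      ∀ Y, (smallLoop I i k X B).val.2 = some Y → SlotList I Y := by
  induction k generalizing X B with
  | zero => exact ⟨h, fun Y hY => by cases hY; exact ⟨hk, hX⟩⟩
  | succ k ih =>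
    have hB := h.length
    rcases ha : (findSlot I (isLowFree I i X) 1 B).val with _ | j
    swap
    · obtain ⟨h1, h2, h3, -⟩ := findSlot_lowFree_some ha
      have := SlotList.cons hX ((I.r_pos i).trans h2) (hB ▸ h3) hk
      rw [smallLoop_low ha]
      exact ih h this.1 this.2
    by_cases huv : (findSlot I (isLowUsed I i X) 1 B).val = none ∨
        (findSlot I (isHighFree I i X) 1 B).val = none
    swap
    · rw [not_or] at huv
      obtain ⟨j₁, hu⟩ := Option.ne_none_iff_exists'.1 huv.1
      obtain ⟨j₂, hv⟩ := Option.ne_none_iff_exists'.1 huv.2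
      obtain ⟨u1, u2, u3, -⟩ := findSlot_lowUsed_some hu
      obtain ⟨v1, v2, v3, -⟩ := findSlot_highFree_some hv
      have := SlotList.cons hX ((I.r_pos i).trans v2) (hB ▸ v3) hk
      rw [smallLoop_move ha hu hv]
      exact ih (h.moveAds ((I.r_pos i).trans u2) (hB ▸ u3) ((I.r_pos i).trans v2) (hB ▸ v3)
        (by rintro rfl; exact v1 u1)) this.1 this.2
    rcases hc : (findSlot I (isRoomFree I i X) 1 B).val with _ | j₁
    · rw [smallLoop_discard ha huv hc]
      exact ⟨h, fun Y hY => by cases hY⟩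
    · rcases hd : (leastFull I i X 1 B).val with _ | ⟨j, g⟩
      · obtain ⟨g1, g2, g3, g4⟩ := findSlot_roomFree_some hc
        exact (leastFull_ne_none_aux ((I.r_pos i).trans g2) (by omega) g1 g2 hd).elim
      · obtain ⟨h1, h2, h3, -⟩ := leastFull_some hd
        have := SlotList.cons hX ((I.r_pos i).trans h2) (hB ▸ h3) hk
        rw [smallLoop_least ha huv hc hd]
        exact ih h this.1 this.2

theorem smallLoop_cost_le (i : Fin I.n) {A : Finset (Fin I.n)} {B : Slots I} (h : Valid I A B)
    {k : ℕ} {X : List ℕ} (hX : ∀ j ∈ X, 1 ≤ j ∧ j ≤ I.K) (hk : X.length + k ≤ I.K) :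
    (smallLoop I i k X B).cost ≤ I.unit ^ 9 := by
  have key : (smallLoop I i k X B).cost ≤ (k + 1) * I.unit ^ 8 := by
    obtain ⟨p0, p1, p2, p3, p4, p5, p6, p7⟩ := I.unit_pows
    induction k generalizing X B with
    | zero => simp only [smallLoop, Timed.cost_bind, tick_cost, Timed.cost_pure]; linarith
    | succ k ih =>
      have hB := h.length
      have hsl : SlotList I X := ⟨by omega, hX⟩
      have c0 := I.natBits_le_unit (a := k + 1) (I.le_bound_of_le (by omega))
      have c1 := findSlot_cost_le (fun j hj b hb => isLowFree_cost_le i hsl hj (h.length_le b hb))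
        (B := B) (j₀ := 1) (by omega)
      have c2 := findSlot_cost_le (fun j hj b hb => isLowUsed_cost_le i hsl hj (h.length_le b hb))
        (B := B) (j₀ := 1) (by omega)
      have c3 := findSlot_cost_le (fun j hj b hb => isHighFree_cost_le i hsl hj (h.length_le b hb))
        (B := B) (j₀ := 1) (by omega)
      have c4 := findSlot_cost_le (fun j hj b hb => isRoomFree_cost_le i hsl hj (h.length_le b hb))
        (B := B) (j₀ := 1) (by omega)
      have c5 := leastFull_cost_le i hsl (j₀ := 1) h.length_le (by omega)
      have hpos := Nat.zero_le (k * I.unit ^ 8)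
      -- Case (c) is reached when either search of case (b) fails; its cost is estimated once for
      -- both branches.
      have hlast : ((do
          let c ← findSlot I (isRoomFree I i X) 1 B
          match c with
          | none => pure (B, none)
          | some _ => do
            let d ← leastFull I i X 1 B
            match d with
            | none => pure (B, none)
            | some (j, _) => smallLoop I i k (j :: X) B) : Timed (Slots I × Option (List ℕ))).cost ≤
          (k + 1) * I.unit ^ 8 + I.unit ^ 7 + I.unit ^ 7 := by
        rcases hc : (findSlot I (isRoomFree I i X) 1 B).val with _ | j₁
        · simp only [Timed.cost_bind, hc, Timed.cost_pure]; linarith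
        · rcases hd : (leastFull I i X 1 B).val with _ | ⟨j, g⟩
          · simp only [Timed.cost_bind, hc, hd, Timed.cost_pure]; linarith
          · obtain ⟨h1, h2, h3, -⟩ := leastFull_some hd
            have hn := SlotList.cons hX ((I.r_pos i).trans h2) (hB ▸ h3) hk
            have := ih h hn.1 hn.2
            simp only [Timed.cost_bind, hc, hd]; linarith
      have hsum : ∀ z ≤ (k + 1) * I.unit ^ 8 + I.unit ^ 7 + I.unit ^ 7, natBits (k + 1) +
          ((findSlot I (isLowFree I i X) 1 B).cost + ((findSlot I (isLowUsed I i X) 1 B).cost +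
            ((findSlot I (isHighFree I i X) 1 B).cost + z))) ≤ (k + 1 + 1) * I.unit ^ 8 := by
        intro z hz; linarith
      rw [smallLoop, Timed.cost_bind, Timed.cost_bind, tick_cost]
      rcases ha : (findSlot I (isLowFree I i X) 1 B).val with _ | j
      swap
      · obtain ⟨h1, h2, h3, -⟩ := findSlot_lowFree_some ha
        have hn := SlotList.cons hX ((I.r_pos i).trans h2) (hB ▸ h3) hk
        have := ih h hn.1 hn.2
        simp only; linarith
      simp only
      rw [Timed.cost_bind, Timed.cost_bind]
      rcases hu : (findSlot I (isLowUsed I i X) 1 B).val with _ | j₁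
      · exact hsum _ hlast
      rcases hv : (findSlot I (isHighFree I i X) 1 B).val with _ | j₂
      · exact hsum _ hlast
      obtain ⟨u1, u2, u3, -⟩ := findSlot_lowUsed_some hu
      obtain ⟨v1, v2, v3, -⟩ := findSlot_highFree_some hv
      have hn := SlotList.cons hX ((I.r_pos i).trans v2) (hB ▸ v3) hk
      have c6 := moveAds_cost_le h ((I.r_pos i).trans u2) (hB ▸ u3) ((I.r_pos i).trans v2)
        (hB ▸ v3)
      have := ih (h.moveAds ((I.r_pos i).trans u2) (hB ▸ u3) ((I.r_pos i).trans v2) (hB ▸ v3)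
        (by rintro rfl; exact v1 u1)) hn.1 hn.2
      simp only [Timed.cost_bind]
      linarith
  exact key.trans (I.mul_pow_le (by have := I.K_lt_unit; omega) 8)

theorem smallAds_cost_le {L : List (Fin I.n)} {A : Finset (Fin I.n)} {B : Slots I}
    (h : Valid I A B) (hn : L.Nodup) (hA : ∀ i ∈ L, i ∉ A) :
    (smallAds I L B).cost ≤ I.unit ^ 11 := by
  have key : (smallAds I L B).cost ≤ (L.length + 1) * I.unit ^ 10 := by
    obtain ⟨p0, p1, p2, p3, p4, p5, p6, p7⟩ := I.unit_pows
    have p8 : 200 * I.unit ^ 8 ≤ I.unit ^ 9 := I.pow_step 8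
    have p9 : 200 * I.unit ^ 9 ≤ I.unit ^ 10 := I.pow_step 9
    induction L generalizing A B with
    | nil =>
      simp only [smallAds, Timed.cost_bind, tick_cost, Timed.cost_pure, List.length_nil]; linarith
    | cons i t ih =>
      have hA' := not_mem_insert_of_nodup_cons hn hA
      have hn' := (List.nodup_cons.1 hn).2
      have hw := I.w_le_K i
      have c1 := readFreq_cost_le i
      have c2 := smallLoop_cost_le i h (k := I.w i) (X := []) (by simp) (by simpa using hw)
      obtain ⟨hV, hS⟩ := smallLoop_bounds (i := i) h (k := I.w i) (X := []) (by simp)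
        (by simpa using hw)
      simp only [smallAds, Timed.cost_bind, tick_cost, readFreq_val, List.length_cons]
      rcases ho : (smallLoop I i (I.w i) [] B).val with ⟨B', _ | X⟩
      · rw [ho] at hV
        have := ih (hV.insert i) hn' hA'
        simp only; linarith
      · rw [ho] at hV hS
        have hX := hS X rfl
        have c3 := addCopies_cost_le i hX (j₀ := 1) (B := B') (by rw [hV.length]; omega)
        have := ih (hV.addCopies (hA i (by simp)) hX.2) hn' hA'
        simp only [Timed.cost_bind]; linarith
  exact key.trans (I.mul_pow_le (by have := I.n_lt_unit; have := length_le_of_nodup hn; omega) 10)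

theorem algSmall_cost_le {P : List (Fin I.n)} (hP : P.Nodup) :
    (algSmall I P).cost ≤ I.unit ^ 12 := by
  obtain ⟨p0, p1, p2, p3, p4, p5, p6, p7⟩ := I.unit_pows
  have p8 : 200 * I.unit ^ 8 ≤ I.unit ^ 9 := I.pow_step 8
  have p9 : 200 * I.unit ^ 9 ≤ I.unit ^ 10 := I.pow_step 9
  have p10 : 200 * I.unit ^ 10 ≤ I.unit ^ 11 := I.pow_step 10
  have p11 : 200 * I.unit ^ 11 ≤ I.unit ^ 12 := I.pow_step 11
  have c1 := readK_cost_le I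
  have c2 := emptySlots_cost_le (I := I) le_rfl
  have c3 := sortAds_cost_le (length_le_of_nodup hP)
  have c4 := smallAds_cost_le (feasibleSlots_replicate I).toValid
    ((sortAds_perm I P).nodup_iff.2 hP) (by simp)
  simp only [algSmall, Timed.cost_bind, tick_cost, readK_val, emptySlots_val]
  linarith

/-! ## Cost of the general algorithm -/

theorem better_cost_le {S T : Slots I} (hS : ∀ b ∈ S, b.length ≤ I.n) (hS' : S.length = I.K)
    (hT : ∀ b ∈ T, b.length ≤ I.n) (hT' : T.length = I.K) :
    (better I S T).cost ≤ I.unit ^ 7 := by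
  obtain ⟨p0, p1, p2, p3, p4, p5, p6, p7⟩ := I.unit_pows
  have c1 := totalValue_cost_le hS hS'.le
  have c2 := totalValue_cost_le hT hT'.le
  have c3 := leRat_cost_le (nice_slotsSum hT hT'.le) (nice_slotsSum hS hS'.le)
  simp only [better, Timed.cost_bind, tick_cost, totalValue_val]
  split_ifs <;> simp only [Timed.cost_pure] <;> linarith

theorem algGeneral_cost_le (I : Instance) : (algGeneral I).cost ≤ I.unit ^ 13 := by
  obtain ⟨⟨n₁, n₂, n₃⟩, m₁, m₂, m₃⟩ := splitAds_finRange I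
  have c0 := splitAds_cost_le (I := I) (l := List.finRange I.n) (by simp)
  have hval : (algGeneral I).cost = 1 + ((splitAds I (List.finRange I.n)).cost +
    ((algLarge I (splitAds I (List.finRange I.n)).val.1).cost +
    ((algMedium I (splitAds I (List.finRange I.n)).val.2.1).cost +
    ((algSmall I (splitAds I (List.finRange I.n)).val.2.2).cost +
    ((better I (algLarge I (splitAds I (List.finRange I.n)).val.1).val
      (algMedium I (splitAds I (List.finRange I.n)).val.2.1).val).cost +
    (better I (better I (algLarge I (splitAds I (List.finRange I.n)).val.1).val
      (algMedium I (splitAds I (List.finRange I.n)).val.2.1).val).val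
      (algSmall I (splitAds I (List.finRange I.n)).val.2.2).val).cost))))) := rfl
  rw [hval]
  set R := (splitAds I (List.finRange I.n)).val
  have v₁ := (algLarge_spec n₁).1.toValid
  have v₂ := (algMedium_spec n₂ fun i hi => (m₂ i).1 hi).1.toValid
  have v₃ := (algSmall_spec n₃ fun i hi => (m₃ i).1 hi).1.toValid
  have c1 := algLarge_cost_le (length_le_of_nodup n₁)
  have c2 := algMedium_cost_le n₂
  have c3 := algSmall_cost_le n₃
  have c4 := better_cost_le v₁.length_le v₁.length v₂.length_le v₂.length
  have c5 : (better I (better I (algLarge I R.1).val (algMedium I R.2.1).val).val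
      (algSmall I R.2.2).val).cost ≤ I.unit ^ 7 := by
    rw [better_val]
    split_ifs
    · exact better_cost_le v₁.length_le v₁.length v₃.length_le v₃.length
    · exact better_cost_le v₂.length_le v₂.length v₃.length_le v₃.length
  have p0 := I.unit_pows.1
  -- All contributions are raised to the exponent 12, and one more power absorbs their number.
  have hm : ∀ {a b : ℕ}, a ≤ b → I.unit ^ a ≤ I.unit ^ b := fun h =>
    Nat.pow_le_pow_right (by omega) h
  have q1 := hm (show 4 ≤ 12 by norm_num)
  have q2 := hm (show 8 ≤ 12 by norm_num)
  have q3 := hm (show 7 ≤ 12 by norm_num)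
  have q4 := hm (show 0 ≤ 12 by norm_num)
  have p12 : 200 * I.unit ^ 12 ≤ I.unit ^ 13 := I.pow_step 12
  rw [pow_zero] at q4
  linarith

end costs

end MaxSpace

theorem theorem1 :
    -- the general algorithm always returns a feasible schedule of value at least `OPT / 9`
    (∀ I : MaxSpace.Instance,
      MaxSpace.IsApproxSolution I Finset.univ (1 / 9) (MaxSpace.algGeneral I).val) ∧
    -- its running time is polynomial in the input size as long as `K` is polynomially bounded
    (∀ q : Polynomial ℕ, ∃ p : Polynomial ℕ, ∀ I : MaxSpace.Instance,
      I.K ≤ q.eval I.size → (MaxSpace.algGeneral I).cost ≤ p.eval I.size) ∧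
    -- its three subroutines: exact for large ads, `1/4`-approximate for medium and for small ads
    (∀ (I : MaxSpace.Instance) (A : List (Fin I.n)), A.Nodup →
      ((∀ i ∈ A, 1 / 2 < I.s i) →
        MaxSpace.IsApproxSolution I A.toFinset 1 (MaxSpace.algLarge I A).val) ∧
      ((∀ i ∈ A, 1 / 4 < I.s i ∧ I.s i ≤ 1 / 2) →
        MaxSpace.IsApproxSolution I A.toFinset (1 / 4) (MaxSpace.algMedium I A).val) ∧
      ((∀ i ∈ A, I.s i ≤ 1 / 4) →
        MaxSpace.IsApproxSolution I A.toFinset (1 / 4) (MaxSpace.algSmall I A).val)) := by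
  refine ⟨MaxSpace.isApproxSolution_algGeneral, fun q => ?_, fun I A hA => ⟨fun h => ?_, fun h => ?_,
    fun h => ?_⟩⟩
  -- This is `unit ^ 13` with `K` replaced by its bound `q`.
  · refine ⟨(100 * (Polynomial.X + q + 2)) ^ 13, fun I hI => ?_⟩
    refine (MaxSpace.algGeneral_cost_le I).trans ?_
    simp only [Polynomial.eval_pow, Polynomial.eval_mul, Polynomial.eval_add, Polynomial.eval_X,
      Polynomial.eval_ofNat]
    refine Nat.pow_le_pow_left ?_ 13
    rw [MaxSpace.Instance.unit, MaxSpace.Instance.bound]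
    omega
  · exact MaxSpace.isApproxSolution_algLarge hA h
  · exact (MaxSpace.algMedium_spec hA h).1.quarter (MaxSpace.algMedium_spec hA h).2
  · exact (MaxSpace.algSmall_spec hA h).1.quarter (MaxSpace.algSmall_spec hA h).2
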